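/- Throughout, a \emph{gauge function} is a continuous, strictly increasing $q:[0,r)\to[0,\infty)$ with $q(0)=0$, where $r\in(0,\infty]$; $q^{-1}$ is its inverse, defined on the range of $q$. Call $q$ \emph{$d$-regular} if it is differentiable on $(0,r)$, with derivative $\dot q$, and there are Borel functions $\varphi,\psi$ and $c_0,a>0$ such that $q(\rho\tau)\le\varphi(\tau)q(\rho)$ and $\dot q(\rho\tau)\le\rho^{-1}\psi(\tau)q(\rho\tau)$ for all $\rho,\tau\in(0,c_0]$, and $\int_0^1\log^p(1+a\tau^{-2d})\,\varphi(\tau)\psi(\tau)\,d\tau<\infty$ for all $p\ge1$. $B_\varepsilon(x)$ is the open Euclidean ball, $S^{(\eta)}$ is the set of points at distance less than $\eta$ from $S$, and $d,d_1,d_2,D\ge1$ are integers. The index $1$ on a field denotes its first component, and a tilde denotes the field minus its mean. Let $z\in\mathbb R^D$. For a random field $X=\{X(x),\,x\in T\}$ with values in $\mathbb R^D$, a set $S\subset T$ and a function $m\ge0$ on $S\times S$, let $(H)$ denote the following conditions, for all $x,\bar x\in S$: (1) $c_1\le \mathrm{Var}(X_1(x))\le c_2$ for some constants $c_1,c_2>0$;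 (2) $\mathrm{Corr}(X_1(x),X_1(\bar x))<1$ if $x\ne\bar x$; (3) $|\mathrm{Var}(X_1(x))-\mathrm{Var}(X_1(\bar x))|\le c_3\|X_1(x)-X_1(\bar x)\|_{L^2(\Omega)}^{1+\kappa}$ for some constants $\kappa,c_3>0$; (4) $\|\tilde X_1(x)-\tilde X_1(\bar x)\|_{L^2(\Omega)}\asymp m(x,\bar x)$ and $|E X(x)-E X(\bar x)|\le C\,m(x,\bar x)$, with constants uniform in $x,\bar x$. \textbf{(a)} Let $M=\{M(x),\,x\in\mathbb R^d\}$ be an $\mathbb R^D$-valued Gaussian random field with a.s. continuous sample paths and i.i.d. components, $K\subset\mathbb R^d$ a compact set of positive Lebesgue measure, and $q:[0,r)\to[0,\infty)$ a $d$-regular gauge function with $\mathrm{diam}(K)<r$. Put $$g_q(\tau)=\frac{\tau^D}{(q^{-1}(\tau))^d},\qquad v_q(\tau)=\int_{q^{-1}(\tau)}^{\mathrm{diam}(K)}q(\rho)^{-D}\rho^{d-1}\,d\rho ,$$ where $v_q(\tau)$ is read as $0$ if $q^{-1}(\tau)>\mathrm{diam}(K)$. Assume that for some $\eta>0$: $\inf_{x\in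 K^{(\eta)}}\mathrm{Var}(M_1(x))>0$, and there are $C,\varepsilon_0>0$ such that for all $\varepsilon\in(0,\varepsilon_0)$ and $x\in K^{(\eta)}$ $$E\int_{B_\varepsilon(x)}dy\int_{B_\varepsilon(x)}d\bar y\,\exp\Big(\frac{|M(y)-M(\bar y)|}{q(|y-\bar y|)}\Big)\le C\varepsilon^{2d}.$$ Assume that $(H)$ holds for $X=M$, $S=K$, $m(x,\bar x)=q(|x-\bar x|)$, and that $\sup_\tau v_q(\tau)g_q(\tau)\in(0,\infty)$, the supremum being over the $\tau\in(0,\mathrm{diam}(K)]$ in the range of $q$. Then $$P\big(M(K)\cap\{z\}\ne\emptyset\big)=0\iff\lim_{\tau\downarrow0}g_q(\tau)=0.$$ \textbf{(b)} Let $U=\{U(t,x),\,(t,x)\in\mathbb R^{d_1}\times\mathbb R^{d_2}\}$ be an $\mathbb R^D$-valued Gaussian random field with a.s. continuous sample paths and i.i.d. components, $I\subset\mathbb R^{d_1}$, $J\subset\mathbb R^{d_2}$ compact sets of positive Lebesgue measure, and $q_i:[0,r_i)\to[0,\infty)$ a $d_i$-regular gauge function ($i=1,2$) whose derivative is decreasing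 on some interval $(0,\delta)$, with $\mathrm{diam}(I)<r_1$ and $\mathrm{diam}(J)<r_2$. Put $c_{I,J}=\max(q_1(\mathrm{diam}(I)),q_2(\mathrm{diam}(J)))$ and $$\bar g_q(\tau)=\frac{\tau^D}{(q_1^{-1}(\tau))^{d_1}(q_2^{-1}(\tau))^{d_2}},\qquad \bar v_q(\tau)=\int_\tau^{c_{I,J}}\rho^{-D+1}\,\frac{(q_1^{-1}(\rho))^{d_1-1}(q_2^{-1}(\rho))^{d_2-1}}{\dot q_1(q_1^{-1}(\rho))\,\dot q_2(q_2^{-1}(\rho))}\,d\rho,$$ the integral being over those $\rho$ that lie in the ranges of both $q_1$ and $q_2$. Assume that for some $\eta>0$: $\inf_{I^{(\eta)}\times J^{(\eta)}}\mathrm{Var}(U_1(t,x))>0$, and there are $C,\varepsilon_0>0$ such that for all $\varepsilon\in(0,\varepsilon_0)$, $t\in I^{(\eta)}$ and $x\in J^{(\eta)}$ $$E\sup_{y\in J^{(\eta)}}\int_{B_\varepsilon(t)}ds\int_{B_\varepsilon(t)}d\bar s\,\exp\Big(\frac{|U(s,y)-U(\bar s,y)|}{q_1(|s-\bar s|)}\Big)\le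 C\varepsilon^{2d_1},$$ $$E\sup_{s\in I^{(\eta)}}\int_{B_\varepsilon(x)}dy\int_{B_\varepsilon(x)}d\bar y\,\exp\Big(\frac{|U(s,y)-U(s,\bar y)|}{q_2(|y-\bar y|)}\Big)\le C\varepsilon^{2d_2}.$$ Assume that $(H)$ holds for $X=U$, $S=I\times J$, $m((t,x),(s,y))=q_1(|t-s|)+q_2(|x-y|)$, and that $\sup_\tau\bar v_q(\tau/2)\,\bar g_q(\tau)\in(0,\infty)$, the supremum being over the $\tau\in(0,c_{I,J}]$ in the ranges of both $q_1$ and $q_2$. Then $$P\big(U(I\times J)\cap\{z\}\ne\emptyset\big)=0\iff\lim_{\tau\downarrow0}\bar g_q(\tau)=0.$$ -/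

import Mathlib

open MeasureTheory ProbabilityTheory Set Filter Topology
open scoped ENNReal

noncomputable section

/-- The domain `[0, r)` of a gauge function, where `r = ∞` is allowed. -/
def gaugeDomain (r : ℝ≥0∞) : Set ℝ := {x | 0 ≤ x ∧ ENNReal.ofReal x < r}

/-- `q : [0, r) → [0, ∞)` is a gauge function: continuous, strictly increasing, `q 0 = 0`. -/
structure IsGauge (r : ℝ≥0∞) (q : ℝ → ℝ) : Prop where
  pos : 0 < r
  zero : q 0 = 0
  strictMono : StrictMonoOn q (gaugeDomain r)
  cont : ContinuousOn q (gaugeDomain r)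

/-- The range of the gauge function `q : [0, r) → [0, ∞)`. -/
def gaugeRange (r : ℝ≥0∞) (q : ℝ → ℝ) : Set ℝ := q '' gaugeDomain r

/-- The inverse of the gauge function `q : [0, r) → [0, ∞)`, meaningful on `gaugeRange r q`. -/
def gaugeInv (r : ℝ≥0∞) (q : ℝ → ℝ) (τ : ℝ) : ℝ := Function.invFunOn q (gaugeDomain r) τ

/-- A differentiable gauge function with the growth properties
`q (ρ τ) ≤ φ τ * q ρ` and `q' (ρ τ) ≤ ρ⁻¹ * ψ τ * q (ρ τ)` for small `ρ, τ`, where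
`∫₀¹ log (1 + a / τ ^ (2 d)) ^ p * (φ τ * ψ τ) dτ < ∞` for all `p ≥ 1`. -/
structure IsRegularGauge (d : ℕ) (r : ℝ≥0∞) (q : ℝ → ℝ) : Prop extends IsGauge r q where
  diff : ∀ x ∈ gaugeDomain r, 0 < x → DifferentiableAt ℝ q x
  growth : ∃ φ ψ : ℝ → ℝ, Measurable φ ∧ Measurable ψ ∧
    (∃ c₀ : ℝ, 0 < c₀ ∧ ∀ ρ ∈ Ioc 0 c₀, ∀ τ ∈ Ioc 0 c₀,
      q (ρ * τ) ≤ φ τ * q ρ ∧ deriv q (ρ * τ) ≤ ρ⁻¹ * ψ τ * q (ρ * τ)) ∧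
    ∃ a : ℝ, 0 < a ∧ ∀ p : ℝ, 1 ≤ p →
      ∫⁻ τ in Ioc (0 : ℝ) 1,
        ENNReal.ofReal (Real.log (1 + a / τ ^ (2 * d)) ^ p * (φ τ * ψ τ)) < ⊤

/-- `g_q τ = τ ^ D / (q⁻¹ τ) ^ d`. -/
def gFun (d D : ℕ) (r : ℝ≥0∞) (q : ℝ → ℝ) (τ : ℝ) : ℝ :=
  τ ^ D / gaugeInv r q τ ^ d

/-- `ḡ_q τ = τ ^ D / ((q₁⁻¹ τ) ^ d₁ * (q₂⁻¹ τ) ^ d₂)`. -/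
def gBarFun (d₁ d₂ D : ℕ) (r₁ r₂ : ℝ≥0∞) (q₁ q₂ : ℝ → ℝ) (τ : ℝ) : ℝ :=
  τ ^ D / (gaugeInv r₁ q₁ τ ^ d₁ * gaugeInv r₂ q₂ τ ^ d₂)

/-- `v_q τ = ∫ q(ρ) ^ (-D) * ρ ^ (d - 1) dρ` over `ρ` from `q⁻¹ τ` to `Δ`, in `[0, ∞]`. -/
def vFun (d D : ℕ) (r : ℝ≥0∞) (q : ℝ → ℝ) (Δ τ : ℝ) : ℝ≥0∞ :=
  ∫⁻ ρ in Ioc (gaugeInv r q τ) Δ, ENNReal.ofReal (ρ ^ (d - 1) / q ρ ^ D)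

/-- `v̄_q τ`: the integral over `ρ` from `τ` to `c` (with `ρ` in the domain of `q₁⁻¹` and `q₂⁻¹`) of
`ρ ^ (1 - D) * (q₁⁻¹ ρ) ^ (d₁ - 1) * (q₂⁻¹ ρ) ^ (d₂ - 1) * (q₁' (q₁⁻¹ ρ))⁻¹ * (q₂' (q₂⁻¹ ρ))⁻¹`,
in `[0, ∞]`. -/
def vBarFun (d₁ d₂ D : ℕ) (r₁ r₂ : ℝ≥0∞) (q₁ q₂ : ℝ → ℝ) (c τ : ℝ) : ℝ≥0∞ :=
  ∫⁻ ρ in Ioc τ c ∩ (gaugeRange r₁ q₁ ∩ gaugeRange r₂ q₂),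
    ENNReal.ofReal (ρ ^ (1 - (D : ℤ)) * gaugeInv r₁ q₁ ρ ^ (d₁ - 1) * gaugeInv r₂ q₂ ρ ^ (d₂ - 1)) *
      (ENNReal.ofReal (deriv q₁ (gaugeInv r₁ q₁ ρ)))⁻¹ *
      (ENNReal.ofReal (deriv q₂ (gaugeInv r₂ q₂ ρ)))⁻¹

/-- The set `A` is polar for the random field `X` restricted to `S`: `P (X(S) ∩ A ≠ ∅) = 0`. -/
def IsPolarOn {Ω T F : Type*} [MeasurableSpace Ω] (P : Measure Ω) (X : T → Ω → F)
    (S : Set T) (A : Set F) : Prop :=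
  P {ω | ((fun x => X x ω) '' S ∩ A).Nonempty} = 0

/-- A Gaussian random field with values in `ℝ^D`, with almost surely continuous sample paths and
independent identically distributed components (each component being a real-valued process). -/
structure IsGaussianField {Ω T : Type*} [MeasurableSpace Ω] [TopologicalSpace T] {D : ℕ}
    (P : Measure Ω) (X : T → Ω → EuclideanSpace ℝ (Fin D)) : Prop where
  meas : ∀ x, Measurable (X x)
  gaussian : IsGaussianProcess X P
  cont : ∀ᵐ ω ∂P, Continuous fun x => X x ω
  indep : iIndepFun (fun (i : Fin D) (ω : Ω) (x : T) => X x ω i) P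
  ident : ∀ i j : Fin D,
    IdentDistrib (fun (ω : Ω) (x : T) => X x ω i) (fun (ω : Ω) (x : T) => X x ω j) P P

/-- The double integral of `exp (|h y - h y'| / q |y - y'|)` over `B_ε(x) × B_ε(x)`. -/
def expOsc {d D : ℕ} (q : ℝ → ℝ) (h : EuclideanSpace ℝ (Fin d) → EuclideanSpace ℝ (Fin D))
    (x : EuclideanSpace ℝ (Fin d)) (ε : ℝ) : ℝ≥0∞ :=
  ∫⁻ y in Metric.ball x ε, ∫⁻ y' in Metric.ball x ε,
    ENNReal.ofReal (Real.exp (‖h y - h y'‖ / q (dist y y')))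

/-- Hypotheses of the upper bound for a single gauge function. The set `K^(η)` of points at distance
less than `η` from `K` is `Metric.thickening η K`; the components of `M` being identically
distributed, the variance is that of the first component. -/
def UpperHypM {Ω : Type*} [MeasurableSpace Ω] {d D : ℕ} [NeZero D] (P : Measure Ω)
    (M : EuclideanSpace ℝ (Fin d) → Ω → EuclideanSpace ℝ (Fin D))
    (K : Set (EuclideanSpace ℝ (Fin d))) (r : ℝ≥0∞) (q : ℝ → ℝ) : Prop :=
  IsRegularGauge d r q ∧ ∃ η : ℝ, 0 < η ∧
    (∃ s : ℝ, 0 < s ∧ ∀ x ∈ Metric.thickening η K, s ≤ Var[fun ω => M x ω 0; P]) ∧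
    ∃ C ε₀ : ℝ, 0 < ε₀ ∧ ∀ ε ∈ Ioo 0 ε₀, ∀ x ∈ Metric.thickening η K,
      ∫⁻ ω, expOsc q (fun y => M y ω) x ε ∂P ≤ ENNReal.ofReal (C * ε ^ (2 * d))

/-- Hypotheses of the upper bound for two gauge functions. -/
def UpperHypU {Ω : Type*} [MeasurableSpace Ω] {d₁ d₂ D : ℕ} [NeZero D] (P : Measure Ω)
    (U : EuclideanSpace ℝ (Fin d₁) × EuclideanSpace ℝ (Fin d₂) → Ω → EuclideanSpace ℝ (Fin D))
    (I : Set (EuclideanSpace ℝ (Fin d₁))) (J : Set (EuclideanSpace ℝ (Fin d₂)))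
    (r₁ r₂ : ℝ≥0∞) (q₁ q₂ : ℝ → ℝ) : Prop :=
  IsRegularGauge d₁ r₁ q₁ ∧ IsRegularGauge d₂ r₂ q₂ ∧ ∃ η : ℝ, 0 < η ∧
    (∃ s : ℝ, 0 < s ∧ ∀ p ∈ Metric.thickening η I ×ˢ Metric.thickening η J,
      s ≤ Var[fun ω => U p ω 0; P]) ∧
    ∃ C ε₀ : ℝ, 0 < ε₀ ∧ ∀ ε ∈ Ioo 0 ε₀,
      (∀ t ∈ Metric.thickening η I,
        ∫⁻ ω, ⨆ x ∈ Metric.thickening η J, expOsc q₁ (fun s => U (s, x) ω) t ε ∂P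
          ≤ ENNReal.ofReal (C * ε ^ (2 * d₁))) ∧
      (∀ x ∈ Metric.thickening η J,
        ∫⁻ ω, ⨆ t ∈ Metric.thickening η I, expOsc q₂ (fun y => U (t, y) ω) x ε ∂P
          ≤ ENNReal.ofReal (C * ε ^ (2 * d₂)))

/-- `‖Y‖` in `L²(P)`. -/
def l2norm {Ω : Type*} [MeasurableSpace Ω] (P : Measure Ω) (Y : Ω → ℝ) : ℝ :=
  (eLpNorm Y 2 P).toReal

/-- The centred first component `X₁(x) - E X₁(x)`. -/
def centredFst {Ω T : Type*} [MeasurableSpace Ω] {D : ℕ} [NeZero D] (P : Measure Ω)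
    (X : T → Ω → EuclideanSpace ℝ (Fin D)) (x : T) (ω : Ω) : ℝ :=
  X x ω 0 - ∫ ω', X x ω' 0 ∂P

/-- The structural hypotheses of the lower bound for a field `X` on the set `S`, with canonical
pseudo-metric comparable to `m`. -/
structure LowerHyp {Ω T : Type*} [MeasurableSpace Ω] {D : ℕ} [NeZero D] (P : Measure Ω)
    (X : T → Ω → EuclideanSpace ℝ (Fin D)) (S : Set T) (m : T → T → ℝ) : Prop where
  var_bounds : ∃ c₁ c₂ : ℝ, 0 < c₁ ∧ 0 < c₂ ∧ ∀ x ∈ S,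
    c₁ ≤ Var[fun ω => X x ω 0; P] ∧ Var[fun ω => X x ω 0; P] ≤ c₂
  corr_lt_one : ∀ x ∈ S, ∀ y ∈ S, x ≠ y →
    cov[fun ω => X x ω 0, fun ω => X y ω 0; P] /
      (√Var[fun ω => X x ω 0; P] * √Var[fun ω => X y ω 0; P]) < 1
  var_diff : ∃ κ c₃ : ℝ, 0 < κ ∧ 0 < c₃ ∧ ∀ x ∈ S, ∀ y ∈ S,
    |Var[fun ω => X x ω 0; P] - Var[fun ω => X y ω 0; P]|
      ≤ c₃ * l2norm P (fun ω => X x ω 0 - X y ω 0) ^ (1 + κ)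
  metric_equiv : ∃ c C : ℝ, 0 < c ∧ 0 < C ∧ ∀ x ∈ S, ∀ y ∈ S,
    c * m x y ≤ l2norm P (fun ω => centredFst P X x ω - centredFst P X y ω) ∧
      l2norm P (fun ω => centredFst P X x ω - centredFst P X y ω) ≤ C * m x y
  mean_bound : ∃ C : ℝ, ∀ x ∈ S, ∀ y ∈ S,
    ‖(∫ ω, X x ω ∂P) - ∫ ω, X y ω ∂P‖ ≤ C * m x y

/-- Hypotheses of the lower bound for a single gauge function. -/
def LowerHypM {Ω : Type*} [MeasurableSpace Ω] {d D : ℕ} [NeZero D] (P : Measure Ω)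
    (M : EuclideanSpace ℝ (Fin d) → Ω → EuclideanSpace ℝ (Fin D))
    (K : Set (EuclideanSpace ℝ (Fin d))) (r : ℝ≥0∞) (q : ℝ → ℝ) : Prop :=
  Metric.diam K ∈ gaugeDomain r ∧
  LowerHyp P M K (fun x y => q (dist x y)) ∧
  (⨆ τ ∈ Ioc 0 (Metric.diam K) ∩ gaugeRange r q,
    vFun d D r q (Metric.diam K) τ * ENNReal.ofReal (gFun d D r q τ)) ∈ Ioo 0 ⊤

/-- `c_{I,J} = max (q₁ (diam I)) (q₂ (diam J))`. -/
def cIJ {d₁ d₂ : ℕ} (I : Set (EuclideanSpace ℝ (Fin d₁))) (J : Set (EuclideanSpace ℝ (Fin d₂)))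
    (q₁ q₂ : ℝ → ℝ) : ℝ :=
  max (q₁ (Metric.diam I)) (q₂ (Metric.diam J))

/-- Hypotheses of the lower bound for two gauge functions. -/
def LowerHypU {Ω : Type*} [MeasurableSpace Ω] {d₁ d₂ D : ℕ} [NeZero D] (P : Measure Ω)
    (U : EuclideanSpace ℝ (Fin d₁) × EuclideanSpace ℝ (Fin d₂) → Ω → EuclideanSpace ℝ (Fin D))
    (I : Set (EuclideanSpace ℝ (Fin d₁))) (J : Set (EuclideanSpace ℝ (Fin d₂)))
    (r₁ r₂ : ℝ≥0∞) (q₁ q₂ : ℝ → ℝ) : Prop :=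
  Metric.diam I ∈ gaugeDomain r₁ ∧ Metric.diam J ∈ gaugeDomain r₂ ∧
  LowerHyp P U (I ×ˢ J) (fun a b => q₁ (dist a.1 b.1) + q₂ (dist a.2 b.2)) ∧
  (∃ δ : ℝ, 0 < δ ∧ AntitoneOn (deriv q₁) (Ioo 0 δ) ∧ AntitoneOn (deriv q₂) (Ioo 0 δ)) ∧
  (⨆ τ ∈ Ioc 0 (cIJ I J q₁ q₂) ∩ (gaugeRange r₁ q₁ ∩ gaugeRange r₂ q₂),
    vBarFun d₁ d₂ D r₁ r₂ q₁ q₂ (cIJ I J q₁ q₂) (τ / 2) *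
      ENNReal.ofReal (gBarFun d₁ d₂ D r₁ r₂ q₁ q₂ τ)) ∈ Ioo 0 ⊤

end

/-! ### Gaussian random variables -/

/-! Both directions rest on regressing a Gaussian coordinate $X$ on one of its values:
$X(y)=a(y)X(x)+Z(y)$, where the process $Z$ is uncorrelated with $X(x)$, hence independent of it
(`indepFun_regResidual`).

Decay of $g_q$ gives polarity. If $X(y)=z$ for some $y$ within $\varepsilon/2$ of $x$, then $a(y)\ge
1/2$ for small $\varepsilon$ and $|X(x)-z|\le 2(|1-a(y)||z|+|Z(y)|)$. The right side is dominated by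
a variable independent of $X(x)$ with expectation $O(q(\varepsilon))$. Indeed, regularity of the
gauge gives $q(\varepsilon 2^{-k})\lesssim q(\varepsilon)(k+1)^{-3}$
(`IsRegularGauge.exists_decay`), which beats the linear growth of the logarithmic cardinality of
dyadic nets, so chaining controls $E\sup|Z|$. As $X(x)$ has bounded density, one coordinate hits
with probability $O(q(\varepsilon))$ (`ChainData.exists_measurableSet_hit`), and $D$ independent
coordinates with probability $O(q(\varepsilon)^D)$. Summing over $O(\varepsilon^{-d})$ balls yields
a multiple of $g_q(q(\varepsilon))$. With two gauges, the balls become boxes of sides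
$q_i^{-1}(\tau)$.

Conversely, if $g_q\not\to0$, boundedness of $v_qg_q$ keeps $v_q$ bounded for arbitrarily small
$\tau$, so $\int_0 q^{-D}\rho^{d-1}d\rho$ converges and Lebesgue measure has finite energy for the
kernel $m^{-D}$. At short distances the conditional variance of $X(y)$ given $X(x)$ is at least
$c\,m(x,y)^2$ (`LowerHyp.exists_sq_le_variance_regResidual`), so two-point densities are $O(1/m)$.
The second moment method for the volume of the set where $M$ is $\varepsilon$-close to $z$ bounds
the probability of a near hit below uniformly in $\varepsilon$, and compactness turns near hits into
a hit (`IsGaussianField.not_isPolarOn`). With two gauges the energy integral is split according to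
which gauge dominates, and decreasing derivatives bound each half by $\bar v_q$
(`lintegral_lintegral_le_vBarDensity`). -/

theorem gaussianPDFReal_le {μ s : ℝ} {v : NNReal} (hs : 0 < s) (hv : s ≤ v) (x : ℝ) :
    gaussianPDFReal μ v x ≤ (√s)⁻¹ := by
  have hv0 : (0 : ℝ) < v := hs.trans_le hv
  rw [gaussianPDFReal]
  have h1 : Real.exp (-(x - μ) ^ 2 / (2 * v)) ≤ 1 := by
    rw [Real.exp_le_one_iff]
    exact div_nonpos_of_nonpos_of_nonneg (by nlinarith [sq_nonneg (x - μ)]) (by positivity)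
  have h2 : (√(2 * Real.pi * v))⁻¹ ≤ (√s)⁻¹ := by
    gcongr
    nlinarith [Real.pi_gt_three]
  calc _ ≤ (√s)⁻¹ * 1 := by gcongr
    _ = _ := mul_one _

/-- The density is at most $s^{-1/2}$ and the interval has length $2R$. The radius is allowed to be
infinite because the chaining bound that later plays its role may be. -/
theorem measure_enorm_sub_le {Ω : Type*} [MeasurableSpace Ω] {P : Measure Ω} {ξ : Ω → ℝ}
    (h : HasGaussianLaw ξ P) {s : ℝ} (hs : 0 < s) (hv : s ≤ Var[ξ; P]) (a : ℝ) (R : ℝ≥0∞) :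
    P.map ξ {x | ‖x - a‖ₑ ≤ R} ≤ ENNReal.ofReal (2 / √s) * R := by
  have hs' : 0 < √s := Real.sqrt_pos.2 hs
  rcases eq_or_ne R ⊤ with rfl | hR
  · rw [ENNReal.mul_top]
    · exact le_top
    · simpa using by positivity
  have hv' : s ≤ (Var[ξ; P].toNNReal : ℝ) := hv.trans (Real.le_coe_toNNReal _)
  have hv0 : Var[ξ; P].toNNReal ≠ 0 := by
    intro h0
    rw [h0] at hv'
    simp at hv'
    linarith
  have hset : {x : ℝ | ‖x - a‖ₑ ≤ R} = Metric.closedBall a R.toReal := by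
    ext x
    simp only [mem_ofPred_eq, Metric.mem_closedBall, Real.dist_eq]
    rw [← ofReal_norm, ENNReal.ofReal_le_iff_le_toReal hR, Real.norm_eq_abs]
  rw [h.map_eq_gaussianReal, gaussianReal_apply _ hv0, hset]
  calc ∫⁻ x in Metric.closedBall a R.toReal, gaussianPDF _ _ x
      ≤ ∫⁻ x in Metric.closedBall a R.toReal, ENNReal.ofReal (√s)⁻¹ := by
        refine lintegral_mono fun x => ?_
        exact ENNReal.ofReal_le_ofReal (gaussianPDFReal_le hs hv' x)
    _ = ENNReal.ofReal (2 / √s) * R := by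
        rw [lintegral_const, Measure.restrict_apply_univ, Real.volume_closedBall,
          ← ENNReal.ofReal_mul (by positivity), ← ENNReal.ofReal_toReal hR,
          ← ENNReal.ofReal_mul (by positivity), ENNReal.toReal_ofReal (by positivity)]
        congr 1
        ring

/-- Conditioning on the independent radius reduces to a fixed one. This turns a bound on the
expected size of the residual into a hitting probability. -/
theorem measure_enorm_sub_le_of_indepFun {Ω : Type*} [MeasurableSpace Ω] {P : Measure Ω}
    [IsProbabilityMeasure P] {ξ : Ω → ℝ} (h : HasGaussianLaw ξ P) (hξ : Measurable ξ) {s : ℝ}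
    (hs : 0 < s) (hv : s ≤ Var[ξ; P]) (a : ℝ) {R : Ω → ℝ≥0∞} (hR : Measurable R)
    (hind : IndepFun ξ R P) :
    P {ω | ‖ξ ω - a‖ₑ ≤ R ω} ≤ ENNReal.ofReal (2 / √s) * ∫⁻ ω, R ω ∂P := by
  have hm : MeasurableSet {p : ℝ × ℝ≥0∞ | ‖p.1 - a‖ₑ ≤ p.2} :=
    measurableSet_le (by fun_prop) (by fun_prop)
  have hprod := (indepFun_iff_map_prod_eq_prod_map_map hξ.aemeasurable hR.aemeasurable).1 hind
  have : IsProbabilityMeasure (P.map ξ) := Measure.isProbabilityMeasure_map hξ.aemeasurable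
  have : IsProbabilityMeasure (P.map R) := Measure.isProbabilityMeasure_map hR.aemeasurable
  calc P {ω | ‖ξ ω - a‖ₑ ≤ R ω}
      = P.map (fun ω => (ξ ω, R ω)) {p : ℝ × ℝ≥0∞ | ‖p.1 - a‖ₑ ≤ p.2} := by
        rw [Measure.map_apply (by fun_prop) hm]; rfl
    _ = ∫⁻ r, P.map ξ {x | ‖x - a‖ₑ ≤ r} ∂(P.map R) := by
        rw [hprod, Measure.prod_apply_symm hm]; rfl
    _ ≤ ∫⁻ r, ENNReal.ofReal (2 / √s) * r ∂(P.map R) :=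
        lintegral_mono fun r => measure_enorm_sub_le h hs hv a r
    _ = ENNReal.ofReal (2 / √s) * ∫⁻ ω, R ω ∂P := by
        rw [lintegral_const_mul _ measurable_id', lintegral_map measurable_id' hR]

/-- Since $\varepsilon\le1$, the interval stays within $A+1$ of the mean, where the density is
bounded below. -/
theorem le_measure_enorm_sub_le {Ω : Type*} [MeasurableSpace Ω] {P : Measure Ω} {ξ : Ω → ℝ}
    (h : HasGaussianLaw ξ P) (hξ : Measurable ξ) {s s' A a : ℝ} (hs : 0 < s) (hv : s ≤ Var[ξ; P])
    (hv' : Var[ξ; P] ≤ s') (hA : |a - ∫ ω, ξ ω ∂P| ≤ A) {ε : ℝ} (hε : 0 < ε) (hε1 : ε ≤ 1) :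
    ENNReal.ofReal (2 * ((√(2 * Real.pi * s'))⁻¹ * Real.exp (-(A + 1) ^ 2 / (2 * s))) * ε) ≤
      P {ω | ‖ξ ω - a‖ₑ ≤ ENNReal.ofReal ε} := by
  have hV : (Var[ξ; P].toNNReal : ℝ) = Var[ξ; P] := Real.coe_toNNReal _ (variance_nonneg _ _)
  have hv0 : Var[ξ; P].toNNReal ≠ 0 := by
    intro h0
    rw [h0] at hV
    simp at hV
    linarith
  have hset : {x : ℝ | ‖x - a‖ₑ ≤ ENNReal.ofReal ε} = Metric.closedBall a ε := by
    ext x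
    simp only [mem_ofPred_eq, Metric.mem_closedBall, Real.dist_eq]
    rw [← ofReal_norm, ENNReal.ofReal_le_ofReal_iff hε.le, Real.norm_eq_abs]
  have hms : MeasurableSet {x : ℝ | ‖x - a‖ₑ ≤ ENNReal.ofReal ε} := by
    rw [hset]; exact Metric.isClosed_closedBall.measurableSet
  have hmap : P {ω | ‖ξ ω - a‖ₑ ≤ ENNReal.ofReal ε} =
      P.map ξ {x : ℝ | ‖x - a‖ₑ ≤ ENNReal.ofReal ε} := by
    rw [Measure.map_apply hξ hms]; rfl
  rw [hmap, h.map_eq_gaussianReal, gaussianReal_apply _ hv0, hset]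
  have hA0 : 0 ≤ A := (abs_nonneg _).trans hA
  calc ENNReal.ofReal (2 * ((√(2 * Real.pi * s'))⁻¹ * Real.exp (-(A + 1) ^ 2 / (2 * s))) * ε)
      = ∫⁻ x in Metric.closedBall a ε,
          ENNReal.ofReal ((√(2 * Real.pi * s'))⁻¹ * Real.exp (-(A + 1) ^ 2 / (2 * s))) := by
        rw [lintegral_const, Measure.restrict_apply_univ, Real.volume_closedBall,
          ← ENNReal.ofReal_mul (by positivity)]
        congr 1
        ring
    _ ≤ ∫⁻ x in Metric.closedBall a ε, gaussianPDF _ _ x := by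
        refine setLIntegral_mono' Metric.isClosed_closedBall.measurableSet fun x hx => ?_
        refine ENNReal.ofReal_le_ofReal ?_
        rw [gaussianPDFReal, hV]
        have hVp : 0 < Var[ξ; P] := hs.trans_le hv
        rw [Metric.mem_closedBall, Real.dist_eq] at hx
        have hx' : |x - ∫ ω, ξ ω ∂P| ≤ A + 1 := by
          have := abs_sub_le x a (∫ ω, ξ ω ∂P)
          linarith
        gcongr ?_ * Real.exp ?_
        · gcongr
        · rw [neg_div, neg_div, neg_le_neg_iff]
          have : (x - ∫ ω, ξ ω ∂P) ^ 2 ≤ (A + 1) ^ 2 := by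
            rw [← sq_abs]; gcongr
          gcongr

/-- From $e^{|u|}\le e^u+e^{-u}$ and the Gaussian moment generating function at $\pm1/\delta$. The
bound does not depend on $\delta$, so it serves every chaining scale. -/
theorem lintegral_exp_abs_div_le {Ω : Type*} [MeasurableSpace Ω] {P : Measure Ω} {Y : Ω → ℝ}
    (h : HasGaussianLaw Y P) {C δ : ℝ} (hδ : 0 < δ) (hm : |∫ ω, Y ω ∂P| ≤ C * δ)
    (hv : Var[Y; P] ≤ (C * δ) ^ 2) :
    ∫⁻ ω, ENNReal.ofReal (Real.exp (|Y ω| / δ)) ∂P ≤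
      ENNReal.ofReal (2 * Real.exp (C + C ^ 2 / 2)) := by
  have hV : (Var[Y; P].toNNReal : ℝ) = Var[Y; P] := Real.coe_toNNReal _ (variance_nonneg _ _)
  have key : ∀ t : ℝ, |t| = 1 / δ →
      ∫⁻ ω, ENNReal.ofReal (Real.exp (t * Y ω)) ∂P ≤ ENNReal.ofReal (Real.exp (C + C ^ 2 / 2)) := by
    intro t ht
    have hint : Integrable (fun ω => Real.exp (t * Y ω)) P := by
      have := integrable_exp_mul_gaussianReal (μ := ∫ ω, Y ω ∂P) (v := Var[Y; P].toNNReal) t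
      rw [← h.map_eq_gaussianReal] at this
      exact this.comp_aemeasurable h.aemeasurable
    rw [← ofReal_integral_eq_lintegral_ofReal hint (ae_of_all _ fun _ => (Real.exp_pos _).le)]
    refine ENNReal.ofReal_le_ofReal ?_
    have := mgf_gaussianReal h.map_eq_gaussianReal t
    rw [mgf] at this
    rw [this, hV]
    have ht2 : t ^ 2 = 1 / δ ^ 2 := by rw [← sq_abs, ht]; ring
    gcongr
    · calc (∫ ω, Y ω ∂P) * t ≤ |(∫ ω, Y ω ∂P) * t| := le_abs_self _
        _ = |∫ ω, Y ω ∂P| * (1 / δ) := by rw [abs_mul, ht]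
        _ ≤ C * δ * (1 / δ) := by gcongr
        _ = C := by field_simp
    · rw [ht2]
      calc Var[Y; P] * (1 / δ ^ 2) ≤ (C * δ) ^ 2 * (1 / δ ^ 2) := by gcongr
        _ = C ^ 2 := by field_simp
  calc ∫⁻ ω, ENNReal.ofReal (Real.exp (|Y ω| / δ)) ∂P
      ≤ ∫⁻ ω, (ENNReal.ofReal (Real.exp (1 / δ * Y ω)) +
          ENNReal.ofReal (Real.exp (-(1 / δ) * Y ω))) ∂P := by
        refine lintegral_mono fun ω => ?_
        rcases abs_choice (Y ω) with h' | h' <;> simp only [h']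
        · refine le_trans (le_of_eq ?_) le_self_add
          congr 2; ring
        · refine le_trans (le_of_eq ?_) le_add_self
          congr 2; ring
    _ = ∫⁻ ω, ENNReal.ofReal (Real.exp (1 / δ * Y ω)) ∂P +
          ∫⁻ ω, ENNReal.ofReal (Real.exp (-(1 / δ) * Y ω)) ∂P := by
        refine lintegral_add_left' ?_ _
        have := h.aemeasurable
        fun_prop
    _ ≤ ENNReal.ofReal (Real.exp (C + C ^ 2 / 2)) + ENNReal.ofReal (Real.exp (C + C ^ 2 / 2)) :=
        add_le_add (key _ (abs_of_pos (by positivity)))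
          (key _ (by rw [abs_neg]; exact abs_of_pos (by positivity)))
    _ = _ := by rw [← ENNReal.ofReal_add (by positivity) (by positivity), two_mul]

/-! ### Regression of a Gaussian process on one of its values -/

/-- The regression coefficient of `X y` on `X x`. -/
noncomputable def regCoef {Ω T : Type*} [MeasurableSpace Ω] (P : Measure Ω) (X : T → Ω → ℝ)
    (x y : T) : ℝ := cov[X y, X x; P] / Var[X x; P]

/-- The part of `X y` that is left after regression on `X x`. -/
noncomputable def regResidual {Ω T : Type*} [MeasurableSpace Ω] (P : Measure Ω) (X : T → Ω → ℝ)
    (x y : T) (ω : Ω) : ℝ := X y ω - regCoef P X x y * X x ω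

section Regression

variable {Ω T : Type*} [MeasurableSpace Ω] {P : Measure Ω} {X : T → Ω → ℝ}

theorem regCoef_self {x : T} (hx : 0 < Var[X x; P]) (hm : AEMeasurable (X x) P) :
    regCoef P X x x = 1 := by
  rw [regCoef, covariance_self hm, div_self hx.ne']

theorem measurable_regResidual (hm : ∀ x, Measurable (X x)) (x y : T) :
    Measurable (regResidual P X x y) :=
  (hm y).sub ((hm x).const_mul _)

theorem memLp_two_of_isGaussianProcess (hX : IsGaussianProcess X P) (x : T) : MemLp (X x) 2 P :=
  (hX.hasGaussianLaw_eval x).memLp_two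

/-- Adjoining $X(x)$ to all residuals in one Gaussian process lets zero covariance be upgraded to
independence from the whole residual process. -/
theorem isGaussianProcess_elim_regResidual (hX : IsGaussianProcess X P) (x : T) :
    IsGaussianProcess (Sum.elim (fun _ : Unit => X x) (regResidual P X x)) P := by
  classical
  refine hX.of_isGaussianProcess fun s => ?_
  rcases s with _ | y
  · exact ⟨{x}, ContinuousLinearMap.proj ⟨x, by simp⟩, fun ω => by simp⟩
  · refine ⟨{x, y}, ContinuousLinearMap.proj ⟨y, by simp⟩ -
      regCoef P X x y • ContinuousLinearMap.proj ⟨x, by simp⟩, fun ω => ?_⟩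
    simp [regResidual]

theorem isGaussianProcess_regResidual (hX : IsGaussianProcess X P) (x : T) :
    IsGaussianProcess (regResidual P X x) P :=
  (isGaussianProcess_elim_regResidual hX x).comp_right Sum.inr

variable [IsProbabilityMeasure P]

theorem covariance_regResidual (hX : IsGaussianProcess X P) {x : T} (hx : 0 < Var[X x; P])
    (y : T) : cov[X x, regResidual P X x y; P] = 0 := by
  have h2 := memLp_two_of_isGaussianProcess hX
  unfold regResidual
  rw [covariance_fun_sub_right (h2 x) (h2 y) ((h2 x).const_mul _), covariance_const_mul_right,
    covariance_self (hX.aemeasurable x), regCoef, div_mul_cancel₀ _ hx.ne', covariance_comm,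
    sub_self]

theorem indepFun_regResidual (hX : IsGaussianProcess X P) (hm : ∀ x, Measurable (X x)) {x : T}
    (hx : 0 < Var[X x; P]) : IndepFun (X x) (fun ω y => regResidual P X x y ω) P := by
  have h := (isGaussianProcess_elim_regResidual hX x).indepFun_of_covariance_eq_zero
    (fun _ => (hm x).aemeasurable) (fun y => (measurable_regResidual hm x y).aemeasurable)
    (fun _ y => covariance_regResidual hX hx y)
  exact h.comp (φ := fun f : Unit → ℝ => f ()) (measurable_pi_apply _) measurable_id

theorem variance_sub_div_variance_mul {W ξ : Ω → ℝ} (hW : MemLp W 2 P) (hξ : MemLp ξ 2 P)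
    (h0 : 0 < Var[ξ; P]) :
    Var[fun ω => W ω - cov[W, ξ; P] / Var[ξ; P] * ξ ω; P] =
      Var[W; P] - cov[W, ξ; P] ^ 2 / Var[ξ; P] := by
  rw [variance_fun_sub hW (hξ.const_mul _), covariance_const_mul_right, variance_const_mul]
  field_simp
  ring

theorem sq_covariance_le {W ξ : Ω → ℝ} (hW : MemLp W 2 P) (hξ : MemLp ξ 2 P)
    (h0 : 0 < Var[ξ; P]) : cov[W, ξ; P] ^ 2 ≤ Var[W; P] * Var[ξ; P] := by
  have := variance_sub_div_variance_mul hW hξ h0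
  have h := variance_nonneg (fun ω => W ω - cov[W, ξ; P] / Var[ξ; P] * ξ ω) P
  rw [this, sub_nonneg, div_le_iff₀ h0] at h
  exact h

theorem regCoef_sub_regCoef (hX : IsGaussianProcess X P) (x y y' : T) :
    regCoef P X x y - regCoef P X x y' =
      cov[fun ω => X y ω - X y' ω, X x; P] / Var[X x; P] := by
  have h2 := memLp_two_of_isGaussianProcess hX
  rw [covariance_fun_sub_left (h2 y) (h2 y') (h2 x), regCoef, regCoef, sub_div]

theorem sq_regCoef_sub_regCoef_le (hX : IsGaussianProcess X P) {x : T} (hx : 0 < Var[X x; P])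
    (y y' : T) : (regCoef P X x y - regCoef P X x y') ^ 2 ≤
      Var[fun ω => X y ω - X y' ω; P] / Var[X x; P] := by
  have h2 := memLp_two_of_isGaussianProcess hX
  rw [regCoef_sub_regCoef hX, div_pow, le_div_iff₀ hx, div_mul_eq_mul_div, div_le_iff₀ (by positivity)]
  have := sq_covariance_le ((h2 y).sub (h2 y')) (h2 x) hx
  simp only [Pi.sub_def] at this
  nlinarith

theorem variance_regResidual (hX : IsGaussianProcess X P) {x : T} (hx : 0 < Var[X x; P])
    (y : T) : Var[regResidual P X x y; P] = Var[X y; P] - cov[X y, X x; P] ^ 2 / Var[X x; P] :=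
  variance_sub_div_variance_mul (memLp_two_of_isGaussianProcess hX y)
    (memLp_two_of_isGaussianProcess hX x) hx

/-- The increment of the residual is the residual of the increment, and projection does not increase
variance; so the residual inherits the increment bounds of the field. -/
theorem variance_regResidual_sub_le (hX : IsGaussianProcess X P) {x : T} (hx : 0 < Var[X x; P])
    (y y' : T) : Var[fun ω => regResidual P X x y ω - regResidual P X x y' ω; P] ≤
      Var[fun ω => X y ω - X y' ω; P] := by
  have h2 := memLp_two_of_isGaussianProcess hX
  have h := variance_sub_div_variance_mul ((h2 y).sub (h2 y')) (h2 x) hx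
  simp only [Pi.sub_def] at h
  rw [← regCoef_sub_regCoef hX] at h
  have he : (fun ω => regResidual P X x y ω - regResidual P X x y' ω) =
      fun ω => X y ω - X y' ω - (regCoef P X x y - regCoef P X x y') * X x ω := by
    ext ω; simp only [regResidual]; ring
  rw [he, h]
  exact sub_le_self _ (by positivity)

theorem integral_regResidual_sub (hX : IsGaussianProcess X P) (x y y' : T) :
    ∫ ω, (regResidual P X x y ω - regResidual P X x y' ω) ∂P =
      ∫ ω, X y ω ∂P - ∫ ω, X y' ω ∂P -
        (regCoef P X x y - regCoef P X x y') * ∫ ω, X x ω ∂P := by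
  have hi : ∀ x, Integrable (X x) P := fun x =>
    (memLp_two_of_isGaussianProcess hX x).integrable (by norm_num)
  have he : (fun ω => regResidual P X x y ω - regResidual P X x y' ω) =
      fun ω => X y ω - X y' ω - (regCoef P X x y - regCoef P X x y') * X x ω := by
    ext ω; simp only [regResidual]; ring
  have h1 : Integrable (fun ω => X y ω - X y' ω) P := (hi y).sub (hi y')
  rw [he, integral_sub h1 ((hi x).const_mul _), integral_sub (hi y) (hi y'), integral_const_mul]

end Regression

/-! ### Chaining -/

/-- The chaining bound for the increments of `f` along the finite sets of pairs `F n`, at scales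
`δ n` and with logarithmic cardinalities `L n`. -/
noncomputable def chainBound {T : Type*} (F : ℕ → Finset (T × T)) (δ L : ℕ → ℝ) (f : T → ℝ) :
    ℝ≥0∞ :=
  ∑' n, ENNReal.ofReal (δ n) * (ENNReal.ofReal (L n) +
    ∑ p ∈ F n, ENNReal.ofReal (Real.exp (|f p.2 - f p.1| / δ n - L n)))

section Chaining

variable {T : Type*} {F : ℕ → Finset (T × T)} {δ L : ℕ → ℝ}

theorem measurable_chainBound : Measurable (chainBound F δ L) := by
  unfold chainBound
  refine Measurable.tsum fun n => ?_
  refine Measurable.const_mul (Measurable.const_add (Finset.measurable_fun_sum _ fun p _ => ?_) _) _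
  have h1 : Measurable fun f : T → ℝ => f p.1 := measurable_pi_apply _
  have h2 : Measurable fun f : T → ℝ => f p.2 := measurable_pi_apply _
  have : Measurable fun f : T → ℝ => |f p.2 - f p.1| :=
    continuous_abs.measurable.comp (h2.sub h1)
  fun_prop

/-- The inequality $u\le L+e^{u-L}$ replaces a maximum over links by a sum of exponentials, whose
expectation is easy to bound. -/
theorem enorm_sub_le_chainBound_term (hδ : ∀ n, 0 < δ n) (f : T → ℝ) {n : ℕ} {p : T × T}
    (hp : p ∈ F n) :
    ‖f p.2 - f p.1‖ₑ ≤ ENNReal.ofReal (δ n) * (ENNReal.ofReal (L n) +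
      ∑ p ∈ F n, ENNReal.ofReal (Real.exp (|f p.2 - f p.1| / δ n - L n))) := by
  have hδn := hδ n
  calc ‖f p.2 - f p.1‖ₑ = ENNReal.ofReal |f p.2 - f p.1| := by
        rw [← ofReal_norm, Real.norm_eq_abs]
    _ ≤ ENNReal.ofReal (δ n * (L n + Real.exp (|f p.2 - f p.1| / δ n - L n))) := by
        refine ENNReal.ofReal_le_ofReal ?_
        have := Real.add_one_le_exp (|f p.2 - f p.1| / δ n - L n)
        rw [← div_le_iff₀' hδn]
        linarith
    _ ≤ ENNReal.ofReal (δ n) * (ENNReal.ofReal (L n) +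
          ENNReal.ofReal (Real.exp (|f p.2 - f p.1| / δ n - L n))) := by
        rw [ENNReal.ofReal_mul hδn.le]
        gcongr
        exact ENNReal.ofReal_add_le
    _ ≤ _ := by
        gcongr
        exact Finset.single_le_sum
          (f := fun p : T × T => ENNReal.ofReal (Real.exp (|f p.2 - f p.1| / δ n - L n)))
          (fun _ _ => zero_le) hp

theorem enorm_sub_le_chainBound (hδ : ∀ n, 0 < δ n) {c : ℕ → T}
    (hc : ∀ n, (c n, c (n + 1)) ∈ F n) (f : T → ℝ) (N : ℕ) :
    ‖f (c N) - f (c 0)‖ₑ ≤ chainBound F δ L f := by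
  calc ‖f (c N) - f (c 0)‖ₑ = ‖∑ n ∈ Finset.range N, (f (c (n + 1)) - f (c n))‖ₑ := by
        rw [Finset.sum_range_sub fun n => f (c n)]
    _ ≤ ∑ n ∈ Finset.range N, ‖f (c (n + 1)) - f (c n)‖ₑ := enorm_sum_le _ _
    _ ≤ _ := Finset.sum_le_sum fun n _ => enorm_sub_le_chainBound_term (L := L) hδ f (hc n)
    _ ≤ _ := ENNReal.sum_le_tsum _

theorem enorm_sub_le_chainBound_of_tendsto (hδ : ∀ n, 0 < δ n) {c : ℕ → T}
    (hc : ∀ n, (c n, c (n + 1)) ∈ F n) (f : T → ℝ) {y : T}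
    (hf : Tendsto (fun n => f (c n)) atTop (𝓝 (f y))) :
    ‖f y - f (c 0)‖ₑ ≤ chainBound F δ L f :=
  le_of_tendsto (hf.sub_const _).enorm
    (Eventually.of_forall fun N => enorm_sub_le_chainBound hδ hc f N)

/-- Each link has a bounded exponential moment at scale `δ n`, and the factor $e^{-L_n}$ compensates
for the at most $e^{L_n}$ links of order $n$. -/
theorem lintegral_chainBound_le {Ω : Type*} [MeasurableSpace Ω] {P : Measure Ω}
    {Z : T → Ω → ℝ} (hZ : IsGaussianProcess Z P) (hm : ∀ x, Measurable (Z x)) {C : ℝ}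
    (hδ : ∀ n, 0 < δ n) (hF : ∀ n, ((F n).card : ℝ) ≤ Real.exp (L n))
    (hmean : ∀ n, ∀ p ∈ F n, |∫ ω, (Z p.2 ω - Z p.1 ω) ∂P| ≤ C * δ n)
    (hvar : ∀ n, ∀ p ∈ F n, Var[fun ω => Z p.2 ω - Z p.1 ω; P] ≤ (C * δ n) ^ 2) :
    ∫⁻ ω, chainBound F δ L (fun y => Z y ω) ∂P ≤
      ∑' n, ENNReal.ofReal (δ n) * (ENNReal.ofReal (L n) +
        ENNReal.ofReal (2 * Real.exp (C + C ^ 2 / 2))) := by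
  have := hZ.isProbabilityMeasure
  have hmeas : ∀ n, ∀ p : T × T, Measurable fun ω =>
      ENNReal.ofReal (Real.exp (|Z p.2 ω - Z p.1 ω| / δ n - L n)) := by
    intro n p
    have h : Measurable fun ω => |Z p.2 ω - Z p.1 ω| :=
      continuous_abs.measurable.comp ((hm _).sub (hm _))
    fun_prop
  unfold chainBound
  rw [lintegral_tsum]
  swap
  · intro n
    refine (Measurable.const_mul (Measurable.const_add
      (Finset.measurable_fun_sum _ fun p _ => hmeas n p) _) _).aemeasurable
  refine ENNReal.tsum_le_tsum fun n => ?_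
  rw [lintegral_const_mul _
    (Measurable.const_add (Finset.measurable_fun_sum _ fun p _ => hmeas n p) _)]
  gcongr
  rw [lintegral_add_left measurable_const, lintegral_const, measure_univ, mul_one]
  gcongr
  rw [lintegral_finsetSum _ fun p _ => hmeas n p]
  calc ∑ p ∈ F n, ∫⁻ ω, ENNReal.ofReal (Real.exp (|Z p.2 ω - Z p.1 ω| / δ n - L n)) ∂P
      ≤ ∑ p ∈ F n, ENNReal.ofReal (2 * Real.exp (C + C ^ 2 / 2)) *
          ENNReal.ofReal (Real.exp (-L n)) := by
        refine Finset.sum_le_sum fun p hp => ?_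
        have h1 : ∀ ω, ENNReal.ofReal (Real.exp (|Z p.2 ω - Z p.1 ω| / δ n - L n)) =
            ENNReal.ofReal (Real.exp (|Z p.2 ω - Z p.1 ω| / δ n)) *
              ENNReal.ofReal (Real.exp (-L n)) := by
          intro ω
          rw [← ENNReal.ofReal_mul (by positivity), ← Real.exp_add, sub_eq_add_neg]
        simp_rw [h1]
        rw [lintegral_mul_const' _ _ ENNReal.ofReal_ne_top]
        gcongr
        exact lintegral_exp_abs_div_le hZ.hasGaussianLaw_fun_sub (hδ n) (hmean n p hp) (hvar n p hp)
    _ = ENNReal.ofReal ((F n).card * (2 * Real.exp (C + C ^ 2 / 2) * Real.exp (-L n))) := by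
        rw [Finset.sum_const, nsmul_eq_mul, ENNReal.ofReal_mul (Nat.cast_nonneg _),
          ENNReal.ofReal_natCast, ENNReal.ofReal_mul (p := 2 * Real.exp _) (by positivity)]
    _ ≤ _ := by
        refine ENNReal.ofReal_le_ofReal ?_
        calc (F n).card * (2 * Real.exp (C + C ^ 2 / 2) * Real.exp (-L n))
            ≤ Real.exp (L n) * (2 * Real.exp (C + C ^ 2 / 2) * Real.exp (-L n)) := by
              gcongr; exact hF n
          _ = (Real.exp (L n) * Real.exp (-L n)) * (2 * Real.exp (C + C ^ 2 / 2)) := by ring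
          _ = _ := by rw [← Real.exp_add, add_neg_cancel, Real.exp_zero, one_mul]

end Chaining

/-! ### Chains and the hitting estimate for one coordinate -/

/-- Chains in `S`, all starting at `x`, that approximate every point of `S`: the links of order `n`
belong to the finite set `F n`, whose cardinality is at most `exp (L n)`, and the `n`-th point of
each chain is `δ n`-close to the limit for `m`. -/
structure ChainData {T : Type*} [TopologicalSpace T] (m : T → T → ℝ) (x : T) (S : Set T)
    (F : ℕ → Finset (T × T)) (δ L : ℕ → ℝ) : Prop where
  exists_chain : ∀ y ∈ S, ∃ c : ℕ → T, c 0 = x ∧ (∀ n, (c n, c (n + 1)) ∈ F n) ∧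
    Tendsto c atTop (𝓝 y) ∧ ∀ n, c n ∈ S ∧ m y (c n) ≤ δ n
  link_le : ∀ n, ∀ p ∈ F n, p.1 ∈ S ∧ p.2 ∈ S ∧ m p.2 p.1 ≤ δ n
  pos : ∀ n, 0 < δ n
  nonneg : ∀ n, 0 ≤ L n
  card_le : ∀ n, ((F n).card : ℝ) ≤ Real.exp (L n)

/-- The constant in the hitting estimate `ChainData.exists_measurableSet_hit`. -/
noncomputable def hitConst (s C A : ℝ) : ℝ :=
  2 / √s * (2 * (C * A / √s +
    2 * Real.exp ((C + C * A / √s) + (C + C * A / √s) ^ 2 / 2)))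

/-- If $f(y)=z$, then $a(y)(f(x)-z)=(1-a(y))z-(f(y)-a(y)f(x))$, and $a(y)\ge1/2$ bounds $|f(x)-z|$
through the residual. The result is stated with a measurable set of paths containing the hitting
event, which need not itself be measurable in the product σ-algebra, so that independence of the
coordinates can be applied. -/
theorem ChainData.exists_measurableSet_hit {Ω T : Type*} [MeasurableSpace Ω] [TopologicalSpace T]
    {P : Measure Ω} [IsProbabilityMeasure P] {X : T → Ω → ℝ} (hX : IsGaussianProcess X P)
    (hm : ∀ x, Measurable (X x)) {x : T} {S : Set T} {F : ℕ → Finset (T × T)} {δ L : ℕ → ℝ}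
    {m : T → T → ℝ} (hm0 : ∀ a ∈ S, ∀ b ∈ S, 0 ≤ m a b) (hch : ChainData m x S F δ L) {s C A Δ z : ℝ}
    (hs : 0 < s) (hC : 0 < C) (hA : 0 ≤ A) (hΔ : 0 ≤ Δ)
    (hvx : s ≤ Var[X x; P]) (hmx : |∫ ω, X x ω ∂P| ≤ A) (hz : |z| ≤ A)
    (hmean : ∀ a ∈ S, ∀ b ∈ S, |∫ ω, X a ω ∂P - ∫ ω, X b ω ∂P| ≤ C * m a b)
    (hvar : ∀ a ∈ S, ∀ b ∈ S, Var[fun ω => X a ω - X b ω; P] ≤ (C * m a b) ^ 2)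
    (hsmall : C * δ 0 / √s ≤ 1 / 2)
    (hsum : ∑' n, ENNReal.ofReal (δ n) * ENNReal.ofReal (L n + 1) ≤ ENNReal.ofReal Δ) :
    ∃ B : Set (T → ℝ), MeasurableSet B ∧ (∀ f : T → ℝ, Continuous f → (∃ y ∈ S, f y = z) → f ∈ B) ∧
      P {ω | (fun y => X y ω) ∈ B} ≤ ENNReal.ofReal (hitConst s C A * Δ) := by
  have hs' : 0 < √s := Real.sqrt_pos.2 hs
  have hvx0 : 0 < Var[X x; P] := hs.trans_le hvx
  have hδ := hch.pos
  have hCδ0 : 0 ≤ C * δ 0 / √s := by have := hδ 0; positivity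
  set a := regCoef P X x with ha
  set g : (T → ℝ) → T → ℝ := fun f y => f y - a y * f x with hg
  set C' := C + C * A / √s with hC'
  have hgm : Measurable g := measurable_pi_lambda _ fun y =>
    (measurable_pi_apply y).sub ((measurable_pi_apply x).const_mul _)
  -- Only countably many values of the residual enter, so this is measurable; the factor 2 bounds
  -- $1/a(y)$.
  set R : (T → ℝ) → ℝ≥0∞ :=
    fun f => 2 * (ENNReal.ofReal (C * δ 0 / √s * A) + chainBound F δ L f) with hR
  have hRm : Measurable R := (measurable_chainBound.const_add _).const_mul _
  have hcoef : ∀ y y' : T, ∀ ε : ℝ, 0 ≤ ε → Var[fun ω => X y ω - X y' ω; P] ≤ ε ^ 2 →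
      |a y - a y'| ≤ ε / √s := by
    intro y y' ε hε h
    refine abs_le_of_sq_le_sq ?_ (by positivity)
    rw [div_pow, Real.sq_sqrt hs.le]
    refine (sq_regCoef_sub_regCoef_le hX hvx0 y y').trans ?_
    gcongr
  have hax : a x = 1 := regCoef_self hvx0 (hm x).aemeasurable
  -- As `L n + 1 ≥ 1`, convergence of the series forces `δ n → 0`. This gives convergence of the
  -- coefficients $a$ along chains without assuming $a$ continuous.
  have hδ0 : Tendsto δ atTop (𝓝 0) := by
    have h1 : Tendsto (fun n => ENNReal.ofReal (δ n)) atTop (𝓝 0) := by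
      refine tendsto_of_tendsto_of_tendsto_of_le_of_le tendsto_const_nhds
        (ENNReal.tendsto_atTop_zero_of_tsum_ne_top (hsum.trans_lt ENNReal.ofReal_lt_top).ne)
        (fun _ => zero_le) fun n => le_mul_of_one_le_right' ?_
      rw [← ENNReal.ofReal_one]
      exact ENNReal.ofReal_le_ofReal (by linarith [hch.nonneg n])
    have h2 := (ENNReal.tendsto_toReal ENNReal.zero_ne_top).comp h1
    refine h2.congr fun n => ?_
    exact ENNReal.toReal_ofReal (hδ n).le
  refine ⟨{f | ‖f x - z‖ₑ ≤ R (g f)}, ?_, ?_, ?_⟩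
  · exact measurableSet_le ((measurable_pi_apply x).sub_const _).enorm (hRm.comp hgm)
  · rintro f hf ⟨y, hy, hfy⟩
    obtain ⟨c, hc0, hcF, hcy, hcm⟩ := hch.exists_chain y hy
    have hac : ∀ n, |a y - a (c n)| ≤ C * δ n / √s := fun n =>
      hcoef y (c n) _ (by have := hδ n; positivity) ((hvar y hy _ (hcm n).1).trans (by
        have := hm0 y hy _ (hcm n).1
        gcongr
        exact (hcm n).2))
    have hay : |a y - a x| ≤ C * δ 0 / √s := hc0 ▸ hac 0
    rw [hax] at hay
    have hay' := abs_le.1 hay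
    have haypos : 1 / 2 ≤ a y := by linarith
    have hgx : g f x = 0 := by simp [hg, hax]
    have hrem : ‖f y - a y * f x‖ₑ ≤ chainBound F δ L (g f) := by
      have hgc : Tendsto (fun n => g f (c n)) atTop (𝓝 (g f y)) := by
        have hat : Tendsto (fun n => a (c n)) atTop (𝓝 (a y)) := by
          refine tendsto_iff_dist_tendsto_zero.2 (squeeze_zero (fun _ => dist_nonneg) (fun n => ?_)
            (by simpa using (hδ0.const_mul C).div_const √s))
          rw [dist_comm, Real.dist_eq]
          exact hac n
        exact ((hf.tendsto y).comp hcy).sub (hat.mul_const _)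
      have := enorm_sub_le_chainBound_of_tendsto (L := L) hδ hcF (g f) hgc
      rwa [hc0, hgx, sub_zero] at this
    have hreal : |f x - z| ≤ 2 * (C * δ 0 / √s * A + |f y - a y * f x|) := by
      have e : a y * (f x - z) = (1 - a y) * z - (f y - a y * f x) := by rw [hfy]; ring
      have h2 : |a y * (f x - z)| ≤ C * δ 0 / √s * A + |f y - a y * f x| := by
        rw [e]
        refine (abs_sub _ _).trans ?_
        gcongr
        rw [abs_mul, abs_sub_comm]
        gcongr
      rw [abs_mul, abs_of_nonneg (by linarith)] at h2
      nlinarith [abs_nonneg (f x - z)]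
    rw [mem_ofPred_eq]
    calc ‖f x - z‖ₑ = ENNReal.ofReal |f x - z| := by rw [← ofReal_norm, Real.norm_eq_abs]
      _ ≤ ENNReal.ofReal (2 * (C * δ 0 / √s * A + |f y - a y * f x|)) :=
          ENNReal.ofReal_le_ofReal hreal
      _ ≤ 2 * (ENNReal.ofReal (C * δ 0 / √s * A) + ‖f y - a y * f x‖ₑ) := by
          rw [ENNReal.ofReal_mul (by norm_num), ENNReal.ofReal_ofNat, ← ofReal_norm,
            Real.norm_eq_abs]
          gcongr
          exact ENNReal.ofReal_add_le
      _ ≤ R (g f) := by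
          rw [hR]; dsimp only; gcongr
  · have hind := indepFun_regResidual hX hm hvx0
    have hRω : Measurable fun ω => R (fun y => regResidual P X x y ω) :=
      hRm.comp (measurable_pi_lambda _ fun y => measurable_regResidual hm x y)
    have hbd := measure_enorm_sub_le_of_indepFun (hX.hasGaussianLaw_eval x) (hm x) hs hvx z hRω
      (hind.comp measurable_id hRm)
    refine hbd.trans ?_
    have hδ00 := hδ 0
    -- The constant `C'` adds to `C` the drift that the increments of $a$ create by multiplying the
    -- mean of $X(x)$.
    have hint := lintegral_chainBound_le (F := F) (L := L) (C := C')
      (isGaussianProcess_regResidual hX x) (measurable_regResidual hm x) hδ hch.card_le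
      (fun n p hp => by
        have hδn := hδ n
        rw [integral_regResidual_sub hX]
        refine (abs_sub _ _).trans ?_
        rw [hC', add_mul]
        gcongr
        · obtain ⟨h1, h2, h3⟩ := hch.link_le n p hp
          exact (hmean _ h2 _ h1).trans (by gcongr)
        · rw [abs_mul]
          calc _ ≤ C * δ n / √s * A := by
                gcongr
                obtain ⟨h1, h2, h3⟩ := hch.link_le n p hp
                have := hm0 _ h2 _ h1
                exact hcoef _ _ _ (by positivity) ((hvar _ h2 _ h1).trans (by gcongr))
            _ = _ := by ring)
      (fun n p hp => by
        have hδn := hδ n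
        obtain ⟨h1, h2, h3⟩ := hch.link_le n p hp
        refine (variance_regResidual_sub_le hX hvx0 _ _).trans ((hvar _ h2 _ h1).trans ?_)
        have := hm0 _ h2 _ h1
        gcongr
        rw [hC']
        exact le_add_of_nonneg_right (by positivity))
    set K := 2 * Real.exp (C' + C' ^ 2 / 2) with hK
    have hC'0 : 0 ≤ C' := by positivity
    have hK1 : 1 ≤ K := by
      have := Real.one_le_exp (show 0 ≤ C' + C' ^ 2 / 2 by positivity)
      rw [hK]; linarith
    -- The zeroth term alone gives `δ 0 ≤ Δ`, so the contribution of $(1-a(y))z$ is also of order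
    -- `Δ`.
    have hδΔ : ENNReal.ofReal (δ 0) ≤ ENNReal.ofReal Δ := by
      refine le_trans ?_ hsum
      refine le_trans ?_ (ENNReal.le_tsum 0)
      refine le_mul_of_one_le_right' ?_
      rw [← ENNReal.ofReal_one]
      exact ENNReal.ofReal_le_ofReal (by linarith [hch.nonneg 0])
    have hδΔ' : δ 0 ≤ Δ := (ENNReal.ofReal_le_ofReal_iff hΔ).1 hδΔ
    have hint2 : ∫⁻ ω, chainBound F δ L (fun y => regResidual P X x y ω) ∂P ≤
        ENNReal.ofReal (K * Δ) := by
      refine hint.trans ?_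
      calc _ ≤ ∑' n, ENNReal.ofReal K * (ENNReal.ofReal (δ n) * ENNReal.ofReal (L n + 1)) := by
            refine ENNReal.tsum_le_tsum fun n => ?_
            have := hch.nonneg n
            rw [← ENNReal.ofReal_add this (by linarith), mul_left_comm,
              ← ENNReal.ofReal_mul (p := K) (by linarith)]
            gcongr
            nlinarith
        _ = ENNReal.ofReal K * ∑' n, (ENNReal.ofReal (δ n) * ENNReal.ofReal (L n + 1)) :=
            ENNReal.tsum_mul_left
        _ ≤ _ := by
            rw [ENNReal.ofReal_mul (p := K) (by linarith)]
            gcongr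
    have hK0 : 0 ≤ K := by linarith
    calc ENNReal.ofReal (2 / √s) * ∫⁻ ω, R (fun y => regResidual P X x y ω) ∂P
        ≤ ENNReal.ofReal (2 / √s) * (ENNReal.ofReal 2 * (ENNReal.ofReal (C * δ 0 / √s * A) +
            ENNReal.ofReal (K * Δ))) := by
          gcongr
          rw [hR]
          dsimp only
          have hmc : Measurable fun ω => chainBound F δ L (fun y => regResidual P X x y ω) :=
            measurable_chainBound.comp
              (measurable_pi_lambda _ fun y => measurable_regResidual hm x y)
          rw [lintegral_const_mul _ (hmc.const_add _), lintegral_add_left measurable_const,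
            lintegral_const, measure_univ, mul_one, ENNReal.ofReal_ofNat]
          gcongr
      _ = ENNReal.ofReal (2 / √s * (2 * (C * δ 0 / √s * A + K * Δ))) := by
          rw [← ENNReal.ofReal_add (by positivity) (by positivity),
            ← ENNReal.ofReal_mul (by positivity), ← ENNReal.ofReal_mul (by positivity)]
      _ ≤ ENNReal.ofReal (hitConst s C A * Δ) := by
          refine ENNReal.ofReal_le_ofReal ?_
          have e : hitConst s C A * Δ = 2 / √s * (2 * (C * A / √s * Δ + K * Δ)) := by
            rw [hitConst, hK, hC']; ring
          have e' : C * A / √s * Δ = C * Δ / √s * A := by ring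
          rw [e, e']
          gcongr

/-! ### Vector-valued fields -/

section Field

variable {Ω T : Type*} [MeasurableSpace Ω] [TopologicalSpace T] {D : ℕ} {P : Measure Ω}
  {M : T → Ω → EuclideanSpace ℝ (Fin D)}

theorem IsGaussianField.measurable_apply (hM : IsGaussianField P M) (x : T) (i : Fin D) :
    Measurable fun ω => M x ω i :=
  (EuclideanSpace.proj (𝕜 := ℝ) i).measurable.comp (hM.meas x)

theorem IsGaussianField.isGaussianProcess_apply (hM : IsGaussianField P M) (i : Fin D) :
    IsGaussianProcess (fun x ω => M x ω i) P :=
  hM.gaussian.comp_left fun _ => EuclideanSpace.proj (𝕜 := ℝ) i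

theorem IsGaussianField.measure_inter_eq_prod [NeZero D] (hM : IsGaussianField P M)
    {B : Fin D → Set (T → ℝ)} (hB : ∀ i, MeasurableSet (B i)) :
    P {ω | ∀ i, (fun x => M x ω i) ∈ B i} = ∏ i, P {ω | (fun x => M x ω 0) ∈ B i} := by
  have h := hM.indep.measure_inter_preimage_eq_mul Finset.univ (sets := B) fun i _ => hB i
  have he : {ω | ∀ i, (fun x => M x ω i) ∈ B i} =
      ⋂ i ∈ (Finset.univ : Finset (Fin D)), (fun ω x => M x ω i) ⁻¹' B i := by
    ext ω; simp
  rw [he, h]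
  exact Finset.prod_congr rfl fun i _ => (hM.ident i 0).measure_mem_eq (hB i)

/-- Up to a null set, a hit puts every coordinate path in its own measurable set; independence then
yields the $D$-th power. -/
theorem IsGaussianField.measure_hit_le [NeZero D] [IsProbabilityMeasure P]
    (hM : IsGaussianField P M) {x : T} {S : Set T} {F : ℕ → Finset (T × T)} {δ L : ℕ → ℝ}
    {m : T → T → ℝ} (hm0 : ∀ a ∈ S, ∀ b ∈ S, 0 ≤ m a b) (hch : ChainData m x S F δ L) {s C A Δ : ℝ}
    {z : EuclideanSpace ℝ (Fin D)}
    (hs : 0 < s) (hC : 0 < C) (hA : 0 ≤ A) (hΔ : 0 ≤ Δ)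
    (hvx : s ≤ Var[fun ω => M x ω 0; P]) (hmx : |∫ ω, M x ω 0 ∂P| ≤ A) (hz : ∀ i, |z i| ≤ A)
    (hmean : ∀ a ∈ S, ∀ b ∈ S, |∫ ω, M a ω 0 ∂P - ∫ ω, M b ω 0 ∂P| ≤ C * m a b)
    (hvar : ∀ a ∈ S, ∀ b ∈ S, Var[fun ω => M a ω 0 - M b ω 0; P] ≤ (C * m a b) ^ 2)
    (hsmall : C * δ 0 / √s ≤ 1 / 2)
    (hsum : ∑' n, ENNReal.ofReal (δ n) * ENNReal.ofReal (L n + 1) ≤ ENNReal.ofReal Δ) :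
    P {ω | ∃ y ∈ S, M y ω = z} ≤ ENNReal.ofReal (hitConst s C A * Δ) ^ D := by
  have h := fun i => hch.exists_measurableSet_hit (hM.isGaussianProcess_apply 0)
    (fun y => hM.measurable_apply y 0) hm0 hs hC hA hΔ hvx hmx (hz i) hmean hvar hsmall hsum
  choose B hB hBhit hBP using h
  calc P {ω | ∃ y ∈ S, M y ω = z} ≤ P {ω | ∀ i, (fun x => M x ω i) ∈ B i} := by
        refine measure_mono_ae ?_
        filter_upwards [hM.cont] with ω hω
        rintro ⟨y, hy, hyz⟩ i
        refine hBhit i _ ((EuclideanSpace.proj (𝕜 := ℝ) i).continuous.comp hω) ⟨y, hy, ?_⟩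
        rw [hyz]
    _ = ∏ i, P {ω | (fun x => M x ω 0) ∈ B i} := hM.measure_inter_eq_prod hB
    _ ≤ ∏ _i : Fin D, ENNReal.ofReal (hitConst s C A * Δ) :=
        Finset.prod_le_prod' fun i _ => hBP i
    _ = _ := by simp

end Field

/-! ### Second moment estimates -/

/-- Given $X(x)=a$, closeness of $X(y)$ to $z$ says that the independent residual is close to
$z-\beta a$, and its density is at most $v^{-1/2}$. -/
theorem measure_two_point_le {Ω T : Type*} [MeasurableSpace Ω] {P : Measure Ω}
    [IsProbabilityMeasure P] {X : T → Ω → ℝ} (hX : IsGaussianProcess X P)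
    (hm : ∀ x, Measurable (X x)) {x y : T} {s v : ℝ} (hs : 0 < s) (hvx : s ≤ Var[X x; P])
    (hv : 0 < v) (hvy : v ≤ Var[regResidual P X x y; P]) (z : ℝ) (ε : ℝ≥0∞) :
    P {ω | ‖X x ω - z‖ₑ ≤ ε ∧ ‖X y ω - z‖ₑ ≤ ε} ≤
      ENNReal.ofReal (2 / √s) * ε * (ENNReal.ofReal (2 / √v) * ε) := by
  have hind : IndepFun (X x) (regResidual P X x y) P :=
    (indepFun_regResidual hX hm (hs.trans_le hvx)).comp measurable_id (measurable_pi_apply y)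
  have hZm := measurable_regResidual (P := P) hm x y
  have hprod := (indepFun_iff_map_prod_eq_prod_map_map (hm x).aemeasurable hZm.aemeasurable).1 hind
  have : IsProbabilityMeasure (P.map (X x)) := Measure.isProbabilityMeasure_map (hm x).aemeasurable
  have : IsProbabilityMeasure (P.map (regResidual P X x y)) :=
    Measure.isProbabilityMeasure_map hZm.aemeasurable
  set β := regCoef P X x y with hβ
  set E : Set (ℝ × ℝ) := {p | ‖p.1 - z‖ₑ ≤ ε ∧ ‖p.2 - (z - β * p.1)‖ₑ ≤ ε} with hE
  have hE₁ : MeasurableSet {p : ℝ × ℝ | ‖p.1 - z‖ₑ ≤ ε} :=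
    measurableSet_le (by fun_prop) (by fun_prop)
  have hE₂ : MeasurableSet {p : ℝ × ℝ | ‖p.2 - (z - β * p.1)‖ₑ ≤ ε} :=
    measurableSet_le (by fun_prop) (by fun_prop)
  have hEm : MeasurableSet E := hE₁.inter hE₂
  have hSm : MeasurableSet {a : ℝ | ‖a - z‖ₑ ≤ ε} :=
    measurableSet_le (by fun_prop) (by fun_prop)
  calc P {ω | ‖X x ω - z‖ₑ ≤ ε ∧ ‖X y ω - z‖ₑ ≤ ε}
      = P.map (fun ω => (X x ω, regResidual P X x y ω)) E := by
        rw [Measure.map_apply ((hm x).prodMk hZm) hEm]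
        congr 1
        ext ω
        have : regResidual P X x y ω - (z - β * X x ω) = X y ω - z := by
          rw [regResidual, ← hβ]; ring
        simp [hE, this]
    _ = ∫⁻ a, P.map (regResidual P X x y) {b | (a, b) ∈ E} ∂(P.map (X x)) := by
        rw [hprod, Measure.prod_apply hEm]; rfl
    _ ≤ ∫⁻ a, {a | ‖a - z‖ₑ ≤ ε}.indicator (fun _ => ENNReal.ofReal (2 / √v) * ε) a
          ∂(P.map (X x)) := by
        refine lintegral_mono fun a => ?_
        by_cases ha : ‖a - z‖ₑ ≤ ε
        · rw [indicator_of_mem (by exact ha)]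
          refine le_trans (measure_mono fun b hb => ?_) (measure_enorm_sub_le
            ((isGaussianProcess_regResidual hX x).hasGaussianLaw_eval y) hv hvy (z - β * a) ε)
          exact hb.2
        · have : {b | (a, b) ∈ E} = ∅ := by
            ext b; simp [hE, ha]
          rw [this]; simp
    _ = ENNReal.ofReal (2 / √v) * ε * P.map (X x) {a | ‖a - z‖ₑ ≤ ε} := by
        rw [lintegral_indicator hSm, lintegral_const, Measure.restrict_apply_univ]
    _ ≤ ENNReal.ofReal (2 / √v) * ε * (ENNReal.ofReal (2 / √s) * ε) := by
        gcongr
        exact measure_enorm_sub_le (hX.hasGaussianLaw_eval x) hs hvx z ε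
    _ = _ := mul_comm _ _

/-- With $a,b$ the two variances and $d$ that of the increment, the residual variance is
$\bigl(d(2(a+b)-d)-(a-b)^2\bigr)/(4a)$. Here $2(a+b)-d\ge3c_1$ and $(a-b)^2\le2c_1d$, which leaves
at least $c_1d$ in the numerator. -/
theorem le_variance_regResidual {Ω T : Type*} [MeasurableSpace Ω] {P : Measure Ω}
    [IsProbabilityMeasure P] {X : T → Ω → ℝ} (hX : IsGaussianProcess X P) {x y : T} {c₁ c₂ : ℝ}
    (hc₁ : 0 < c₁) (hx : c₁ ≤ Var[X x; P]) (hy : c₁ ≤ Var[X y; P]) (hx' : Var[X x; P] ≤ c₂)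
    (hd : Var[fun ω => X x ω - X y ω; P] ≤ c₁)
    (hdiff : (Var[X x; P] - Var[X y; P]) ^ 2 ≤ 2 * c₁ * Var[fun ω => X x ω - X y ω; P]) :
    c₁ / (4 * c₂) * Var[fun ω => X x ω - X y ω; P] ≤ Var[regResidual P X x y; P] := by
  have hx0 : 0 < Var[X x; P] := hc₁.trans_le hx
  rw [variance_regResidual hX hx0]
  have h2 := memLp_two_of_isGaussianProcess hX
  have hv : Var[fun ω => X x ω - X y ω; P] = Var[X x; P] - 2 * cov[X y, X x; P] + Var[X y; P] := by
    rw [covariance_comm]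
    exact variance_fun_sub (h2 x) (h2 y)
  set a := Var[X x; P]
  set b := Var[X y; P]
  set k := cov[X y, X x; P]
  set d := Var[fun ω => X x ω - X y ω; P] with hdd
  have hd0 : 0 ≤ d := variance_nonneg _ _
  have hk : k = (a + b - d) / 2 := by linarith
  have hc2 : 0 < c₂ := hx0.trans_le hx'
  have e : b - k ^ 2 / a = (d * (2 * (a + b) - d) - (a - b) ^ 2) / (4 * a) := by
    rw [hk]; field_simp; ring
  rw [e, div_mul_eq_mul_div, div_le_div_iff₀ (by positivity) (by positivity)]
  have h3 : c₁ * d ≤ d * (2 * (a + b) - d) - (a - b) ^ 2 := by nlinarith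
  have h4 : 0 ≤ c₁ * d := by positivity
  calc c₁ * d * (4 * a) ≤ c₁ * d * (4 * c₂) := by gcongr
    _ ≤ _ := by gcongr

/-- Cauchy–Schwarz for $J=J\cdot 1_{\{J\ne0\}}$. -/
theorem sq_lintegral_le {Ω : Type*} [MeasurableSpace Ω] {P : Measure Ω} {J : Ω → ℝ≥0∞}
    (hJ : Measurable J) : (∫⁻ ω, J ω ∂P) ^ 2 ≤ (∫⁻ ω, J ω * J ω ∂P) * P {ω | J ω ≠ 0} := by
  have hS : MeasurableSet {ω | J ω ≠ 0} := (measurableSet_eq_fun hJ measurable_const).compl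
  set g : Ω → ℝ≥0∞ := {ω | J ω ≠ 0}.indicator fun _ => 1 with hg
  have h := ENNReal.lintegral_mul_le_Lp_mul_Lq P Real.HolderConjugate.two_two hJ.aemeasurable
    (g := g) (measurable_const.indicator hS).aemeasurable
  have h1 : ∫⁻ ω, (J * g) ω ∂P = ∫⁻ ω, J ω ∂P := by
    refine lintegral_congr fun ω => ?_
    by_cases hω : J ω = 0 <;> simp [hg, hω]
  have h2 : ∫⁻ ω, g ω ^ (2 : ℝ) ∂P = P {ω | J ω ≠ 0} := by
    rw [← lintegral_indicator_one hS]
    refine lintegral_congr fun ω => ?_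
    by_cases hω : J ω = 0 <;> simp [hg, hω]
  rw [h1, h2] at h
  calc (∫⁻ ω, J ω ∂P) ^ 2 ≤ ((∫⁻ ω, J ω ^ (2 : ℝ) ∂P) ^ (1 / 2 : ℝ) *
        P {ω | J ω ≠ 0} ^ (1 / 2 : ℝ)) ^ 2 := by
        gcongr
    _ = _ := by
        rw [mul_pow, ← ENNReal.rpow_natCast, ← ENNReal.rpow_natCast, ← ENNReal.rpow_mul,
          ← ENNReal.rpow_mul]
        simp [pow_two]

theorem lintegral_measure_sq {Ω T : Type*} [MeasurableSpace Ω] [MeasurableSpace T]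
    {P : Measure Ω} [SFinite P] {ν : Measure T} [SFinite ν] {E : Set (T × Ω)}
    (hE : MeasurableSet E) :
    ∫⁻ ω, ν {x | (x, ω) ∈ E} * ν {x | (x, ω) ∈ E} ∂P =
      ∫⁻ x, ∫⁻ y, P {ω | (x, ω) ∈ E ∧ (y, ω) ∈ E} ∂ν ∂ν := by
  set G : Set (Ω × (T × T)) := {p | (p.2.1, p.1) ∈ E ∧ (p.2.2, p.1) ∈ E} with hG
  have hG₁ : MeasurableSet {p : Ω × (T × T) | (p.2.1, p.1) ∈ E} :=
    hE.preimage (f := fun p : Ω × (T × T) => (p.2.1, p.1)) (by fun_prop)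
  have hG₂ : MeasurableSet {p : Ω × (T × T) | (p.2.2, p.1) ∈ E} :=
    hE.preimage (f := fun p : Ω × (T × T) => (p.2.2, p.1)) (by fun_prop)
  have hGm : MeasurableSet G := hG₁.inter hG₂
  have h1 := Measure.prod_apply (μ := P) (ν := ν.prod ν) hGm
  have h2 := Measure.prod_apply_symm (μ := P) (ν := ν.prod ν) hGm
  have h3 : ∀ ω, (ν.prod ν) (Prod.mk ω ⁻¹' G) = ν {x | (x, ω) ∈ E} * ν {x | (x, ω) ∈ E} := by
    intro ω
    rw [← Measure.prod_prod]
    congr 1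
  simp_rw [h3] at h1
  rw [← h1, h2, lintegral_prod]
  · rfl
  · exact (measurable_measure_prodMk_right hGm).aemeasurable

/-- Second moment method for the `ν`-measure of the points where every coordinate is within
$\varepsilon$ of that of $z$: the mean is at least of order $\varepsilon^D$, the second moment at
most $\varepsilon^{2D}$ times the energy. -/
theorem IsGaussianField.not_isPolarOn {Ω T : Type*} [MeasurableSpace Ω] [TopologicalSpace T]
    [TopologicalSpace.MetrizableSpace T] [SecondCountableTopology T] [MeasurableSpace T]
    [OpensMeasurableSpace T] {D : ℕ} [NeZero D] {P : Measure Ω} [IsProbabilityMeasure P]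
    {M : T → Ω → EuclideanSpace ℝ (Fin D)} (hM : IsGaussianField P M) {K : Set T}
    (hK : IsCompact K) {ν : Measure T} [SFinite ν] (hν0 : ν K ≠ 0)
    {m : T → T → ℝ} (hm0 : ∀ x ∈ K, ∀ y ∈ K, 0 ≤ m x y) {z : EuclideanSpace ℝ (Fin D)} {s s' A c : ℝ}
    (hs : 0 < s) (hc : 0 < c)
    (hv : ∀ x ∈ K, s ≤ Var[fun ω => M x ω 0; P]) (hv' : ∀ x ∈ K, Var[fun ω => M x ω 0; P] ≤ s')
    (hA : ∀ x ∈ K, ∀ i, |z i - ∫ ω, M x ω 0 ∂P| ≤ A)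
    (hres : ∀ x ∈ K, ∀ y ∈ K, (c * m x y) ^ 2 ≤ Var[regResidual P (fun x ω => M x ω 0) x y; P])
    (henergy : ∫⁻ x in K, ∫⁻ y in K, (ENNReal.ofReal (m x y))⁻¹ ^ D ∂ν ∂ν < ⊤) :
    ¬ IsPolarOn P M K {z} := by
  have hKm : MeasurableSet K := hK.measurableSet
  have hs0 : 0 < √s := Real.sqrt_pos.2 hs
  obtain ⟨x₀, hx₀⟩ := nonempty_of_measure_ne_zero hν0
  have hs' : 0 < s' := hs.trans_le ((hv _ hx₀).trans (hv' _ hx₀))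
  -- a version of the field with continuous paths
  obtain ⟨N, hNsub, hNm, hN0⟩ := exists_measurable_superset_of_null (ae_iff.1 hM.cont)
  classical
  set M' : T → Ω → EuclideanSpace ℝ (Fin D) := fun x => N.piecewise (fun _ => 0) (M x) with hM'
  have hM'cont : ∀ ω, Continuous fun x => M' x ω := by
    intro ω
    by_cases hω : ω ∈ N
    · simp only [hM', Set.piecewise, if_pos hω]; exact continuous_const
    · simp only [hM', Set.piecewise, if_neg hω]
      by_contra h
      exact hω (hNsub h)
  have hM'm : Measurable (Function.uncurry M') :=
    measurable_uncurry_of_continuous_of_measurable hM'cont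
      fun x => Measurable.piecewise hNm measurable_const (hM.meas x)
  have hM'ae : ∀ᵐ ω ∂P, ∀ x, M' x ω = M x ω := by
    filter_upwards [measure_eq_zero_iff_ae_notMem.1 hN0] with ω hω x
    simp only [hM', Set.piecewise, if_neg hω]
  set E : ℝ → Set (T × Ω) := fun ε =>
    {p | ∀ i, ‖Function.uncurry M' p i - z i‖ₑ ≤ ENNReal.ofReal ε} with hE
  have hEm : ∀ ε, MeasurableSet (E ε) := by
    intro ε
    have : E ε = ⋂ i, {p | ‖Function.uncurry M' p i - z i‖ₑ ≤ ENNReal.ofReal ε} := by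
      ext p; simp [hE]
    rw [this]
    refine MeasurableSet.iInter fun i => measurableSet_le ?_ measurable_const
    exact (((EuclideanSpace.proj (𝕜 := ℝ) i).measurable.comp hM'm).sub_const _).enorm
  set ν' := ν.restrict K with hν'
  set J : ℝ → Ω → ℝ≥0∞ := fun ε ω => ν' {x | (x, ω) ∈ E ε} with hJ
  have hJm : ∀ ε, Measurable (J ε) := fun ε => measurable_measure_prodMk_right (hEm ε)
  have hball : ∀ (w : ℝ) (ε : ℝ) (x : T), MeasurableSet {f : T → ℝ | ‖f x - w‖ₑ ≤ ENNReal.ofReal ε} :=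
    fun w ε x => measurableSet_le ((measurable_pi_apply x).sub_const _).enorm measurable_const
  -- first moment
  set c₁ : ℝ := 2 * ((√(2 * Real.pi * s'))⁻¹ * Real.exp (-(A + 1) ^ 2 / (2 * s))) with hc₁
  have hc₁0 : 0 < c₁ := by have := Real.pi_pos; positivity
  have hone : ∀ ε, 0 < ε → ε ≤ 1 → ∀ x ∈ K,
      ENNReal.ofReal (c₁ * ε) ^ D ≤ P {ω | (x, ω) ∈ E ε} := by
    intro ε hε hε1 x hx
    calc ENNReal.ofReal (c₁ * ε) ^ D = ∏ _i : Fin D, ENNReal.ofReal (c₁ * ε) := by simp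
      _ ≤ ∏ i, P {ω | (fun x => M x ω 0) ∈ {f : T → ℝ | ‖f x - z i‖ₑ ≤ ENNReal.ofReal ε}} :=
          Finset.prod_le_prod' fun i _ => le_measure_enorm_sub_le
            ((hM.isGaussianProcess_apply 0).hasGaussianLaw_eval x) (hM.measurable_apply x 0) hs
            (hv x hx) (hv' x hx) (hA x hx i) hε hε1
      _ = P {ω | ∀ i, (fun x => M x ω i) ∈ {f : T → ℝ | ‖f x - z i‖ₑ ≤ ENNReal.ofReal ε}} :=
          (hM.measure_inter_eq_prod fun i => hball (z i) ε x).symm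
      _ = _ := by
          refine measure_congr ?_
          filter_upwards [hM'ae] with ω hω
          refine propext ?_
          change (∀ i, ‖M x ω i - z i‖ₑ ≤ ENNReal.ofReal ε) ↔
            ∀ i, ‖M' x ω i - z i‖ₑ ≤ ENNReal.ofReal ε
          rw [hω]
  -- second moment
  set c₂ : ℝ := 2 / √s * (2 / c) with hc₂
  have htwo : ∀ ε, 0 < ε → ∀ x ∈ K, ∀ y ∈ K, P {ω | (x, ω) ∈ E ε ∧ (y, ω) ∈ E ε} ≤
      ENNReal.ofReal (c₂ * ε ^ 2) ^ D * (ENNReal.ofReal (m x y))⁻¹ ^ D := by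
    intro ε hε x hx y hy
    have hc₂ε : 0 < c₂ * ε ^ 2 := by positivity
    rcases (hm0 x hx y hy).eq_or_lt with h0 | h0
    -- Where `m` vanishes the kernel is infinite, as $D\ge1$, and nothing is to be proved.
    · rw [← h0, ENNReal.ofReal_zero, ENNReal.inv_zero, ENNReal.top_pow (NeZero.ne D),
        ENNReal.mul_top]
      · exact le_top
      · exact pow_ne_zero _ (by simpa using hc₂ε)
    calc P {ω | (x, ω) ∈ E ε ∧ (y, ω) ∈ E ε}
        = P {ω | ∀ i, (fun x => M x ω i) ∈ {f : T → ℝ | ‖f x - z i‖ₑ ≤ ENNReal.ofReal ε} ∩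
            {f : T → ℝ | ‖f y - z i‖ₑ ≤ ENNReal.ofReal ε}} := by
          refine measure_congr ?_
          filter_upwards [hM'ae] with ω hω
          refine propext ?_
          change ((∀ i, ‖M' x ω i - z i‖ₑ ≤ ENNReal.ofReal ε) ∧
            ∀ i, ‖M' y ω i - z i‖ₑ ≤ ENNReal.ofReal ε) ↔
            ∀ i, ‖M x ω i - z i‖ₑ ≤ ENNReal.ofReal ε ∧ ‖M y ω i - z i‖ₑ ≤ ENNReal.ofReal ε
          rw [hω, hω, forall_and]
      _ = ∏ i, P {ω | (fun x => M x ω 0) ∈ {f : T → ℝ | ‖f x - z i‖ₑ ≤ ENNReal.ofReal ε} ∩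
            {f : T → ℝ | ‖f y - z i‖ₑ ≤ ENNReal.ofReal ε}} :=
          hM.measure_inter_eq_prod fun i => (hball (z i) ε x).inter (hball (z i) ε y)
      _ ≤ ∏ _i : Fin D, (ENNReal.ofReal (c₂ * ε ^ 2) * (ENNReal.ofReal (m x y))⁻¹) := by
          refine Finset.prod_le_prod' fun i _ => ?_
          refine (measure_two_point_le (hM.isGaussianProcess_apply 0)
            (fun y => hM.measurable_apply y 0) hs (hv x hx) (v := (c * m x y) ^ 2) (by positivity)
            (hres x hx y hy) (z i) (ENNReal.ofReal ε)).trans (le_of_eq ?_)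
          rw [Real.sqrt_sq (by positivity), ← ENNReal.ofReal_inv_of_pos h0,
            ← ENNReal.ofReal_mul (by positivity), ← ENNReal.ofReal_mul (by positivity),
            ← ENNReal.ofReal_mul (by positivity), ← ENNReal.ofReal_mul (by positivity)]
          congr 1
          rw [hc₂]
          field_simp
      _ = _ := by simp [mul_pow]
  set I := ∫⁻ x in K, ∫⁻ y in K, (ENNReal.ofReal (m x y))⁻¹ ^ D ∂ν ∂ν with hI
  -- lower bound for the probability of being close to `z`
  have hlow : ∀ ε, 0 < ε → ε ≤ 1 →
      (ENNReal.ofReal c₁ ^ D * ν K) ^ 2 ≤ ENNReal.ofReal c₂ ^ D * I * P {ω | J ε ω ≠ 0} := by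
    intro ε hε hε1
    have h1 : ENNReal.ofReal (c₁ * ε) ^ D * ν K ≤ ∫⁻ ω, J ε ω ∂P := by
      have h := Measure.prod_apply (μ := ν') (ν := P) (hEm ε)
      have h' := Measure.prod_apply_symm (μ := ν') (ν := P) (hEm ε)
      calc _ = ∫⁻ x in K, ENNReal.ofReal (c₁ * ε) ^ D ∂ν := by
            rw [lintegral_const, Measure.restrict_apply_univ]
        _ ≤ ∫⁻ x in K, P {ω | (x, ω) ∈ E ε} ∂ν := setLIntegral_mono' hKm (hone ε hε hε1)
        _ = _ := h.symm.trans h'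
    have h2 : ∫⁻ ω, J ε ω * J ε ω ∂P ≤ ENNReal.ofReal (c₂ * ε ^ 2) ^ D * I := by
      rw [hJ, lintegral_measure_sq (hEm ε), hI,
        ← lintegral_const_mul' _ _ (ENNReal.pow_ne_top ENNReal.ofReal_ne_top)]
      refine setLIntegral_mono' hKm fun x hx => ?_
      rw [← lintegral_const_mul' _ _ (ENNReal.pow_ne_top ENNReal.ofReal_ne_top)]
      exact setLIntegral_mono' hKm fun y hy => htwo ε hε x hx y hy
    have h3 : (ENNReal.ofReal (c₁ * ε) ^ D * ν K) ^ 2 ≤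
        ENNReal.ofReal (c₂ * ε ^ 2) ^ D * I * P {ω | J ε ω ≠ 0} := by
      calc _ ≤ (∫⁻ ω, J ε ω ∂P) ^ 2 := by gcongr
        _ ≤ _ := sq_lintegral_le (hJm ε)
        _ ≤ _ := by gcongr
    -- Both sides scale like $\varepsilon^{2D}$; cancelling this factor makes the bound uniform in
    -- $\varepsilon$.
    set e := ENNReal.ofReal ε ^ (2 * D) with he
    have he0 : e ≠ 0 := pow_ne_zero _ (by simpa using hε)
    have he1 : e ≠ ⊤ := ENNReal.pow_ne_top ENNReal.ofReal_ne_top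
    rw [ENNReal.ofReal_mul hc₁0.le, ENNReal.ofReal_mul (p := c₂) (by positivity),
      ENNReal.ofReal_pow hε.le] at h3
    have h4 : e * (ENNReal.ofReal c₁ ^ D * ν K) ^ 2 ≤
        e * (ENNReal.ofReal c₂ ^ D * I * P {ω | J ε ω ≠ 0}) := by
      calc _ = ((ENNReal.ofReal c₁ * ENNReal.ofReal ε) ^ D * ν K) ^ 2 := by rw [he]; ring
        _ ≤ _ := h3
        _ = _ := by rw [he]; ring
    exact (ENNReal.mul_le_mul_iff_right he0 he1).1 h4
  -- conclusion by compactness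
  set ε : ℕ → ℝ := fun n => 1 / ((n : ℝ) + 1) with hεdef
  have hε0 : ∀ n, 0 < ε n := fun n => by positivity
  have hε1 : ∀ n, ε n ≤ 1 := fun n => by
    rw [hεdef]; dsimp only
    rw [div_le_one (by positivity)]
    linarith [Nat.cast_nonneg (α := ℝ) n]
  set B : ℕ → Set Ω := fun n => {ω | J (ε n) ω ≠ 0} with hB
  have hBanti : Antitone B := by
    intro n k hnk ω hω h0
    refine hω (le_antisymm ((measure_mono ?_).trans h0.le) zero_le)
    intro x hx i
    refine (hx i).trans (ENNReal.ofReal_le_ofReal ?_)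
    exact Nat.one_div_le_one_div hnk
  have hBm : ∀ n, MeasurableSet (B n) := fun n =>
    (measurableSet_eq_fun (hJm _) measurable_const).compl
  intro hpolar
  have hsub : P (⋂ n, B n) ≤ P {ω | ((fun x => M x ω) '' K ∩ {z}).Nonempty} := by
    refine measure_mono_ae ?_
    filter_upwards [hM'ae] with ω hω hωB
    have hclosed : ∀ n, IsClosed {x | ∀ i, ‖M' x ω i - z i‖ₑ ≤ ENNReal.ofReal (ε n)} := by
      intro n
      have hcl : {x | ∀ i, ‖M' x ω i - z i‖ₑ ≤ ENNReal.ofReal (ε n)} =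
          ⋂ i, {x | ‖M' x ω i - z i‖ₑ ≤ ENNReal.ofReal (ε n)} := by ext; simp
      rw [hcl]
      refine isClosed_iInter fun i => isClosed_le ?_ continuous_const
      exact (((EuclideanSpace.proj (𝕜 := ℝ) i).continuous.comp (hM'cont ω)).sub
        continuous_const).enorm
    -- The near-hit sets are nested, compact and nonempty; a common point is an exact hit.
    have hne : (⋂ n, K ∩ {x | ∀ i, ‖M' x ω i - z i‖ₑ ≤ ENNReal.ofReal (ε n)}).Nonempty := by
      refine IsCompact.nonempty_iInter_of_sequence_nonempty_isCompact_isClosed _ (fun n => ?_)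
        (fun n => ?_) (hK.inter_right (hclosed 0)) (fun n => hK.isClosed.inter (hclosed n))
      · refine inter_subset_inter_right _ fun x hx i => (hx i).trans (ENNReal.ofReal_le_ofReal ?_)
        exact Nat.one_div_le_one_div n.le_succ
      · have h0 : ν.restrict K {x | (x, ω) ∈ E (ε n)} ≠ 0 := mem_iInter.1 hωB n
        rw [Measure.restrict_apply' hKm] at h0
        obtain ⟨x, hx1, hx2⟩ := nonempty_of_measure_ne_zero h0
        exact ⟨x, hx2, hx1⟩
    obtain ⟨x, hx⟩ := hne
    rw [mem_iInter] at hx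
    refine ⟨z, ⟨x, (hx 0).1, ?_⟩, rfl⟩
    dsimp only
    rw [← hω x]
    ext i
    have hlim : Tendsto (fun n => ENNReal.ofReal (ε n)) atTop (𝓝 0) := by
      rw [← ENNReal.ofReal_zero]
      exact (ENNReal.continuous_ofReal.tendsto _).comp tendsto_one_div_add_atTop_nhds_zero_nat
    have h0 : ‖M' x ω i - z i‖ₑ ≤ 0 := ge_of_tendsto' hlim fun n => (hx n).2 i
    simpa [sub_eq_zero] using h0
  have hzero : P (⋂ n, B n) = 0 := le_antisymm (hsub.trans (le_of_eq hpolar)) zero_le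
  have hlim := tendsto_measure_iInter_atTop (μ := P) (fun n => (hBm n).nullMeasurableSet) hBanti
    ⟨0, measure_ne_top _ _⟩
  rw [hzero] at hlim
  -- Finite energy enters here: only with a finite factor does `P (B n) → 0` contradict the uniform
  -- lower bound.
  have hItop : ENNReal.ofReal c₂ ^ D * I ≠ ⊤ :=
    ENNReal.mul_ne_top (ENNReal.pow_ne_top ENNReal.ofReal_ne_top) henergy.ne
  have hlim2 := ENNReal.Tendsto.const_mul (a := ENNReal.ofReal c₂ ^ D * I) hlim (Or.inr hItop)
  rw [mul_zero] at hlim2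
  have h0 : (ENNReal.ofReal c₁ ^ D * ν K) ^ 2 ≤ 0 :=
    ge_of_tendsto' hlim2 fun n => hlow (ε n) (hε0 n) (hε1 n)
  have : ENNReal.ofReal c₁ ≠ 0 := by simpa using hc₁0
  simp [this, hν0] at h0

/-! ### Gauge functions -/

section Gauge

variable {r : ℝ≥0∞} {q : ℝ → ℝ}

theorem mem_gaugeDomain_of_le {x y : ℝ} (hx : x ∈ gaugeDomain r) (hy : 0 ≤ y) (hyx : y ≤ x) :
    y ∈ gaugeDomain r :=
  ⟨hy, (ENNReal.ofReal_le_ofReal hyx).trans_lt hx.2⟩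

namespace IsGauge

theorem zero_mem (hq : IsGauge r q) : (0 : ℝ) ∈ gaugeDomain r := ⟨le_rfl, by simpa using hq.pos⟩

theorem exists_pos_mem (hq : IsGauge r q) : ∃ b ∈ gaugeDomain r, 0 < b := by
  obtain ⟨b, hb0, hbr⟩ := ENNReal.lt_iff_exists_real_btwn.1 hq.pos
  exact ⟨b, ⟨hb0, hbr.2⟩, by simpa using hbr.1⟩

theorem mono (hq : IsGauge r q) {x y : ℝ} (hy : y ∈ gaugeDomain r) (hx : 0 ≤ x) (hxy : x ≤ y) :
    q x ≤ q y :=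
  hq.strictMono.monotoneOn (mem_gaugeDomain_of_le hy hx hxy) hy hxy

theorem apply_pos (hq : IsGauge r q) {x : ℝ} (hx : x ∈ gaugeDomain r) (h : 0 < x) : 0 < q x := by
  rw [← hq.zero]
  exact hq.strictMono hq.zero_mem hx h

theorem apply_nonneg (hq : IsGauge r q) {x : ℝ} (hx : x ∈ gaugeDomain r) : 0 ≤ q x := by
  rw [← hq.zero]
  exact hq.mono hx le_rfl hx.1

theorem gaugeInv_apply (hq : IsGauge r q) {x : ℝ} (hx : x ∈ gaugeDomain r) :
    gaugeInv r q (q x) = x :=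
  hq.strictMono.injOn.leftInvOn_invFunOn hx

theorem gaugeInv_mem {τ : ℝ} (hτ : τ ∈ gaugeRange r q) : gaugeInv r q τ ∈ gaugeDomain r :=
  Function.invFunOn_mem hτ

theorem apply_gaugeInv {τ : ℝ} (hτ : τ ∈ gaugeRange r q) : q (gaugeInv r q τ) = τ :=
  Function.invFunOn_eq hτ

theorem exists_apply_eq (hq : IsGauge r q) {b τ : ℝ} (hb : b ∈ gaugeDomain r) (hτ : 0 ≤ τ)
    (hτb : τ ≤ q b) : ∃ x ∈ Icc 0 b, q x = τ := by
  have := intermediate_value_Icc (f := q) hb.1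
    (hq.cont.mono fun x hx => mem_gaugeDomain_of_le hb hx.1 hx.2)
  rw [hq.zero] at this
  exact this ⟨hτ, hτb⟩

theorem mem_gaugeRange (hq : IsGauge r q) {b τ : ℝ} (hb : b ∈ gaugeDomain r) (hτ : 0 ≤ τ)
    (hτb : τ ≤ q b) : τ ∈ gaugeRange r q := by
  obtain ⟨x, hx, rfl⟩ := hq.exists_apply_eq hb hτ hτb
  exact ⟨x, mem_gaugeDomain_of_le hb hx.1 hx.2, rfl⟩

theorem gaugeInv_le (hq : IsGauge r q) {b τ : ℝ} (hb : b ∈ gaugeDomain r) (hτ : 0 ≤ τ)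
    (hτb : τ ≤ q b) : gaugeInv r q τ ≤ b := by
  obtain ⟨x, hx, rfl⟩ := hq.exists_apply_eq hb hτ hτb
  rw [hq.gaugeInv_apply (mem_gaugeDomain_of_le hb hx.1 hx.2)]
  exact hx.2

theorem gaugeInv_pos (hq : IsGauge r q) {τ : ℝ} (hτ : τ ∈ gaugeRange r q) (h : 0 < τ) :
    0 < gaugeInv r q τ := by
  refine lt_of_le_of_ne (gaugeInv_mem hτ).1 fun h0 => ?_
  have := apply_gaugeInv hτ
  rw [← h0, hq.zero] at this
  exact h.ne this

/-- For small `τ > 0`, the inverse gauge is defined at `τ` and its value is small. -/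
theorem eventually_gaugeInv_le (hq : IsGauge r q) {b : ℝ} (hb : b ∈ gaugeDomain r) (h0 : 0 < b) :
    ∀ᶠ τ in 𝓝[>] (0 : ℝ), τ ∈ gaugeRange r q ∧ 0 < gaugeInv r q τ ∧ gaugeInv r q τ ≤ b := by
  filter_upwards [Ioc_mem_nhdsGT (hq.apply_pos hb h0)] with τ hτ
  have h := hq.mem_gaugeRange hb hτ.1.le hτ.2
  exact ⟨h, hq.gaugeInv_pos h hτ.1, hq.gaugeInv_le hb hτ.1.le hτ.2⟩

theorem tendsto_nhdsGT (hq : IsGauge r q) : Tendsto q (𝓝[>] 0) (𝓝[>] 0) := by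
  obtain ⟨b, hb, hb0⟩ := hq.exists_pos_mem
  have hmem : ∀ᶠ x in 𝓝[>] (0 : ℝ), x ∈ gaugeDomain r ∧ 0 < x := by
    filter_upwards [Ioc_mem_nhdsGT hb0] with x hx
    exact ⟨mem_gaugeDomain_of_le hb hx.1.le hx.2, hx.1⟩
  refine tendsto_nhdsWithin_iff.2 ⟨?_, hmem.mono fun x hx => hq.apply_pos hx.1 hx.2⟩
  have h := hq.cont 0 hq.zero_mem
  rw [ContinuousWithinAt, hq.zero] at h
  exact h.mono_left (nhdsWithin_le_iff.2 (hmem.mono fun x hx => hx.1))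

end IsGauge

/-! ### Decay of regular gauge functions -/

/-- Bernoulli's inequality with exponent $b=\min(a,1)\le1$ gives $1+b2^k\ge(1+2^k)^b$, so the
logarithmic weight at $\tau=2^{-k}$ grows at least linearly in $k$. -/
theorem mul_le_log_one_add {a : ℝ} (ha : 0 < a) {d : ℕ} (hd : d ≠ 0) (k : ℕ) :
    min a 1 * (Real.log 2 / 2) * (k + 1) ≤ Real.log (1 + a / ((1 / 2 : ℝ) ^ k) ^ (2 * d)) := by
  set b := min a 1 with hb
  have hb0 : 0 < b := lt_min ha one_pos
  have hb1 : b ≤ 1 := min_le_right _ _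
  have h2k : (1 : ℝ) ≤ 2 ^ k := one_le_pow₀ (by norm_num)
  have hlog2 : 0 < Real.log 2 := Real.log_pos (by norm_num)
  have h1 : (1 + 2 ^ k : ℝ) ^ b ≤ 1 + b * 2 ^ k :=
    rpow_one_add_le_one_add_mul_self (by linarith) hb0.le hb1
  have h2 : b * Real.log (1 + 2 ^ k) ≤ Real.log (1 + b * 2 ^ k) := by
    rw [← Real.log_rpow (by positivity)]
    exact Real.log_le_log (by positivity) h1
  have h3 : Real.log 2 / 2 * (k + 1) ≤ Real.log (1 + 2 ^ k) := by
    have e1 : Real.log 2 ≤ Real.log (1 + 2 ^ k) := Real.log_le_log (by norm_num) (by linarith)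
    have e2 : k * Real.log 2 ≤ Real.log (1 + 2 ^ k) := by
      rw [← Real.log_pow]
      exact Real.log_le_log (by positivity) (by linarith)
    nlinarith
  have h4 : a / ((1 / 2 : ℝ) ^ k) ^ (2 * d) = a * (2 ^ k) ^ (2 * d) := by
    rw [one_div, inv_pow, inv_pow, div_inv_eq_mul]
  have h5 : (2 : ℝ) ^ k ≤ (2 ^ k) ^ (2 * d) := le_self_pow₀ h2k (by omega)
  rw [h4]
  calc b * (Real.log 2 / 2) * (k + 1) = b * (Real.log 2 / 2 * (k + 1)) := by ring
    _ ≤ b * Real.log (1 + 2 ^ k) := by gcongr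
    _ ≤ Real.log (1 + b * 2 ^ k) := h2
    _ ≤ _ := by
      gcongr
      exact min_le_left _ _

/-- A gauge function is controlled by the integral of a bound for the derivative of `q (ε ·)`. -/
theorem IsRegularGauge.ofReal_apply_mul_le {d : ℕ} (hq : IsRegularGauge d r q) {ε t : ℝ}
    (hε : 0 < ε) (hεt : ε * t ∈ gaugeDomain r) {g : ℝ → ℝ}
    (hg : ∀ τ ∈ Ioo 0 t, ε * deriv q (ε * τ) ≤ g τ) :
    ENNReal.ofReal (q (ε * t)) ≤ ∫⁻ τ in Ioc 0 t, ENNReal.ofReal (g τ) := by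
  have hG := hq.toIsGauge
  have hmem : ∀ τ ∈ Ioo 0 t, ε * τ ∈ gaugeDomain r := fun τ hτ =>
    mem_gaugeDomain_of_le hεt (mul_nonneg hε.le hτ.1.le) (by gcongr; exact hτ.2.le)
  have hderiv : ∀ τ ∈ Ioo 0 t,
      HasDerivWithinAt (fun τ => q (ε * τ)) (ε * deriv q (ε * τ)) (Ioo 0 t) τ := by
    intro τ hτ
    have h1 := (hq.diff _ (hmem τ hτ) (mul_pos hε hτ.1)).hasDerivAt
    have h2 : HasDerivAt (fun τ => ε * τ) ε τ := by simpa using (hasDerivAt_id τ).const_mul ε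
    have h3 := h1.comp τ h2
    rw [mul_comm] at h3
    exact h3.hasDerivWithinAt
  have hmono : MonotoneOn (fun τ => q (ε * τ)) (Ioo 0 t) := fun x hx y hy hxy =>
    hG.mono (hmem y hy) (hmem x hx).1 (by gcongr)
  -- The area formula for monotone functions needs no a priori integrability of the derivative.
  have hvol := lintegral_deriv_eq_volume_image_of_monotoneOn measurableSet_Ioo hderiv hmono
  have hsub : Ioo 0 (q (ε * t)) ⊆ (fun τ => q (ε * τ)) '' Ioo 0 t := by
    rintro y ⟨hy0, hy1⟩
    obtain ⟨x, hx, rfl⟩ := hG.exists_apply_eq hεt hy0.le hy1.le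
    have hx0 : 0 < x := lt_of_le_of_ne hx.1 fun h => by rw [← h, hG.zero] at hy0; exact hy0.ne rfl
    have hxt : x < ε * t := lt_of_le_of_ne hx.2 fun h => by rw [h] at hy1; exact hy1.ne rfl
    refine ⟨x / ε, ⟨by positivity, by rwa [div_lt_iff₀' hε]⟩, ?_⟩
    dsimp only
    rw [mul_div_cancel₀ _ hε.ne']
  calc ENNReal.ofReal (q (ε * t)) = volume (Ioo 0 (q (ε * t))) := by
        rw [Real.volume_Ioo, sub_zero]
    _ ≤ _ := measure_mono hsub
    _ = _ := hvol.symm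
    _ ≤ ∫⁻ τ in Ioo 0 t, ENNReal.ofReal (g τ) :=
        setLIntegral_mono' measurableSet_Ioo fun τ hτ => ENNReal.ofReal_le_ofReal (hg τ hτ)
    _ ≤ _ := lintegral_mono_set Ioo_subset_Ioc_self

/-- Integrating the growth bounds gives $q(\varepsilon2^{-k})\le
q(\varepsilon)\int_0^{2^{-k}}\varphi\psi$, and on this range the weight $\log^3$ is at least a
multiple of $(k+1)^3$. The exponent 3 is chosen so that a summable series remains after
multiplication by the entropy, which is linear in $k$. -/
theorem IsRegularGauge.exists_decay {d : ℕ} (hd : d ≠ 0) (hq : IsRegularGauge d r q) :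
    ∃ C ε₁ : ℝ, 0 < C ∧ 0 < ε₁ ∧ ε₁ ∈ gaugeDomain r ∧ ∀ ε ∈ Ioc 0 ε₁, ∀ k : ℕ,
      q (ε * (1 / 2) ^ k) ≤ C * q ε / (k + 1) ^ 3 := by
  have hG := hq.toIsGauge
  obtain ⟨φ, ψ, -, -, ⟨c₀, hc₀, hgrowth⟩, a, ha, hint⟩ := hq.growth
  obtain ⟨b₀, hb₀, hb₀0⟩ := hG.exists_pos_mem
  set ε₁ := min b₀ c₀ with hε₁
  have hε₁0 : 0 < ε₁ := lt_min hb₀0 hc₀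
  have hε₁m : ε₁ ∈ gaugeDomain r := mem_gaugeDomain_of_le hb₀ hε₁0.le (min_le_left _ _)
  set B := ∫⁻ τ in Ioc (0 : ℝ) 1,
    ENNReal.ofReal (Real.log (1 + a / τ ^ (2 * d)) ^ (3 : ℝ) * (φ τ * ψ τ)) with hB
  have hBtop : B < ⊤ := hint 3 (by norm_num)
  obtain ⟨n₁, hn₁⟩ := exists_pow_lt_of_lt_one hc₀ (show (1 / 2 : ℝ) < 1 by norm_num)
  set e := min a 1 * (Real.log 2 / 2) with he
  have he0 : 0 < e := by
    have : 0 < Real.log 2 := Real.log_pos (by norm_num)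
    have : 0 < min a 1 := lt_min ha one_pos
    positivity
  refine ⟨B.toReal / e ^ 3 + (n₁ + 1) ^ 3, ε₁, by positivity, hε₁0, hε₁m, ?_⟩
  intro ε hε k
  have hεm : ε ∈ gaugeDomain r := mem_gaugeDomain_of_le hε₁m hε.1.le hε.2
  have hqε : 0 < q ε := hG.apply_pos hεm hε.1
  set t : ℝ := (1 / 2) ^ k with ht
  have ht0 : 0 < t := by positivity
  have ht1 : t ≤ 1 := pow_le_one₀ (by norm_num) (by norm_num)
  have hεt : ε * t ∈ gaugeDomain r := mem_gaugeDomain_of_le hεm (by have := hε.1; positivity)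
    (mul_le_of_le_one_right hε.1.le ht1)
  rw [le_div_iff₀ (by positivity)]
  rcases lt_or_ge k n₁ with hk | hk
  -- For `k < n₁` the growth condition may not apply at scale $2^{-k}$; monotonicity suffices, at
  -- the cost of the summand $(n_1+1)^3$ in the constant.
  · have h1 : q (ε * t) ≤ q ε := hG.mono hεm hεt.1 (mul_le_of_le_one_right hε.1.le ht1)
    have h2 : ((k : ℝ) + 1) ^ 3 ≤ (n₁ + 1) ^ 3 := by gcongr
    calc q (ε * t) * (k + 1) ^ 3 ≤ q ε * (n₁ + 1) ^ 3 := by gcongr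
      _ ≤ _ := by
        rw [add_mul, mul_comm (q ε)]
        exact le_add_of_nonneg_left (by positivity)
  · have htc : t ≤ c₀ := by
      refine le_trans ?_ hn₁.le
      exact pow_le_pow_of_le_one (by norm_num) (by norm_num) hk
    have hεc : ε ∈ Ioc 0 c₀ := ⟨hε.1, hε.2.trans (min_le_right _ _)⟩
    have hpos : ∀ τ ∈ Ioc 0 t, ε * τ ∈ gaugeDomain r ∧ 0 < q (ε * τ) := by
      intro τ hτ
      have h1 : ε * τ ∈ gaugeDomain r := mem_gaugeDomain_of_le hεt
        (mul_nonneg hε.1.le hτ.1.le) (mul_le_mul_of_nonneg_left hτ.2 hε.1.le)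
      exact ⟨h1, hG.apply_pos h1 (mul_pos hε.1 hτ.1)⟩
    -- The signs of `φ` and `ψ` are not assumed; the growth inequalities force them, because $q>0$
    -- and $\dot q\ge0$.
    have hφ : ∀ τ ∈ Ioc 0 t, 0 ≤ φ τ := by
      intro τ hτ
      have h1 := (hgrowth ε hεc τ ⟨hτ.1, hτ.2.trans htc⟩).1
      exact nonneg_of_mul_nonneg_left ((hpos τ hτ).2.le.trans h1) hqε
    have hψ : ∀ τ ∈ Ioo 0 t, 0 ≤ ψ τ := by
      intro τ hτ
      have hτ' : τ ∈ Ioc 0 t := ⟨hτ.1, hτ.2.le⟩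
      have h1 := (hgrowth ε hεc τ ⟨hτ.1, hτ.2.le.trans htc⟩).2
      have h2 : 0 ≤ deriv q (ε * τ) := by
        have hmono : MonotoneOn q (Icc 0 (ε * t)) := fun x hx y hy hxy =>
          hG.mono (mem_gaugeDomain_of_le hεt hy.1 hy.2) hx.1 hxy
        have hnhds : Icc 0 (ε * t) ∈ 𝓝 (ε * τ) :=
          Icc_mem_nhds (mul_pos hε.1 hτ.1) (mul_lt_mul_of_pos_left hτ.2 hε.1)
        rw [← derivWithin_of_mem_nhds hnhds]
        exact hmono.derivWithin_nonneg
      have h3 := h2.trans h1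
      have h4 : 0 ≤ ε⁻¹ * ψ τ := nonneg_of_mul_nonneg_left h3 (hpos τ hτ').2
      exact nonneg_of_mul_nonneg_right h4 (inv_pos.2 hε.1)
    have hw : e * (k + 1) ≤ Real.log (1 + a / t ^ (2 * d)) := mul_le_log_one_add ha hd k
    have hstep := hq.ofReal_apply_mul_le hε.1 hεt (g := fun τ => q ε * (φ τ * ψ τ)) (by
      intro τ hτ
      have hτ' : τ ∈ Ioc 0 t := ⟨hτ.1, hτ.2.le⟩
      obtain ⟨h1, h2⟩ := hgrowth ε hεc τ ⟨hτ.1, hτ.2.le.trans htc⟩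
      calc ε * deriv q (ε * τ) ≤ ε * (ε⁻¹ * ψ τ * q (ε * τ)) := by
            have := hε.1
            gcongr
        _ = ψ τ * q (ε * τ) := by
            have := hε.1.ne'
            field_simp
        _ ≤ ψ τ * (φ τ * q ε) := by
            have := hψ τ hτ
            gcongr
        _ = _ := by ring)
    have hfin : ENNReal.ofReal (q (ε * t) * (e * (k + 1)) ^ 3) ≤ ENNReal.ofReal (q ε) * B := by
      calc ENNReal.ofReal (q (ε * t) * (e * (k + 1)) ^ 3)
          = ENNReal.ofReal ((e * (k + 1)) ^ 3) * ENNReal.ofReal (q (ε * t)) := by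
            rw [mul_comm, ENNReal.ofReal_mul (by positivity)]
        _ ≤ ENNReal.ofReal ((e * (k + 1)) ^ 3) *
              ∫⁻ τ in Ioc 0 t, ENNReal.ofReal (q ε * (φ τ * ψ τ)) := by gcongr
        _ = ∫⁻ τ in Ioo 0 t, ENNReal.ofReal ((e * (k + 1)) ^ 3) *
              ENNReal.ofReal (q ε * (φ τ * ψ τ)) := by
            rw [lintegral_const_mul' _ _ ENNReal.ofReal_ne_top,
              setLIntegral_congr Ioo_ae_eq_Ioc]
        _ ≤ ∫⁻ τ in Ioo 0 t, ENNReal.ofReal (q ε) *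
              ENNReal.ofReal (Real.log (1 + a / τ ^ (2 * d)) ^ (3 : ℝ) * (φ τ * ψ τ)) := by
            refine setLIntegral_mono' measurableSet_Ioo fun τ hτ => ?_
            rw [← ENNReal.ofReal_mul (by positivity), ← ENNReal.ofReal_mul hqε.le]
            refine ENNReal.ofReal_le_ofReal ?_
            have hφψ : 0 ≤ φ τ * ψ τ := mul_nonneg (hφ τ ⟨hτ.1, hτ.2.le⟩) (hψ τ hτ)
            have hτ0 := hτ.1
            have hwτ : e * (k + 1) ≤ Real.log (1 + a / τ ^ (2 * d)) := by
              refine hw.trans ?_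
              gcongr
              exact hτ.2.le
            have h3 : (e * (k + 1)) ^ 3 ≤ Real.log (1 + a / τ ^ (2 * d)) ^ (3 : ℝ) := by
              rw [show (3 : ℝ) = ((3 : ℕ) : ℝ) by norm_num, Real.rpow_natCast]
              gcongr
            rw [mul_left_comm]
            gcongr
        _ = ENNReal.ofReal (q ε) * ∫⁻ τ in Ioo 0 t,
              ENNReal.ofReal (Real.log (1 + a / τ ^ (2 * d)) ^ (3 : ℝ) * (φ τ * ψ τ)) :=
            lintegral_const_mul' _ _ ENNReal.ofReal_ne_top
        _ ≤ _ := by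
            gcongr
            exact lintegral_mono_set fun τ hτ => ⟨hτ.1, hτ.2.le.trans ht1⟩
    rw [← ENNReal.ofReal_toReal hBtop.ne, ← ENNReal.ofReal_mul hqε.le,
      ENNReal.ofReal_le_ofReal_iff (by positivity), mul_pow] at hfin
    have h5 : q (ε * t) * (k + 1) ^ 3 ≤ B.toReal / e ^ 3 * q ε := by
      rw [div_mul_eq_mul_div, le_div_iff₀ (by positivity)]
      linarith
    refine h5.trans ?_
    gcongr
    exact le_add_of_nonneg_right (by positivity)

end Gauge

/-! ### Nets in Euclidean spaces -/

theorem EuclideanSpace.dist_le_mul_of_abs_sub_le {d : ℕ} {y y' : EuclideanSpace ℝ (Fin d)} {ρ : ℝ}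
    (hρ : 0 ≤ ρ) (h : ∀ i, |y i - y' i| ≤ ρ) : dist y y' ≤ d * ρ := by
  rw [EuclideanSpace.dist_eq]
  refine Real.sqrt_le_iff.2 ⟨by positivity, ?_⟩
  calc ∑ i, dist (y i) (y' i) ^ 2 ≤ ∑ _i : Fin d, ρ ^ 2 := by
        refine Finset.sum_le_sum fun i _ => ?_
        rw [Real.dist_eq]
        have := h i
        gcongr
    _ = d * ρ ^ 2 := by simp
    _ ≤ (d : ℝ) ^ 2 * ρ ^ 2 := by
        gcongr
        rcases Nat.eq_zero_or_pos d with rfl | hd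
        · simp
        · exact le_self_pow₀ (by exact_mod_cast hd) (by norm_num)
    _ = _ := by ring

/-- A bounded subset of a Euclidean space has a finite net of controlled cardinality. -/
theorem exists_net {d : ℕ} [NeZero d] {S : Set (EuclideanSpace ℝ (Fin d))}
    {x₀ : EuclideanSpace ℝ (Fin d)} {R h : ℝ} (hh : 0 < h) (hhR : h ≤ R)
    (hS : S ⊆ Metric.closedBall x₀ R) :
    ∃ (π : EuclideanSpace ℝ (Fin d) → EuclideanSpace ℝ (Fin d))
      (A : Finset (EuclideanSpace ℝ (Fin d))), (A : Set (EuclideanSpace ℝ (Fin d))) ⊆ S ∧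
      (∀ y ∈ S, π y ∈ A ∧ dist y (π y) ≤ h) ∧ (A.card : ℝ) ≤ ((2 * d + 3) * (R / h)) ^ d := by
  classical
  have hd : (0 : ℝ) < d := by exact_mod_cast NeZero.pos d
  have hR : 0 < R := hh.trans_le hhR
  -- Points in a common cube of side $h/d$ are at distance at most $d\cdot(h/d)=h$.
  set ρ := h / d with hρ
  have hρ0 : 0 < ρ := by positivity
  set κ : EuclideanSpace ℝ (Fin d) → Fin d → ℤ := fun y i => ⌊(y i - x₀ i) / ρ⌋ with hκ
  set N := ⌈R / ρ⌉ with hN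
  have hbox : κ '' S ⊆ (Fintype.piFinset fun _ : Fin d => Finset.Icc (-N) N : Finset (Fin d → ℤ)) := by
    rintro _ ⟨y, hy, rfl⟩
    simp only [Finset.mem_coe, Fintype.mem_piFinset, Finset.mem_Icc]
    intro i
    have h1 : |y i - x₀ i| ≤ R := by
      have h2 := EuclideanSpace.norm_eq (y - x₀)
      have h3 := PiLp.norm_apply_le (y - x₀) i
      have h4 := hS hy
      rw [Metric.mem_closedBall, dist_eq_norm] at h4
      simpa using h3.trans h4
    have h2 := abs_le.1 h1
    constructor
    · rw [hκ]
      dsimp only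
      rw [Int.le_floor]
      have h3 : R / ρ ≤ N := Int.le_ceil _
      have h4 : -(R / ρ) ≤ (y i - x₀ i) / ρ := by
        rw [← neg_div]
        gcongr
        exact h2.1
      push_cast
      linarith
    · refine Int.floor_le_iff.2 ?_
      have h3 : R / ρ ≤ N := Int.le_ceil _
      have h4 : (y i - x₀ i) / ρ ≤ R / ρ := by
        gcongr
        exact h2.2
      linarith
  -- One representative in `S` per occupied cube keeps the net inside `S`, the only place where the
  -- field is controlled.
  set g : (Fin d → ℤ) → EuclideanSpace ℝ (Fin d) :=
    fun k => if hk : ∃ s ∈ S, κ s = k then hk.choose else 0 with hg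
  have hgS : ∀ y ∈ S, g (κ y) ∈ S ∧ κ (g (κ y)) = κ y := by
    intro y hy
    have hk : ∃ s ∈ S, κ s = κ y := ⟨y, hy, rfl⟩
    have := hk.choose_spec
    simpa only [hg, dif_pos hk] using this
  have hfin : ((fun y => g (κ y)) '' S).Finite := by
    rw [← image_image g κ]
    exact ((Finset.finite_toSet _).subset hbox).image g
  refine ⟨fun y => g (κ y), hfin.toFinset, ?_, ?_, ?_⟩
  · rw [Finite.coe_toFinset]
    rintro _ ⟨y, hy, rfl⟩
    exact (hgS y hy).1
  · intro y hy
    refine ⟨by simpa using ⟨y, hy, rfl⟩, ?_⟩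
    have h1 : ∀ i, |y i - g (κ y) i| ≤ ρ := by
      intro i
      have h2 : ⌊(g (κ y) i - x₀ i) / ρ⌋ = ⌊(y i - x₀ i) / ρ⌋ := congrFun (hgS y hy).2 i
      have h3 := Int.abs_sub_lt_one_of_floor_eq_floor h2.symm
      rw [← sub_div, abs_div, abs_of_pos hρ0, div_lt_one hρ0] at h3
      rw [show y i - g (κ y) i = y i - x₀ i - (g (κ y) i - x₀ i) by ring]
      exact h3.le
    refine (EuclideanSpace.dist_le_mul_of_abs_sub_le hρ0.le h1).trans (le_of_eq ?_)
    rw [hρ]; field_simp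
  · have hN0 : 0 ≤ N := Int.ceil_nonneg (by positivity)
    have h1 : hfin.toFinset.card ≤ (2 * N + 1).toNat ^ d := by
      rw [← ncard_eq_toFinset_card _ hfin, ← image_image g κ]
      calc (g '' (κ '' S)).ncard ≤ (κ '' S).ncard :=
            ncard_image_le ((Finset.finite_toSet _).subset hbox)
        _ ≤ _ := ncard_le_ncard hbox (Finset.finite_toSet _)
        _ = _ := by
            rw [ncard_coe_finset, Fintype.card_piFinset]
            simp only [Int.card_Icc, Finset.prod_const, Finset.card_univ, Fintype.card_fin]
            congr 2
            ring
    have h2 : ((2 * N + 1).toNat : ℝ) ≤ (2 * d + 3) * (R / h) := by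
      have h3 : ((2 * N + 1).toNat : ℝ) = 2 * N + 1 := by
        have : ((2 * N + 1).toNat : ℤ) = 2 * N + 1 := Int.toNat_of_nonneg (by linarith)
        exact_mod_cast this
      have h4 : (N : ℝ) < R / ρ + 1 := Int.ceil_lt_add_one _
      have h5 : R / ρ = d * (R / h) := by rw [hρ]; field_simp
      have h6 : 1 ≤ R / h := by rwa [one_le_div hh]
      rw [h3]
      nlinarith
    calc (hfin.toFinset.card : ℝ) ≤ ((2 * N + 1).toNat : ℝ) ^ d := by exact_mod_cast h1
      _ ≤ _ := by gcongr

/-! ### Chains in Euclidean spaces -/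

/-- The logarithmic number of links of order `n` in the chains of `exists_chainData`. -/
noncomputable def linkLog (d n : ℕ) : ℝ := 2 * d * (Real.log (2 * d + 3) + (n + 1) * Real.log 2)

theorem linkLog_nonneg (d n : ℕ) : 0 ≤ linkLog d n := by
  have h1 : 0 ≤ Real.log (2 * (d : ℝ) + 3) :=
    Real.log_nonneg (by linarith [Nat.cast_nonneg (α := ℝ) d])
  have h2 : 0 ≤ Real.log 2 := Real.log_nonneg (by norm_num)
  unfold linkLog
  positivity

theorem linkLog_add_one_le (d n : ℕ) :
    linkLog d n + 1 ≤ (2 * d * (Real.log (2 * d + 3) + Real.log 2) + 1) * (n + 1) := by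
  have h1 : 0 ≤ Real.log (2 * (d : ℝ) + 3) :=
    Real.log_nonneg (by linarith [Nat.cast_nonneg (α := ℝ) d])
  have h3 : 0 ≤ 2 * (d : ℝ) * Real.log (2 * d + 3) * n := by positivity
  unfold linkLog
  nlinarith [Nat.cast_nonneg (α := ℝ) n]

/-- Each point is reached through nets of mesh $2^{-n}\varepsilon/2$, the coarsest being `{x}`.
Consecutive approximations differ by at most $\tfrac34 2^{-n}\varepsilon$. The links lie in the
product of two consecutive nets, whence the factor $2d$ in `linkLog`. -/
theorem exists_chainData {d : ℕ} [NeZero d] {S : Set (EuclideanSpace ℝ (Fin d))}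
    {x : EuclideanSpace ℝ (Fin d)} {ε : ℝ} (hε : 0 < ε) (hx : x ∈ S)
    (hS : S ⊆ Metric.closedBall x (ε / 2)) {r : ℝ≥0∞} {q : ℝ → ℝ} (hq : IsGauge r q)
    (hεr : ε ∈ gaugeDomain r) :
    ∃ F, ChainData (fun y y' => q (dist y y')) x S F (fun n => q (ε * (1 / 2) ^ n))
      (linkLog d) := by
  classical
  have hd0 : (0 : ℝ) ≤ d := Nat.cast_nonneg d
  have hhalf : ∀ n : ℕ, (0 : ℝ) < (1 / 2) ^ n := fun n => by positivity
  have hhalf1 : ∀ n : ℕ, (1 / 2 : ℝ) ^ n ≤ 1 := fun n => pow_le_one₀ (by norm_num) (by norm_num)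
  have hmem : ∀ n : ℕ, ε * (1 / 2) ^ n ∈ gaugeDomain r := fun n =>
    mem_gaugeDomain_of_le hεr (mul_pos hε (hhalf n)).le (mul_le_of_le_one_right hε.le (hhalf1 n))
  have hnet : ∀ n : ℕ, ∃ (π : EuclideanSpace ℝ (Fin d) → EuclideanSpace ℝ (Fin d))
      (A : Finset (EuclideanSpace ℝ (Fin d))), (A : Set (EuclideanSpace ℝ (Fin d))) ⊆ S ∧
      (∀ y ∈ S, π y ∈ A ∧ dist y (π y) ≤ ε / 2 * (1 / 2) ^ n) ∧
      (A.card : ℝ) ≤ ((2 * d + 3) * 2 ^ n) ^ d ∧ (n = 0 → ∀ y, π y = x) := by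
    intro n
    rcases Nat.eq_zero_or_pos n with rfl | hn
    · refine ⟨fun _ => x, {x}, by simpa using hx, fun y hy => ⟨by simp, by simpa using hS hy⟩, ?_,
        fun _ _ => rfl⟩
      simp only [Finset.card_singleton, Nat.cast_one, pow_zero, mul_one]
      exact one_le_pow₀ (by linarith)
    · obtain ⟨π, A, h1, h2, h3⟩ := exists_net (S := S) (R := ε / 2) (h := ε / 2 * (1 / 2) ^ n)
        (mul_pos (by positivity) (hhalf n))
        (mul_le_of_le_one_right (by positivity) (hhalf1 n)) hS
      refine ⟨π, A, h1, h2, h3.trans (le_of_eq ?_), fun h => absurd h hn.ne'⟩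
      congr 2
      field_simp
      rw [← mul_pow]; norm_num
  choose π A hAS hπ hA hπ0 using hnet
  refine ⟨fun n => (A n ×ˢ A (n + 1)).filter fun p => dist p.2 p.1 ≤ ε * (1 / 2) ^ n, ?_, ?_, ?_,
    linkLog_nonneg d, ?_⟩
  · intro y hy
    refine ⟨fun n => π n y, hπ0 0 rfl y, fun n => ?_, ?_, fun n => ⟨hAS n (hπ n y hy).1, ?_⟩⟩
    · rw [Finset.mem_filter, Finset.mem_product]
      refine ⟨⟨(hπ n y hy).1, (hπ (n + 1) y hy).1⟩, ?_⟩
      calc dist (π (n + 1) y) (π n y) ≤ dist y (π (n + 1) y) + dist y (π n y) :=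
            dist_triangle_left _ _ _
        _ ≤ ε / 2 * (1 / 2) ^ (n + 1) + ε / 2 * (1 / 2) ^ n :=
            add_le_add (hπ (n + 1) y hy).2 (hπ n y hy).2
        _ ≤ _ := by
            rw [pow_succ]
            nlinarith [mul_pos hε (hhalf n)]
    · have hlim := (tendsto_pow_atTop_nhds_zero_of_lt_one (r := (1 / 2 : ℝ)) (by norm_num)
        (by norm_num)).const_mul (ε / 2)
      rw [mul_zero] at hlim
      refine tendsto_iff_dist_tendsto_zero.2 (squeeze_zero (fun _ => dist_nonneg) (fun n => ?_) hlim)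
      rw [dist_comm]
      exact (hπ n y hy).2
    · refine hq.mono (hmem n) dist_nonneg ((hπ n y hy).2.trans ?_)
      nlinarith [mul_pos hε (hhalf n)]
  · intro n p hp
    rw [Finset.mem_filter, Finset.mem_product] at hp
    exact ⟨hAS _ hp.1.1, hAS _ hp.1.2, hq.mono (hmem n) dist_nonneg hp.2⟩
  · exact fun n => hq.apply_pos (hmem n) (mul_pos hε (hhalf n))
  · intro n
    have h1 : (((A n ×ˢ A (n + 1)).filter
        fun p => dist p.2 p.1 ≤ ε * (1 / 2) ^ n).card : ℝ) ≤ (A n).card * (A (n + 1)).card := by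
      rw [← Nat.cast_mul, ← Finset.card_product]
      exact_mod_cast Finset.card_filter_le _ _
    have h2 : Real.exp (linkLog d n) = ((2 * d + 3) * 2 ^ (n + 1)) ^ d *
        ((2 * d + 3) * 2 ^ (n + 1)) ^ d := by
      have h3 : (2 * (d : ℝ) + 3) * 2 ^ (n + 1) =
          Real.exp (Real.log (2 * d + 3) + (n + 1) * Real.log 2) := by
        rw [Real.exp_add, Real.exp_log (by positivity)]
        congr 1
        have : ((n : ℝ) + 1) * Real.log 2 = Real.log (2 ^ (n + 1)) := by
          rw [Real.log_pow]; push_cast; ring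
        rw [this, Real.exp_log (by positivity)]
      rw [h3, ← Real.exp_nat_mul, ← Real.exp_add, linkLog]
      congr 1
      ring
    rw [h2]
    refine h1.trans ?_
    gcongr
    · refine (hA n).trans ?_
      gcongr <;> norm_num
    · exact hA (n + 1)

/-- Run the two chains in parallel: numbers of links multiply, so their logarithms add. -/
theorem ChainData.prod {T₁ T₂ : Type*} [TopologicalSpace T₁] [TopologicalSpace T₂]
    {m₁ : T₁ → T₁ → ℝ} {m₂ : T₂ → T₂ → ℝ} {x₁ : T₁} {x₂ : T₂} {S₁ : Set T₁} {S₂ : Set T₂}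
    {F₁ : ℕ → Finset (T₁ × T₁)} {F₂ : ℕ → Finset (T₂ × T₂)} {δ₁ δ₂ L₁ L₂ : ℕ → ℝ}
    (h₁ : ChainData m₁ x₁ S₁ F₁ δ₁ L₁) (h₂ : ChainData m₂ x₂ S₂ F₂ δ₂ L₂) :
    ∃ F, ChainData (fun a b : T₁ × T₂ => m₁ a.1 b.1 + m₂ a.2 b.2) (x₁, x₂) (S₁ ×ˢ S₂) F
      (fun n => δ₁ n + δ₂ n) (fun n => L₁ n + L₂ n) := by
  classical
  refine ⟨fun n => (F₁ n ×ˢ F₂ n).image fun p => ((p.1.1, p.2.1), (p.1.2, p.2.2)), ?_, ?_,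
    fun n => add_pos (h₁.pos n) (h₂.pos n), fun n => add_nonneg (h₁.nonneg n) (h₂.nonneg n), ?_⟩
  · rintro ⟨y₁, y₂⟩ ⟨hy₁, hy₂⟩
    obtain ⟨c₁, h10, h1F, h1t, h1m⟩ := h₁.exists_chain y₁ hy₁
    obtain ⟨c₂, h20, h2F, h2t, h2m⟩ := h₂.exists_chain y₂ hy₂
    refine ⟨fun n => (c₁ n, c₂ n), by simp only [h10, h20], fun n => ?_, h1t.prodMk_nhds h2t,
      fun n => ⟨⟨(h1m n).1, (h2m n).1⟩, add_le_add (h1m n).2 (h2m n).2⟩⟩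
    exact Finset.mem_image.2 ⟨((c₁ n, c₁ (n + 1)), (c₂ n, c₂ (n + 1))),
      Finset.mem_product.2 ⟨h1F n, h2F n⟩, rfl⟩
  · intro n p hp
    obtain ⟨⟨p₁, p₂⟩, hp', rfl⟩ := Finset.mem_image.1 hp
    rw [Finset.mem_product] at hp'
    obtain ⟨a1, a2, a3⟩ := h₁.link_le n _ hp'.1
    obtain ⟨b1, b2, b3⟩ := h₂.link_le n _ hp'.2
    exact ⟨⟨a1, b1⟩, ⟨a2, b2⟩, add_le_add a3 b3⟩
  · intro n
    rw [Real.exp_add]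
    calc _ ≤ ((F₁ n ×ˢ F₂ n).card : ℝ) := by exact_mod_cast Finset.card_image_le
      _ = (F₁ n).card * (F₂ n).card := by rw [Finset.card_product]; push_cast; ring
      _ ≤ _ := by
        have := h₁.card_le n
        have := h₂.card_le n
        gcongr

/-- Cubic decay against linear entropy leaves $\sum(n+1)^{-2}$. -/
theorem tsum_ofReal_mul_le {δ L : ℕ → ℝ} {G Λ : ℝ} (hG : 0 ≤ G) (hΛ : 0 ≤ Λ)
    (hδ : ∀ n : ℕ, δ n ≤ G / (n + 1) ^ 3) (hL : ∀ n : ℕ, L n + 1 ≤ Λ * (n + 1)) :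
    ∑' n, ENNReal.ofReal (δ n) * ENNReal.ofReal (L n + 1) ≤
      ENNReal.ofReal (G * Λ * ∑' n : ℕ, 1 / ((n : ℝ) + 1) ^ 2) := by
  have hsum : Summable fun n : ℕ => 1 / ((n : ℝ) + 1) ^ 2 := by
    have := (summable_nat_add_iff 1).2 (Real.summable_one_div_nat_pow.2 (show 1 < 2 by norm_num))
    exact_mod_cast this
  rw [ENNReal.ofReal_mul (by positivity),
    ENNReal.ofReal_tsum_of_nonneg (fun n => by positivity) hsum, ← ENNReal.tsum_mul_left]
  refine ENNReal.tsum_le_tsum fun n => ?_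
  calc ENNReal.ofReal (δ n) * ENNReal.ofReal (L n + 1)
      ≤ ENNReal.ofReal (G / (n + 1) ^ 3) * ENNReal.ofReal (Λ * (n + 1)) := by
        gcongr
        · exact hδ n
        · exact hL n
    _ = _ := by
        rw [← ENNReal.ofReal_mul (by positivity), ← ENNReal.ofReal_mul (by positivity)]
        congr 1
        field_simp

/-! ### Consequences of the structural hypotheses -/

theorem sq_l2norm_sub_integral {Ω : Type*} [MeasurableSpace Ω] {P : Measure Ω} (Y : Ω → ℝ) :
    l2norm P (fun ω => Y ω - ∫ ω', Y ω' ∂P) ^ 2 = Var[Y; P] := by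
  have h := eLpNorm_nnreal_pow_eq_lintegral (μ := P) (f := fun ω => Y ω - ∫ ω', Y ω' ∂P)
    (p := 2) (by norm_num)
  rw [l2norm, ← ENNReal.toReal_pow, variance, evariance]
  congr 1
  simpa using h

section LowerHyp

variable {Ω T : Type*} [MeasurableSpace Ω] [TopologicalSpace T] {D : ℕ} [NeZero D]
  {P : Measure Ω} [IsProbabilityMeasure P] {M : T → Ω → EuclideanSpace ℝ (Fin D)} {K : Set T}
  {m : T → T → ℝ}

theorem IsGaussianField.integrable_apply (hM : IsGaussianField P M) (x : T) :
    Integrable (fun ω => M x ω 0) P :=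
  (memLp_two_of_isGaussianProcess (hM.isGaussianProcess_apply 0) x).integrable (by norm_num)

theorem IsGaussianField.sq_l2norm_centredFst_sub (hM : IsGaussianField P M) (x y : T) :
    l2norm P (fun ω => centredFst P M x ω - centredFst P M y ω) ^ 2 =
      Var[fun ω => M x ω 0 - M y ω 0; P] := by
  rw [← sq_l2norm_sub_integral, integral_sub (hM.integrable_apply x) (hM.integrable_apply y)]
  congr 2
  ext ω
  simp only [centredFst]
  ring

theorem IsGaussianField.abs_integral_sub_le (hM : IsGaussianField P M) (x y : T) :
    |∫ ω, M x ω 0 ∂P - ∫ ω, M y ω 0 ∂P| ≤ ‖(∫ ω, M x ω ∂P) - ∫ ω, M y ω ∂P‖ := by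
  have h : ∀ x, ∫ ω, M x ω 0 ∂P = (∫ ω, M x ω ∂P) 0 := by
    intro x
    have hi : Integrable (M x) P :=
      (hM.gaussian.hasGaussianLaw_eval x).memLp_two.integrable (by norm_num)
    exact (EuclideanSpace.proj (𝕜 := ℝ) (0 : Fin D)).integral_comp_comm hi
  rw [h, h]
  exact PiLp.norm_apply_le ((∫ ω, M x ω ∂P) - ∫ ω, M y ω ∂P) 0

/-- Minkowski's inequality. It is needed because the variance condition of $(H)$ uses the uncentred
norm, whereas the metric comparison uses the centred one. -/
theorem IsGaussianField.l2norm_sub_le (hM : IsGaussianField P M) (x y : T) :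
    l2norm P (fun ω => M x ω 0 - M y ω 0) ≤
      l2norm P (fun ω => centredFst P M x ω - centredFst P M y ω) +
        |∫ ω, M x ω 0 ∂P - ∫ ω, M y ω 0 ∂P| := by
  set μ := ∫ ω, M x ω 0 ∂P - ∫ ω, M y ω 0 ∂P with hμ
  have h2 := memLp_two_of_isGaussianProcess (hM.isGaussianProcess_apply 0)
  have hW : MemLp (fun ω => centredFst P M x ω - centredFst P M y ω) 2 P :=
    ((h2 x).sub (memLp_const _)).sub ((h2 y).sub (memLp_const _))
  have he : (fun ω => M x ω 0 - M y ω 0) =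
      (fun ω => centredFst P M x ω - centredFst P M y ω) + fun _ => μ := by
    ext ω
    simp only [centredFst, Pi.add_apply, hμ]
    ring
  have hc : eLpNorm (fun _ : Ω => μ) 2 P = ‖μ‖ₑ := by
    rw [eLpNorm_const _ (by norm_num) (IsProbabilityMeasure.ne_zero P)]
    simp
  have h := eLpNorm_add_le hW.aestronglyMeasurable (aestronglyMeasurable_const (b := μ))
    (show (1 : ℝ≥0∞) ≤ 2 by norm_num)
  rw [← he, hc] at h
  have h' := ENNReal.toReal_mono (ENNReal.add_ne_top.2 ⟨hW.eLpNorm_ne_top, enorm_ne_top⟩) h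
  rw [ENNReal.toReal_add hW.eLpNorm_ne_top enorm_ne_top, toReal_enorm, Real.norm_eq_abs] at h'
  exact h'

theorem LowerHyp.exists_increment_bounds (h : LowerHyp P M K m) (hM : IsGaussianField P M)
    (hm0 : ∀ x ∈ K, ∀ y ∈ K, 0 ≤ m x y) :
    ∃ C : ℝ, 0 < C ∧ ∀ x ∈ K, ∀ y ∈ K,
      |∫ ω, M x ω 0 ∂P - ∫ ω, M y ω 0 ∂P| ≤ C * m x y ∧
      Var[fun ω => M x ω 0 - M y ω 0; P] ≤ (C * m x y) ^ 2 := by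
  obtain ⟨_, C₁, _, hC₁, hvar⟩ := h.metric_equiv
  obtain ⟨C₂, hmean⟩ := h.mean_bound
  refine ⟨max C₁ C₂, lt_max_of_lt_left hC₁, fun x hx y hy => ⟨?_, ?_⟩⟩
  · refine (hM.abs_integral_sub_le x y).trans ((hmean x hx y hy).trans ?_)
    exact mul_le_mul_of_nonneg_right (le_max_right _ _) (hm0 x hx y hy)
  · rw [← hM.sq_l2norm_centredFst_sub]
    have := hm0 x hx y hy
    refine pow_le_pow_left₀ ENNReal.toReal_nonneg ((hvar x hx y hy).2.trans ?_) 2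
    gcongr
    exact le_max_left _ _

theorem LowerHyp.exists_mean_bound (h : LowerHyp P M K m) (hM : IsGaussianField P M)
    (hm0 : ∀ x ∈ K, ∀ y ∈ K, 0 ≤ m x y) {B : ℝ} (hB : ∀ x ∈ K, ∀ y ∈ K, m x y ≤ B) :
    ∃ A : ℝ, 0 ≤ A ∧ ∀ x ∈ K, |∫ ω, M x ω 0 ∂P| ≤ A := by
  rcases K.eq_empty_or_nonempty with rfl | ⟨x₀, hx₀⟩
  · exact ⟨0, le_rfl, by simp⟩
  obtain ⟨C, hC, hinc⟩ := h.exists_increment_bounds hM hm0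
  have hA : ∀ x ∈ K, |∫ ω, M x ω 0 ∂P| ≤ |∫ ω, M x₀ ω 0 ∂P| + C * B := by
    intro x hx
    have h1 := (hinc x hx x₀ hx₀).1
    have h2 : C * m x x₀ ≤ C * B := by gcongr; exact hB x hx x₀ hx₀
    have h3 := abs_sub_abs_le_abs_sub (∫ ω, M x ω 0 ∂P) (∫ ω, M x₀ ω 0 ∂P)
    linarith
  exact ⟨_, (abs_nonneg _).trans (hA x₀ hx₀), hA⟩

/-! ### Upper bound for the hitting probabilities -/

/-- The threshold $\tau_0=\sqrt s/(2CG)$ is what keeps the regression coefficients above $1/2$. Both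
constants are independent of the base point and of the piece `S`, so the bound can be summed over a
cover. -/
theorem LowerHyp.exists_hit_bound (h : LowerHyp P M K m) (hM : IsGaussianField P M)
    (hm0 : ∀ x ∈ K, ∀ y ∈ K, 0 ≤ m x y) {B : ℝ} (hB : ∀ x ∈ K, ∀ y ∈ K, m x y ≤ B)
    (z : EuclideanSpace ℝ (Fin D)) {G Λ : ℝ} (hG : 0 < G) (hΛ : 0 < Λ) :
    ∃ H τ₀ : ℝ, 0 ≤ H ∧ 0 < τ₀ ∧ ∀ τ ∈ Ioc 0 τ₀, ∀ (x : T) (S : Set T) (F : ℕ → Finset (T × T))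
      (δ L : ℕ → ℝ), S ⊆ K → x ∈ S → ChainData m x S F δ L →
      (∀ n : ℕ, δ n ≤ G * τ / (n + 1) ^ 3) → (∀ n : ℕ, L n + 1 ≤ Λ * (n + 1)) →
      P {ω | ∃ y ∈ S, M y ω = z} ≤ ENNReal.ofReal (H * τ) ^ D := by
  obtain ⟨s, _, hs, _, hv⟩ := h.var_bounds
  obtain ⟨C, hC, hinc⟩ := h.exists_increment_bounds hM hm0
  obtain ⟨A, hA, hmean⟩ := h.exists_mean_bound hM hm0 hB
  have hs' : 0 < √s := Real.sqrt_pos.2 hs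
  set A' := A + ‖z‖ with hA'
  have hA'0 : 0 ≤ A' := by positivity
  have hS2 : 0 ≤ ∑' n : ℕ, 1 / ((n : ℝ) + 1) ^ 2 := tsum_nonneg fun n => by positivity
  have hhit : 0 ≤ hitConst s C A' := by unfold hitConst; positivity
  refine ⟨hitConst s C A' * (G * Λ * ∑' n : ℕ, 1 / ((n : ℝ) + 1) ^ 2), √s / (2 * C * G),
    by positivity, by positivity, ?_⟩
  intro τ hτ x S F δ L hSK hxS hch hδ hL
  have hτ0 := hτ.1
  have hsum := tsum_ofReal_mul_le (G := G * τ) (by positivity) hΛ.le hδ hL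
  have hres := hM.measure_hit_le (z := z) (fun a ha b hb => hm0 a (hSK ha) b (hSK hb)) hch hs hC
    hA'0 (by positivity) (hv x (hSK hxS)).1
    ((hmean x (hSK hxS)).trans (le_add_of_nonneg_right (norm_nonneg _)))
    (fun i => (PiLp.norm_apply_le z i).trans (le_add_of_nonneg_left hA))
    (fun a ha b hb => (hinc a (hSK ha) b (hSK hb)).1)
    (fun a ha b hb => (hinc a (hSK ha) b (hSK hb)).2) (by
      have h1 := hδ 0
      simp only [Nat.cast_zero, zero_add, one_pow, div_one] at h1
      have h2 := hτ.2
      rw [le_div_iff₀ (by positivity)] at h2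
      rw [div_le_iff₀ hs']
      nlinarith) hsum
  refine hres.trans (le_of_eq ?_)
  congr 2
  ring

end LowerHyp

theorem measure_hit_le_sum {Ω T : Type*} [MeasurableSpace Ω] {D : ℕ} {P : Measure Ω}
    {M : T → Ω → EuclideanSpace ℝ (Fin D)} {K : Set T} {z : EuclideanSpace ℝ (Fin D)} {ι : Type*}
    (A : Finset ι) (S : ι → Set T) (hK : K ⊆ ⋃ a ∈ A, S a) {b : ℝ≥0∞}
    (hb : ∀ a ∈ A, P {ω | ∃ y ∈ S a, M y ω = z} ≤ b) :
    P {ω | ((fun x => M x ω) '' K ∩ {z}).Nonempty} ≤ A.card * b := by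
  calc P {ω | ((fun x => M x ω) '' K ∩ {z}).Nonempty}
      ≤ P (⋃ a ∈ A, {ω | ∃ y ∈ S a, M y ω = z}) := by
        refine measure_mono fun ω hω => ?_
        obtain ⟨_, ⟨y, hy, rfl⟩, hyz⟩ := hω
        obtain ⟨a, ha, hya⟩ := mem_iUnion₂.1 (hK hy)
        exact mem_iUnion₂.2 ⟨a, ha, y, hya, hyz⟩
    _ ≤ ∑ a ∈ A, P {ω | ∃ y ∈ S a, M y ω = z} := measure_biUnion_finset_le _ _
    _ ≤ A.card • b := Finset.sum_le_card_nsmul _ _ _ hb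
    _ = _ := by rw [nsmul_eq_mul]

/-! ### Polarity from the decay of `g_q` -/

theorem gauge_dist_bounds {α : Type*} [PseudoMetricSpace α] {K : Set α}
    (hK : Bornology.IsBounded K) {r : ℝ≥0∞} {q : ℝ → ℝ} (hq : IsGauge r q)
    (hd : Metric.diam K ∈ gaugeDomain r) {x y : α} (hx : x ∈ K) (hy : y ∈ K) :
    dist x y ∈ gaugeDomain r ∧ 0 ≤ q (dist x y) ∧ q (dist x y) ≤ q (Metric.diam K) := by
  have h1 := Metric.dist_le_diam_of_mem hK hx hy
  have h2 := mem_gaugeDomain_of_le hd dist_nonneg h1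
  exact ⟨h2, hq.apply_nonneg h2, hq.mono hd dist_nonneg h1⟩

theorem exists_pos_subset_closedBall {d : ℕ} {K : Set (EuclideanSpace ℝ (Fin d))}
    (hK : IsCompact K) : ∃ R : ℝ, 0 < R ∧ K ⊆ Metric.closedBall 0 R := by
  obtain ⟨R, hR⟩ := hK.isBounded.subset_closedBall 0
  exact ⟨max R 1, by positivity, hR.trans (Metric.closedBall_subset_closedBall (le_max_left _ _))⟩

/-- A cover of a compact set by pieces of small balls centred in the set. -/
theorem exists_cover {d : ℕ} [NeZero d] {K : Set (EuclideanSpace ℝ (Fin d))} {R : ℝ}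
    (hKR : K ⊆ Metric.closedBall 0 R) {ε : ℝ} (hε : 0 < ε) (hεR : ε ≤ R) :
    ∃ A : Finset (EuclideanSpace ℝ (Fin d)), (∀ a ∈ A, a ∈ K) ∧
      (∀ y ∈ K, ∃ a ∈ A, y ∈ K ∩ Metric.closedBall a (ε / 2)) ∧
      (A.card : ℝ) ≤ ((2 * d + 3) * (2 * R)) ^ d / ε ^ d := by
  obtain ⟨π, A, h1, h2, h3⟩ := exists_net (h := ε / 2) (by positivity) (by linarith) hKR
  refine ⟨A, fun a ha => h1 ha, fun y hy => ⟨π y, (h2 y hy).1, hy, (h2 y hy).2⟩, ?_⟩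
  refine h3.trans (le_of_eq ?_)
  rw [← div_pow]
  congr 1
  field_simp

/-- A cover by $O(\varepsilon^{-d})$ balls, each hit with probability $O(q(\varepsilon)^D)$, gives a
multiple of $g_q(q(\varepsilon))$. -/
theorem isPolarOn_of_tendsto_gFun {Ω : Type*} [MeasurableSpace Ω] {P : Measure Ω}
    [IsProbabilityMeasure P] {D : ℕ} [NeZero D] {z : EuclideanSpace ℝ (Fin D)} {d : ℕ} [NeZero d]
    {M : EuclideanSpace ℝ (Fin d) → Ω → EuclideanSpace ℝ (Fin D)}
    {K : Set (EuclideanSpace ℝ (Fin d))} {r : ℝ≥0∞} {q : ℝ → ℝ} (hM : IsGaussianField P M)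
    (hK : IsCompact K) (hq : IsRegularGauge d r q) (hd : Metric.diam K ∈ gaugeDomain r)
    (hlow : LowerHyp P M K fun x y => q (dist x y))
    (hg : Tendsto (gFun d D r q) (𝓝[>] 0) (𝓝 0)) : IsPolarOn P M K {z} := by
  have hG := hq.toIsGauge
  obtain ⟨C, ε₁, hC, hε₁, hε₁m, hdecay⟩ := hq.exists_decay (NeZero.ne d)
  obtain ⟨R, hR, hKR⟩ := exists_pos_subset_closedBall hK
  set Λ := 2 * d * (Real.log (2 * d + 3) + Real.log 2) + 1 with hΛ
  have hΛ0 : 0 < Λ := by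
    have := linkLog_nonneg d 0
    have h1 := linkLog_add_one_le d 0
    simp only [Nat.cast_zero, zero_add, mul_one] at h1
    linarith
  obtain ⟨H, τ₀, hH, hτ₀, hhit⟩ := hlow.exists_hit_bound hM
    (fun x hx y hy => (gauge_dist_bounds hK.isBounded hG hd hx hy).2.1)
    (fun x hx y hy => (gauge_dist_bounds hK.isBounded hG hd hx hy).2.2) z hC hΛ0
  set b := ((2 * d + 3) * (2 * R)) ^ d with hb
  have hb0 : 0 ≤ b := by positivity
  have hqt := hG.tendsto_nhdsGT
  have hbound : ∀ᶠ ε in 𝓝[>] (0 : ℝ),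
      P {ω | ((fun x => M x ω) '' K ∩ {z}).Nonempty} ≤
        ENNReal.ofReal (b * H ^ D * gFun d D r q (q ε)) := by
    have hsmall : ∀ᶠ ε in 𝓝[>] (0 : ℝ), q ε ∈ Ioc 0 τ₀ := hqt (Ioc_mem_nhdsGT hτ₀)
    filter_upwards [hsmall, Ioc_mem_nhdsGT hε₁, Ioc_mem_nhdsGT hR] with ε hqε hε hεR
    have hεm : ε ∈ gaugeDomain r := mem_gaugeDomain_of_le hε₁m hε.1.le hε.2
    have hε0 := hε.1
    have hqε0 := hqε.1
    obtain ⟨A, hAK, hAc, hAcard⟩ := exists_cover hKR hε.1 hεR.2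
    have h := measure_hit_le_sum (P := P) (M := M) (z := z) A
      (fun a => K ∩ Metric.closedBall a (ε / 2)) (b := ENNReal.ofReal (H * q ε) ^ D)
      (fun y hy => by
        obtain ⟨a, ha, hya⟩ := hAc y hy
        exact mem_iUnion₂.2 ⟨a, ha, hya⟩)
      (fun a ha => by
        have haS : a ∈ K ∩ Metric.closedBall a (ε / 2) :=
          ⟨hAK a ha, Metric.mem_closedBall_self (by positivity)⟩
        obtain ⟨F, hF⟩ := exists_chainData hε.1 haS inter_subset_right hG hεm
        exact hhit _ hqε a _ F _ _ inter_subset_left haS hF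
          (fun n => hdecay ε hε n) (linkLog_add_one_le d))
    refine h.trans ?_
    rw [← ENNReal.ofReal_pow (by positivity), ← ENNReal.ofReal_natCast,
      ← ENNReal.ofReal_mul (by positivity)]
    refine ENNReal.ofReal_le_ofReal ?_
    calc (A.card : ℝ) * (H * q ε) ^ D ≤ b / ε ^ d * (H * q ε) ^ D := by gcongr
      _ = b * H ^ D * gFun d D r q (q ε) := by
        rw [gFun, hG.gaugeInv_apply hεm]
        ring
  have hlim : Tendsto (fun ε => ENNReal.ofReal (b * H ^ D * gFun d D r q (q ε))) (𝓝[>] 0)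
      (𝓝 0) := by
    have h1 := ((hg.comp hqt).const_mul (b * H ^ D))
    rw [mul_zero] at h1
    have h2 := (ENNReal.continuous_ofReal.tendsto _).comp h1
    rwa [ENNReal.ofReal_zero] at h2
  exact le_antisymm (ge_of_tendsto hlim hbound) zero_le

/-- Boxes of sides $\varepsilon_i=q_i^{-1}(\tau)$ balance the two gauges: each contributes $\tau$,
and the number of boxes, $O(\varepsilon_1^{-d_1}\varepsilon_2^{-d_2})$, times $\tau^D$ is of order
$\bar g_q(\tau)$. -/
theorem isPolarOn_of_tendsto_gBarFun {Ω : Type*} [MeasurableSpace Ω] {P : Measure Ω}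
    [IsProbabilityMeasure P] {D : ℕ} [NeZero D] {z : EuclideanSpace ℝ (Fin D)} {d₁ d₂ : ℕ}
    [NeZero d₁] [NeZero d₂]
    {U : EuclideanSpace ℝ (Fin d₁) × EuclideanSpace ℝ (Fin d₂) → Ω → EuclideanSpace ℝ (Fin D)}
    {I : Set (EuclideanSpace ℝ (Fin d₁))} {J : Set (EuclideanSpace ℝ (Fin d₂))} {r₁ r₂ : ℝ≥0∞}
    {q₁ q₂ : ℝ → ℝ} (hU : IsGaussianField P U) (hI : IsCompact I) (hJ : IsCompact J)
    (hq₁ : IsRegularGauge d₁ r₁ q₁) (hq₂ : IsRegularGauge d₂ r₂ q₂)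
    (hd₁ : Metric.diam I ∈ gaugeDomain r₁) (hd₂ : Metric.diam J ∈ gaugeDomain r₂)
    (hlow : LowerHyp P U (I ×ˢ J) fun a b => q₁ (dist a.1 b.1) + q₂ (dist a.2 b.2))
    (hg : Tendsto (gBarFun d₁ d₂ D r₁ r₂ q₁ q₂) (𝓝[>] 0) (𝓝 0)) :
    IsPolarOn P U (I ×ˢ J) {z} := by
  have hG₁ := hq₁.toIsGauge
  have hG₂ := hq₂.toIsGauge
  obtain ⟨C₁, e₁, hC₁, he₁, he₁m, hdecay₁⟩ := hq₁.exists_decay (NeZero.ne d₁)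
  obtain ⟨C₂, e₂, hC₂, he₂, he₂m, hdecay₂⟩ := hq₂.exists_decay (NeZero.ne d₂)
  obtain ⟨R₁, hR₁, hIR⟩ := exists_pos_subset_closedBall hI
  obtain ⟨R₂, hR₂, hJR⟩ := exists_pos_subset_closedBall hJ
  have hΛ : ∀ d : ℕ, 0 < 2 * d * (Real.log (2 * d + 3) + Real.log 2) + 1 := by
    intro d
    have := linkLog_nonneg d 0
    have h1 := linkLog_add_one_le d 0
    simp only [Nat.cast_zero, zero_add, mul_one] at h1
    linarith
  obtain ⟨H, τ₀, hH, hτ₀, hhit⟩ := hlow.exists_hit_bound hU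
    (fun x hx y hy => add_nonneg (gauge_dist_bounds hI.isBounded hG₁ hd₁ hx.1 hy.1).2.1
      (gauge_dist_bounds hJ.isBounded hG₂ hd₂ hx.2 hy.2).2.1)
    (fun x hx y hy => add_le_add (gauge_dist_bounds hI.isBounded hG₁ hd₁ hx.1 hy.1).2.2
      (gauge_dist_bounds hJ.isBounded hG₂ hd₂ hx.2 hy.2).2.2) z (add_pos hC₁ hC₂)
    (add_pos (hΛ d₁) (hΛ d₂))
  set b₁ := ((2 * d₁ + 3) * (2 * R₁)) ^ d₁ with hb₁
  set b₂ := ((2 * d₂ + 3) * (2 * R₂)) ^ d₂ with hb₂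
  have hb₁0 : 0 ≤ b₁ := by positivity
  have hb₂0 : 0 ≤ b₂ := by positivity
  have hbound : ∀ᶠ τ in 𝓝[>] (0 : ℝ),
      P {ω | ((fun x => U x ω) '' (I ×ˢ J) ∩ {z}).Nonempty} ≤
        ENNReal.ofReal (b₁ * b₂ * H ^ D * gBarFun d₁ d₂ D r₁ r₂ q₁ q₂ τ) := by
    filter_upwards [Ioc_mem_nhdsGT hτ₀, hG₁.eventually_gaugeInv_le he₁m he₁,
      hG₂.eventually_gaugeInv_le he₂m he₂,
      hG₁.eventually_gaugeInv_le (mem_gaugeDomain_of_le he₁m (lt_min he₁ hR₁).le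
        (min_le_left _ _)) (lt_min he₁ hR₁),
      hG₂.eventually_gaugeInv_le (mem_gaugeDomain_of_le he₂m (lt_min he₂ hR₂).le
        (min_le_left _ _)) (lt_min he₂ hR₂)] with τ hτ h₁ h₂ h₁' h₂'
    obtain ⟨hr₁, hp₁, hl₁⟩ := h₁
    obtain ⟨hr₂, hp₂, hl₂⟩ := h₂
    have hm₁ := IsGauge.gaugeInv_mem hr₁
    have hm₂ := IsGauge.gaugeInv_mem hr₂
    have hqτ₁ := IsGauge.apply_gaugeInv hr₁
    have hqτ₂ := IsGauge.apply_gaugeInv hr₂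
    set ε₁ := gaugeInv r₁ q₁ τ with hε₁
    set ε₂ := gaugeInv r₂ q₂ τ with hε₂
    obtain ⟨A₁, hA₁K, hA₁c, hA₁card⟩ := exists_cover hIR hp₁ (h₁'.2.2.trans (min_le_right _ _))
    obtain ⟨A₂, hA₂K, hA₂c, hA₂card⟩ := exists_cover hJR hp₂ (h₂'.2.2.trans (min_le_right _ _))
    have hτ0 := hτ.1
    have h := measure_hit_le_sum (P := P) (M := U) (K := I ×ˢ J) (z := z) (A₁ ×ˢ A₂)
      (fun a => (I ∩ Metric.closedBall a.1 (ε₁ / 2)) ×ˢ (J ∩ Metric.closedBall a.2 (ε₂ / 2)))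
      (b := ENNReal.ofReal (H * τ) ^ D)
      (fun y hy => by
        obtain ⟨a₁, ha₁, hya₁⟩ := hA₁c y.1 hy.1
        obtain ⟨a₂, ha₂, hya₂⟩ := hA₂c y.2 hy.2
        exact mem_iUnion₂.2 ⟨(a₁, a₂), Finset.mem_product.2 ⟨ha₁, ha₂⟩, hya₁, hya₂⟩)
      (fun a ha => by
        rw [Finset.mem_product] at ha
        have haS₁ : a.1 ∈ I ∩ Metric.closedBall a.1 (ε₁ / 2) :=
          ⟨hA₁K _ ha.1, Metric.mem_closedBall_self (by positivity)⟩
        have haS₂ : a.2 ∈ J ∩ Metric.closedBall a.2 (ε₂ / 2) :=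
          ⟨hA₂K _ ha.2, Metric.mem_closedBall_self (by positivity)⟩
        obtain ⟨F₁, hF₁⟩ := exists_chainData hp₁ haS₁ inter_subset_right hG₁ hm₁
        obtain ⟨F₂, hF₂⟩ := exists_chainData hp₂ haS₂ inter_subset_right hG₂ hm₂
        obtain ⟨F, hF⟩ := hF₁.prod hF₂
        refine hhit _ hτ (a.1, a.2) _ F _ _ (prod_mono inter_subset_left inter_subset_left)
          ⟨haS₁, haS₂⟩ hF (fun n => ?_) (fun n => ?_)
        · have k₁ := hdecay₁ ε₁ ⟨hp₁, hl₁⟩ n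
          have k₂ := hdecay₂ ε₂ ⟨hp₂, hl₂⟩ n
          rw [hqτ₁] at k₁
          rw [hqτ₂] at k₂
          rw [add_mul, add_div]
          exact add_le_add k₁ k₂
        · have k₁ := linkLog_add_one_le d₁ n
          have k₂ := linkLog_add_one_le d₂ n
          rw [add_mul]
          linarith)
    refine h.trans ?_
    rw [← ENNReal.ofReal_pow (by positivity), ← ENNReal.ofReal_natCast,
      ← ENNReal.ofReal_mul (by positivity), Finset.card_product, Nat.cast_mul]
    refine ENNReal.ofReal_le_ofReal ?_
    calc (A₁.card : ℝ) * A₂.card * (H * τ) ^ D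
        ≤ b₁ / ε₁ ^ d₁ * (b₂ / ε₂ ^ d₂) * (H * τ) ^ D := by gcongr
      _ = b₁ * b₂ * H ^ D * gBarFun d₁ d₂ D r₁ r₂ q₁ q₂ τ := by
        rw [gBarFun, ← hε₁, ← hε₂]
        field_simp
        ring
  have hlim : Tendsto (fun τ => ENNReal.ofReal (b₁ * b₂ * H ^ D * gBarFun d₁ d₂ D r₁ r₂ q₁ q₂ τ))
      (𝓝[>] 0) (𝓝 0) := by
    have h1 := hg.const_mul (b₁ * b₂ * H ^ D)
    rw [mul_zero] at h1
    have h2 := (ENNReal.continuous_ofReal.tendsto _).comp h1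
    rwa [ENNReal.ofReal_zero] at h2
  exact le_antisymm (ge_of_tendsto hlim hbound) zero_le

/-! ### Nonpolarity from finite energy -/

theorem IsPolarOn.mono {Ω T F : Type*} [MeasurableSpace Ω] {P : Measure Ω} {X : T → Ω → F}
    {S S' : Set T} {A : Set F} (h : IsPolarOn P X S A) (hS : S' ⊆ S) : IsPolarOn P X S' A :=
  measure_mono_null (fun _ hω => hω.mono (by gcongr)) h

/-- The squared difference of variances is $O(m^{2+2\kappa})$, hence negligible for small $m$
against the variance of the increment, which is comparable to $m^2$. Small $m$ suffices, since a
small piece of the parameter set will be hit already. -/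
theorem LowerHyp.exists_sq_le_variance_regResidual {Ω T : Type*} [MeasurableSpace Ω]
    [TopologicalSpace T] {D : ℕ} [NeZero D] {P : Measure Ω} [IsProbabilityMeasure P]
    {M : T → Ω → EuclideanSpace ℝ (Fin D)} {K : Set T} {m : T → T → ℝ} (h : LowerHyp P M K m)
    (hM : IsGaussianField P M) (hm0 : ∀ x ∈ K, ∀ y ∈ K, 0 ≤ m x y) :
    ∃ c m₀ : ℝ, 0 < c ∧ 0 < m₀ ∧ ∀ x ∈ K, ∀ y ∈ K, m x y ≤ m₀ →
      (c * m x y) ^ 2 ≤ Var[regResidual P (fun x ω => M x ω 0) x y; P] := by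
  obtain ⟨c₁, c₂, hc₁, hc₂, hv⟩ := h.var_bounds
  obtain ⟨c, C₀, hc, hC₀, hme⟩ := h.metric_equiv
  obtain ⟨κ, c₃, hκ, hc₃, hvd⟩ := h.var_diff
  obtain ⟨C, hC, hinc⟩ := h.exists_increment_bounds hM hm0
  -- a threshold below which the variance difference is negligible
  have hlim : Tendsto (fun t : ℝ => (c₃ * (2 * C) * (2 * C * t) ^ κ) ^ 2) (𝓝[>] 0) (𝓝 0) := by
    have h1 : Tendsto (fun t : ℝ => 2 * C * t) (𝓝[>] 0) (𝓝 0) := by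
      have := (tendsto_id (α := ℝ) (x := 𝓝 0)).const_mul (2 * C)
      rw [mul_zero] at this
      exact this.mono_left nhdsWithin_le_nhds
    have h2 := h1.rpow_const (p := κ) (Or.inr hκ.le)
    rw [Real.zero_rpow hκ.ne'] at h2
    have h3 := (h2.const_mul (c₃ * (2 * C))).pow 2
    simpa using h3
  have hlim2 : Tendsto (fun t : ℝ => (C * t) ^ 2) (𝓝[>] 0) (𝓝 0) := by
    have : Tendsto (fun t : ℝ => (C * t) ^ 2) (𝓝 0) (𝓝 ((C * 0) ^ 2)) :=
      Continuous.tendsto (by fun_prop) 0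
    rw [mul_zero, zero_pow two_ne_zero] at this
    exact this.mono_left nhdsWithin_le_nhds
  -- The two requirements give the hypotheses $(a-b)^2\le2c_1V$ and $V\le c_1$ of
  -- `le_variance_regResidual`.
  obtain ⟨m₀, ⟨hm₁, hm₂⟩, hm₀⟩ := ((hlim.eventually_le_const
    (show (0 : ℝ) < 2 * c₁ * c ^ 2 by positivity)).and
    (hlim2.eventually_le_const hc₁)).and self_mem_nhdsWithin |>.exists
  replace hm₀ : 0 < m₀ := hm₀
  refine ⟨√(c₁ / (4 * c₂)) * c, m₀, by positivity, hm₀, fun x hx y hy hxy => ?_⟩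
  have hm := hm0 x hx y hy
  set V := Var[fun ω => M x ω 0 - M y ω 0; P] with hV
  have hV1 : (c * m x y) ^ 2 ≤ V := by
    rw [hV, ← hM.sq_l2norm_centredFst_sub]
    exact pow_le_pow_left₀ (by positivity) (hme x hx y hy).1 2
  have hV2 : V ≤ (C * m x y) ^ 2 := (hinc x hx y hy).2
  have hl : l2norm P (fun ω => M x ω 0 - M y ω 0) ≤ 2 * C * m x y := by
    have h1 := hM.l2norm_sub_le x y
    have h2 := (hinc x hx y hy).1
    have h3 : l2norm P (fun ω => centredFst P M x ω - centredFst P M y ω) ≤ C * m x y := by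
      refine (pow_le_pow_iff_left₀ (by exact ENNReal.toReal_nonneg) (by positivity) two_ne_zero).1 ?_
      rwa [hM.sq_l2norm_centredFst_sub]
    linarith
  have hl0 : 0 ≤ l2norm P (fun ω => M x ω 0 - M y ω 0) := ENNReal.toReal_nonneg
  have hdiff : (Var[fun ω => M x ω 0; P] - Var[fun ω => M y ω 0; P]) ^ 2 ≤ 2 * c₁ * V := by
    rw [← sq_abs]
    calc |Var[fun ω => M x ω 0; P] - Var[fun ω => M y ω 0; P]| ^ 2
        ≤ (c₃ * (2 * C * m x y) ^ (1 + κ)) ^ 2 := by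
          refine pow_le_pow_left₀ (abs_nonneg _) ((hvd x hx y hy).trans ?_) 2
          gcongr
      _ = (c₃ * (2 * C) * (2 * C * m x y) ^ κ) ^ 2 * m x y ^ 2 := by
          rw [Real.rpow_add' (by positivity) (by positivity), Real.rpow_one]
          ring
      _ ≤ (c₃ * (2 * C) * (2 * C * m₀) ^ κ) ^ 2 * m x y ^ 2 := by gcongr
      _ ≤ 2 * c₁ * c ^ 2 * m x y ^ 2 := by gcongr
      _ = 2 * c₁ * (c * m x y) ^ 2 := by ring
      _ ≤ 2 * c₁ * V := by gcongr
  have hVc : V ≤ c₁ := hV2.trans (le_trans (by gcongr) hm₂)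
  have hres := le_variance_regResidual (hM.isGaussianProcess_apply 0) hc₁ (hv x hx).1 (hv y hy).1
    (hv x hx).2 hVc hdiff
  refine le_trans ?_ hres
  rw [mul_assoc, mul_pow, Real.sq_sqrt (by positivity)]
  gcongr

/-- A random field satisfying the structural hypotheses hits every point if a small compact piece
of its parameter set carries a measure of finite energy. -/
theorem LowerHyp.exists_not_isPolarOn {Ω T : Type*} [MeasurableSpace Ω]
    [TopologicalSpace T] [TopologicalSpace.MetrizableSpace T] [SecondCountableTopology T]
    [MeasurableSpace T] [OpensMeasurableSpace T] {D : ℕ} [NeZero D] {P : Measure Ω}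
    [IsProbabilityMeasure P]
    {M : T → Ω → EuclideanSpace ℝ (Fin D)} {K : Set T} {m : T → T → ℝ} (h : LowerHyp P M K m)
    (hM : IsGaussianField P M) (hm0 : ∀ x ∈ K, ∀ y ∈ K, 0 ≤ m x y) {B : ℝ}
    (hB : ∀ x ∈ K, ∀ y ∈ K, m x y ≤ B) (z : EuclideanSpace ℝ (Fin D)) :
    ∃ m₀ : ℝ, 0 < m₀ ∧ ∀ (ν : Measure T) [SFinite ν] (K' : Set T), IsCompact K' → K' ⊆ K →
      ν K' ≠ 0 → (∀ x ∈ K', ∀ y ∈ K', m x y ≤ m₀) →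
      ∫⁻ x in K', ∫⁻ y in K', (ENNReal.ofReal (m x y))⁻¹ ^ D ∂ν ∂ν < ⊤ →
      ¬ IsPolarOn P M K {z} := by
  obtain ⟨s, s', hs, _, hv⟩ := h.var_bounds
  obtain ⟨A, hA, hmean⟩ := h.exists_mean_bound hM hm0 hB
  obtain ⟨c, m₀, hc, hm₀, hres⟩ := h.exists_sq_le_variance_regResidual hM hm0
  refine ⟨m₀, hm₀, fun ν _ K' hK' hsub hν hm hen hpol => ?_⟩
  refine hM.not_isPolarOn hK' hν (fun x hx y hy => hm0 x (hsub hx) y (hsub hy)) (z := z)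
    (s := s) (s' := s') (A := ‖z‖ + A) (c := c) hs hc
    (fun x hx => (hv x (hsub hx)).1) (fun x hx => (hv x (hsub hx)).2) (fun x hx i => ?_)
    (fun x hx y hy => hres x (hsub hx) y (hsub hy) (hm x hx y hy)) hen (hpol.mono hsub)
  exact (abs_sub _ _).trans (add_le_add (PiLp.norm_apply_le z i) (hmean x (hsub hx)))

theorem exists_measure_inter_closedBall_ne_zero {α : Type*} [PseudoMetricSpace α]
    [SecondCountableTopology α] [MeasurableSpace α] {ν : Measure α} {K : Set α} (hK : ν K ≠ 0)
    {ρ : ℝ} (hρ : 0 < ρ) : ∃ x ∈ K, ν (K ∩ Metric.closedBall x ρ) ≠ 0 := by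
  obtain ⟨x, hx, h⟩ := exists_mem_forall_mem_nhdsWithin_pos_measure hK
  exact ⟨x, hx, (h _ (inter_mem self_mem_nhdsWithin
    (mem_nhdsWithin_of_mem_nhds (Metric.closedBall_mem_nhds x hρ)))).ne'⟩

/-! ### Energies in polar coordinates -/

theorem lintegral_norm_eq_toSphere_mul {E : Type*} [NormedAddCommGroup E] [NormedSpace ℝ E]
    [MeasurableSpace E] [BorelSpace E] [FiniteDimensional ℝ E] [Nontrivial E] (μ : Measure E)
    [μ.IsAddHaarMeasure] {f : ℝ → ℝ≥0∞} (hf : Measurable f) :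
    ∫⁻ x, f ‖x‖ ∂μ = μ.toSphere univ *
      ∫⁻ u in Ioi (0 : ℝ), ENNReal.ofReal (u ^ (Module.finrank ℝ E - 1)) * f u := by
  have hmp := μ.measurePreserving_homeomorphUnitSphereProd
  have h1 : ∫⁻ x, f ‖x‖ ∂μ = ∫⁻ x : ({(0 : E)}ᶜ : Set E), f ‖x.1‖ ∂(μ.comap (↑)) := by
    rw [lintegral_subtype_comap (measurableSet_singleton _).compl fun x => f ‖x‖,
      restrict_compl_singleton]
  have h2 := hmp.lintegral_comp_emb (Homeomorph.measurableEmbedding _)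
    (fun p : Metric.sphere (0 : E) 1 × Ioi (0 : ℝ) => f p.2.1)
  simp only [homeomorphUnitSphereProd_apply_snd_coe] at h2
  have hfm : Measurable fun r : Ioi (0 : ℝ) => f r.1 := hf.comp measurable_subtype_coe
  rw [h1, h2, lintegral_prod (fun p : Metric.sphere (0 : E) 1 × Ioi (0 : ℝ) => f p.2.1)
    (hfm.comp measurable_snd).aemeasurable]
  dsimp only
  rw [lintegral_const, mul_comm, Measure.volumeIoiPow,
    lintegral_withDensity_eq_lintegral_mul _ (by fun_prop) hfm]
  congr 1
  exact lintegral_subtype_comap measurableSet_Ioi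
    fun u => ENNReal.ofReal (u ^ (Module.finrank ℝ E - 1)) * f u

/-- Cutting `f` off beyond `ρ` allows `K` to be enlarged to the whole space, where translation
removes `x`. -/
theorem setLIntegral_dist_le {d : ℕ} [NeZero d] {f : ℝ → ℝ≥0∞} (hf : Measurable f)
    {K : Set (EuclideanSpace ℝ (Fin d))} (hK : MeasurableSet K) {x : EuclideanSpace ℝ (Fin d)}
    {ρ : ℝ} (hρ : ∀ y ∈ K, dist x y ≤ ρ) :
    ∫⁻ y in K, f (dist x y) ≤
      (volume : Measure (EuclideanSpace ℝ (Fin d))).toSphere univ *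
        ∫⁻ u in Ioc 0 ρ, ENNReal.ofReal (u ^ (d - 1)) * f u := by
  have : Nontrivial (EuclideanSpace ℝ (Fin d)) :=
    Module.nontrivial_of_finrank_pos (R := ℝ) (by simp [Nat.pos_of_ne_zero (NeZero.ne d)])
  have hg : Measurable ((Iic ρ).indicator f) := hf.indicator measurableSet_Iic
  calc ∫⁻ y in K, f (dist x y)
      = ∫⁻ y in K, (Iic ρ).indicator f (dist x y) :=
        setLIntegral_congr_fun hK fun y hy => (indicator_of_mem (s := Iic ρ) (a := dist x y) (hρ y hy) f).symm
    _ ≤ ∫⁻ y, (Iic ρ).indicator f (dist x y) := setLIntegral_le_lintegral _ _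
    _ = ∫⁻ y, (Iic ρ).indicator f ‖y‖ := by
        simp only [dist_eq_norm]
        exact lintegral_sub_left_eq_self (fun y => (Iic ρ).indicator f ‖y‖) x
    _ = _ := by
        rw [lintegral_norm_eq_toSphere_mul volume hg, finrank_euclideanSpace_fin]
        congr 1
        rw [← Ioi_inter_Iic, inter_comm, ← setLIntegral_indicator measurableSet_Iic]
        refine lintegral_congr fun u => ?_
        by_cases hu : u ≤ ρ <;> simp [hu, indicator]

theorem setLIntegral_setLIntegral_dist_lt_top {d : ℕ} [NeZero d] {f : ℝ → ℝ≥0∞}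
    (hf : Measurable f) {K : Set (EuclideanSpace ℝ (Fin d))} (hK : IsCompact K) {ρ : ℝ}
    (hρ : ∀ x ∈ K, ∀ y ∈ K, dist x y ≤ ρ)
    (hfin : ∫⁻ u in Ioc 0 ρ, ENNReal.ofReal (u ^ (d - 1)) * f u < ⊤) :
    ∫⁻ x in K, ∫⁻ y in K, f (dist x y) < ⊤ := by
  refine (setLIntegral_mono' hK.measurableSet fun x hx =>
    setLIntegral_dist_le hf hK.measurableSet (hρ x hx)).trans_lt ?_
  rw [setLIntegral_const]
  exact ENNReal.mul_lt_top (ENNReal.mul_lt_top (measure_lt_top _ _) hfin) hK.measure_lt_top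

theorem setLIntegral_prod_dist_lt_top {d₁ d₂ : ℕ} [NeZero d₁] [NeZero d₂] {f : ℝ → ℝ → ℝ≥0∞}
    (hf : Measurable (Function.uncurry f)) {I : Set (EuclideanSpace ℝ (Fin d₁))}
    {J : Set (EuclideanSpace ℝ (Fin d₂))} (hI : IsCompact I) (hJ : IsCompact J) {ρ₁ ρ₂ : ℝ}
    (hρ₁ : ∀ x ∈ I, ∀ y ∈ I, dist x y ≤ ρ₁) (hρ₂ : ∀ x ∈ J, ∀ y ∈ J, dist x y ≤ ρ₂)
    (hfin : ∫⁻ u in Ioc 0 ρ₁, ∫⁻ v in Ioc 0 ρ₂,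
      ENNReal.ofReal (u ^ (d₁ - 1)) * ENNReal.ofReal (v ^ (d₂ - 1)) * f u v < ⊤) :
    ∫⁻ a in I ×ˢ J, ∫⁻ b in I ×ˢ J, f (dist a.1 b.1) (dist a.2 b.2) < ⊤ := by
  set σ₁ := (volume : Measure (EuclideanSpace ℝ (Fin d₁))).toSphere univ
  set σ₂ := (volume : Measure (EuclideanSpace ℝ (Fin d₂))).toSphere univ
  have hg : Measurable fun u => ∫⁻ v in Ioc 0 ρ₂, ENNReal.ofReal (v ^ (d₂ - 1)) * f u v := by
    refine Measurable.lintegral_prod_right' (f := fun p : ℝ × ℝ =>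
      ENNReal.ofReal (p.2 ^ (d₂ - 1)) * f p.1 p.2) ?_
    exact (by fun_prop : Measurable fun p : ℝ × ℝ => ENNReal.ofReal (p.2 ^ (d₂ - 1))).mul hf
  have hIJ : MeasurableSet (I ×ˢ J) := hI.measurableSet.prod hJ.measurableSet
  have key : ∀ a ∈ I ×ˢ J, ∫⁻ b in I ×ˢ J, f (dist a.1 b.1) (dist a.2 b.2) ≤
      σ₂ * (σ₁ * ∫⁻ u in Ioc 0 ρ₁, ∫⁻ v in Ioc 0 ρ₂,
        ENNReal.ofReal (u ^ (d₁ - 1)) * ENNReal.ofReal (v ^ (d₂ - 1)) * f u v) := by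
    intro a ha
    have hm : Measurable fun b : EuclideanSpace ℝ (Fin d₁) × EuclideanSpace ℝ (Fin d₂) =>
        f (dist a.1 b.1) (dist a.2 b.2) :=
      hf.comp (g := Function.uncurry f) (f := fun b : EuclideanSpace ℝ (Fin d₁) ×
        EuclideanSpace ℝ (Fin d₂) => (dist a.1 b.1, dist a.2 b.2)) (by fun_prop)
    rw [Measure.volume_eq_prod, ← Measure.prod_restrict, lintegral_prod _ hm.aemeasurable]
    calc ∫⁻ s in I, ∫⁻ y in J, f (dist a.1 s) (dist a.2 y)
        ≤ ∫⁻ s in I, σ₂ * ∫⁻ v in Ioc 0 ρ₂,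
            ENNReal.ofReal (v ^ (d₂ - 1)) * f (dist a.1 s) v := by
          refine lintegral_mono fun s => ?_
          exact setLIntegral_dist_le (hf.comp measurable_prodMk_left) hJ.measurableSet
            (hρ₂ a.2 ha.2)
      _ = σ₂ * ∫⁻ s in I, ∫⁻ v in Ioc 0 ρ₂,
            ENNReal.ofReal (v ^ (d₂ - 1)) * f (dist a.1 s) v :=
          lintegral_const_mul' _ _ (measure_ne_top _ _)
      _ ≤ _ := by
          gcongr
          refine (setLIntegral_dist_le hg hI.measurableSet (hρ₁ a.1 ha.1)).trans (le_of_eq ?_)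
          congr 1
          refine lintegral_congr fun u => ?_
          rw [← lintegral_const_mul' _ _ ENNReal.ofReal_ne_top]
          simp only [mul_assoc]
  refine (setLIntegral_mono' hIJ key).trans_lt ?_
  rw [setLIntegral_const]
  exact ENNReal.mul_lt_top (ENNReal.mul_lt_top (measure_lt_top _ _)
    (ENNReal.mul_lt_top (measure_lt_top _ _) hfin)) (hI.prod hJ).measure_lt_top

/-! ### Finiteness of the potentials -/

/-- Wherever $g\ge\varepsilon$, a bound on $vg$ is a bound on $v$. -/
theorem exists_frequently_le {g : ℝ → ℝ} {v : ℝ → ℝ≥0∞} {A : Set ℝ} {l : Filter ℝ}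
    (hg : ¬ Tendsto g l (𝓝 0)) (hg0 : ∀ᶠ τ in l, 0 ≤ g τ) (hA : ∀ᶠ τ in l, τ ∈ A)
    (hS : ⨆ τ ∈ A, v τ * ENNReal.ofReal (g τ) < ⊤) :
    ∃ S < ⊤, ∃ᶠ τ in l, v τ ≤ S := by
  rw [Metric.tendsto_nhds] at hg
  push Not at hg
  obtain ⟨ε, hε, hfr⟩ := hg
  refine ⟨(⨆ τ ∈ A, v τ * ENNReal.ofReal (g τ)) / ENNReal.ofReal ε,
    ENNReal.div_lt_top hS.ne (by simpa using hε), ?_⟩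
  refine (hfr.and_eventually (hg0.and hA)).mono fun τ h => ?_
  obtain ⟨h1, h2, h3⟩ := h
  rw [Real.dist_eq, sub_zero, abs_of_nonneg h2] at h1
  rw [ENNReal.le_div_iff_mul_le (Or.inl (by simpa using hε)) (Or.inl ENNReal.ofReal_ne_top)]
  exact (mul_le_mul_right (ENNReal.ofReal_le_ofReal h1) _).trans
    (le_iSup₂ (f := fun τ (_ : τ ∈ A) => v τ * ENNReal.ofReal (g τ)) τ h3)

theorem setLIntegral_Ioc_le_of_frequently {μ : Measure ℝ} {F : ℝ → ℝ≥0∞} {φ : ℝ → ℝ} {c : ℝ}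
    {S : ℝ≥0∞} {l : Filter ℝ} (hφ : Tendsto φ l (𝓝 0))
    (h : ∃ᶠ τ in l, ∫⁻ ρ in Ioc (φ τ) c, F ρ ∂μ ≤ S) : ∫⁻ ρ in Ioc 0 c, F ρ ∂μ ≤ S := by
  -- For the measure with density `F`, continuity from below requires no measurability of `F`; the
  -- integrand of $\bar v_q$ involves derivatives and inverse gauges.
  simp only [← withDensity_apply _ measurableSet_Ioc] at h ⊢
  have hU : Ioc (0 : ℝ) c = ⋃ n : ℕ, Ioc (1 / ((n : ℝ) + 1)) c := by
    ext x
    simp only [mem_iUnion, mem_Ioc]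
    refine ⟨fun hx => ?_, fun ⟨n, hn⟩ => ⟨lt_trans (by positivity) hn.1, hn.2⟩⟩
    obtain ⟨n, hn⟩ := exists_nat_one_div_lt hx.1
    exact ⟨n, hn, hx.2⟩
  have hmono : Monotone fun n : ℕ => Ioc (1 / ((n : ℝ) + 1)) c := fun m n hmn =>
    Ioc_subset_Ioc_left (by gcongr)
  rw [hU, hmono.measure_iUnion]
  refine iSup_le fun n => ?_
  have hn : ∀ᶠ τ in l, φ τ ≤ 1 / ((n : ℝ) + 1) := hφ.eventually_le_const (by positivity)
  obtain ⟨τ, h1, h2⟩ := (h.and_eventually hn).exists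
  exact (measure_mono (Ioc_subset_Ioc_left h2)).trans h1

namespace IsGauge

variable {r : ℝ≥0∞} {q : ℝ → ℝ}

theorem tendsto_gaugeInv (hq : IsGauge r q) : Tendsto (gaugeInv r q) (𝓝[>] 0) (𝓝 0) := by
  obtain ⟨b, hb, hb0⟩ := hq.exists_pos_mem
  refine Metric.tendsto_nhds.2 fun ε hε => ?_
  have hε' : (0 : ℝ) < min b (ε / 2) := by positivity
  filter_upwards [hq.eventually_gaugeInv_le
    (mem_gaugeDomain_of_le hb hε'.le (min_le_left _ _)) hε'] with τ hτ
  rw [Real.dist_eq, sub_zero, abs_of_pos hτ.2.1]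
  have := hτ.2.2.trans (min_le_right _ _)
  linarith

/-- Values of `q` outside its domain are arbitrary; clamping the argument supplies a kernel
measurable on all of `ℝ`. -/
theorem exists_continuous_eqOn (hq : IsGauge r q) {ρ : ℝ} (hρ : ρ ∈ gaugeDomain r) :
    ∃ q' : ℝ → ℝ, Continuous q' ∧ EqOn q' q (Icc 0 ρ) := by
  refine ⟨fun u => q (max 0 (min u ρ)), hq.cont.comp_continuous (by fun_prop) fun u =>
    mem_gaugeDomain_of_le hρ (le_max_left _ _) (max_le hρ.1 (min_le_right _ _)), fun u hu => ?_⟩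
  simp only [min_eq_left hu.2, max_eq_right hu.1]

theorem eventually_mem_gaugeRange (hq : IsGauge r q) :
    ∀ᶠ τ in 𝓝[>] (0 : ℝ), τ ∈ gaugeRange r q := by
  obtain ⟨b, hb, hb0⟩ := hq.exists_pos_mem
  exact (hq.eventually_gaugeInv_le hb hb0).mono fun τ hτ => hτ.1

end IsGauge

theorem eventually_mem_Ioc {a : ℝ} (ha : 0 < a) : ∀ᶠ τ in 𝓝[>] (0 : ℝ), τ ∈ Ioc 0 a :=
  Ioc_mem_nhdsGT ha

theorem diam_pos_of_measure_pos {d : ℕ} [NeZero d] {K : Set (EuclideanSpace ℝ (Fin d))}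
    (hK : Bornology.IsBounded K) (hpos : 0 < volume K) : 0 < Metric.diam K := by
  have : Nontrivial (EuclideanSpace ℝ (Fin d)) :=
    Module.nontrivial_of_finrank_pos (R := ℝ) (by simp [Nat.pos_of_ne_zero (NeZero.ne d)])
  by_contra! h
  have hs : K.Subsingleton := fun x hx y hy =>
    dist_le_zero.1 ((Metric.dist_le_diam_of_mem hK hx hy).trans h)
  exact hpos.ne' (hs.measure_zero _)

theorem dist_le_of_mem_closedBall_half {α : Type*} [PseudoMetricSpace α] {x₀ x y : α} {ρ : ℝ}
    (hx : x ∈ Metric.closedBall x₀ (ρ / 2)) (hy : y ∈ Metric.closedBall x₀ (ρ / 2)) :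
    dist x y ≤ ρ := by
  have := dist_triangle_right x y x₀
  rw [Metric.mem_closedBall] at hx hy
  linarith

/-- In polar coordinates, the convergent integral $\int_0q^{-D}\rho^{d-1}d\rho$ bounds the energy of
Lebesgue measure on a small piece of `K` of positive volume. -/
theorem not_isPolarOn_of_not_tendsto_gFun {Ω : Type*} [MeasurableSpace Ω] {P : Measure Ω}
    [IsProbabilityMeasure P] {D : ℕ} [NeZero D] {z : EuclideanSpace ℝ (Fin D)} {d : ℕ} [NeZero d]
    {M : EuclideanSpace ℝ (Fin d) → Ω → EuclideanSpace ℝ (Fin D)}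
    {K : Set (EuclideanSpace ℝ (Fin d))} {r : ℝ≥0∞} {q : ℝ → ℝ} (hM : IsGaussianField P M)
    (hK : IsCompact K) (hpos : 0 < volume K) (hq : IsGauge r q)
    (hlow : LowerHypM P M K r q)
    (hg : ¬ Tendsto (gFun d D r q) (𝓝[>] 0) (𝓝 0)) : ¬ IsPolarOn P M K {z} := by
  obtain ⟨hd, hl, hS⟩ := hlow
  have hΔ := diam_pos_of_measure_pos hK.isBounded hpos
  obtain ⟨S, hST, hfr⟩ := exists_frequently_le (A := Ioc 0 (Metric.diam K) ∩ gaugeRange r q)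
    hg (by
    filter_upwards [self_mem_nhdsWithin, hq.eventually_mem_gaugeRange] with τ hτ hτr
    have h1 : (0 : ℝ) ≤ τ := le_of_lt hτ
    have h2 := (IsGauge.gaugeInv_mem hτr).1
    rw [gFun]
    positivity)
    ((eventually_mem_Ioc hΔ).and hq.eventually_mem_gaugeRange) hS.2
  have hfin := (setLIntegral_Ioc_le_of_frequently hq.tendsto_gaugeInv hfr).trans_lt hST
  obtain ⟨m₀, hm₀, hmain⟩ := hl.exists_not_isPolarOn hM
    (fun x hx y hy => (gauge_dist_bounds hK.isBounded hq hd hx hy).2.1)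
    (fun x hx y hy => (gauge_dist_bounds hK.isBounded hq hd hx hy).2.2) z
  obtain ⟨ρ, ⟨hρ0, hρΔ⟩, hρm⟩ := ((eventually_mem_Ioc hΔ).and
    (hq.tendsto_nhdsGT.eventually (eventually_mem_Ioc hm₀))).exists
  have hρd := mem_gaugeDomain_of_le hd hρ0.le hρΔ
  obtain ⟨x₀, -, hx₀⟩ := exists_measure_inter_closedBall_ne_zero hpos.ne' (half_pos hρ0)
  have hK' : IsCompact (K ∩ Metric.closedBall x₀ (ρ / 2)) :=
    hK.inter_right Metric.isClosed_closedBall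
  have hdist : ∀ x ∈ K ∩ Metric.closedBall x₀ (ρ / 2), ∀ y ∈ K ∩ Metric.closedBall x₀ (ρ / 2),
      dist x y ≤ ρ := fun x hx y hy => dist_le_of_mem_closedBall_half hx.2 hy.2
  obtain ⟨q', hq', heq⟩ := hq.exists_continuous_eqOn hρd
  refine hmain volume _ hK' inter_subset_left hx₀
    (fun x hx y hy => (hq.mono hρd dist_nonneg (hdist x hx y hy)).trans hρm.2) ?_
  have h := setLIntegral_setLIntegral_dist_lt_top
    (f := fun u => (ENNReal.ofReal (q' u))⁻¹ ^ D) (by fun_prop) hK' hdist (by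
      refine lt_of_le_of_lt ?_ hfin
      refine (setLIntegral_mono' measurableSet_Ioc fun u hu => le_of_eq ?_).trans
        (lintegral_mono_set (Ioc_subset_Ioc_right hρΔ))
      have hqu := hq.apply_pos (mem_gaugeDomain_of_le hρd hu.1.le hu.2) hu.1
      have hu0 := hu.1
      rw [heq ⟨hu.1.le, hu.2⟩, ← ENNReal.ofReal_inv_of_pos hqu,
        ← ENNReal.ofReal_pow (by positivity), ← ENNReal.ofReal_mul (by positivity), inv_pow,
        div_eq_mul_inv])
  refine lt_of_le_of_lt (le_of_eq ?_) h
  refine setLIntegral_congr_fun hK'.measurableSet fun x hx =>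
    setLIntegral_congr_fun hK'.measurableSet fun y hy => ?_
  simp only [heq ⟨dist_nonneg, hdist x hx y hy⟩]

/-! ### Nonpolarity for two gauge functions -/

/-- Mean value theorem: strict growth makes $\dot q$ positive somewhere to the right of $x$, and
$q(x)=x\dot q(\xi)$ with $\xi<x$; since $\dot q$ decreases, both facts transfer to $x$. -/
theorem IsGauge.deriv_pos_and_mul_deriv_le {r : ℝ≥0∞} {q : ℝ → ℝ} (hq : IsGauge r q)
    (hdiff : ∀ x ∈ gaugeDomain r, 0 < x → DifferentiableAt ℝ q x) {b : ℝ}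
    (hb : b ∈ gaugeDomain r) (ha : AntitoneOn (deriv q) (Ioo 0 b)) {x : ℝ} (hx : x ∈ Ioo 0 b) :
    0 < deriv q x ∧ x * deriv q x ≤ q x := by
  have hmem : ∀ y ∈ Icc 0 b, y ∈ gaugeDomain r := fun y hy => mem_gaugeDomain_of_le hb hy.1 hy.2
  have hx0 := hx.1
  constructor
  · obtain ⟨ξ, hξ, h⟩ := exists_deriv_eq_slope q hx.2
      (hq.cont.mono fun y hy => hmem y ⟨hx0.le.trans hy.1, hy.2⟩)
      (fun y hy => (hdiff y (hmem y ⟨(hx0.trans hy.1).le, hy.2.le⟩)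
        (hx0.trans hy.1)).differentiableWithinAt)
    have h1 : 0 < deriv q ξ := by
      rw [h]
      exact div_pos (sub_pos.2 (hq.strictMono (hmem x ⟨hx0.le, hx.2.le⟩) hb hx.2))
        (sub_pos.2 hx.2)
    exact h1.trans_le (ha hx ⟨hx0.trans hξ.1, hξ.2⟩ hξ.1.le)
  · obtain ⟨ξ, hξ, h⟩ := exists_deriv_eq_slope q hx0
      (hq.cont.mono fun y hy => hmem y ⟨hy.1, hy.2.trans hx.2.le⟩)
      (fun y hy => (hdiff y (hmem y ⟨hy.1.le, (hy.2.trans hx.2).le⟩)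
        hy.1).differentiableWithinAt)
    rw [hq.zero, sub_zero, sub_zero, eq_div_iff hx0.ne'] at h
    have h1 := ha ⟨hξ.1, hξ.2.trans hx.2⟩ hx hξ.2.le
    nlinarith

/-- The integrand of `v̄_q`. -/
noncomputable def vBarDensity (d₁ d₂ D : ℕ) (r₁ r₂ : ℝ≥0∞) (q₁ q₂ : ℝ → ℝ) (ρ : ℝ) : ℝ≥0∞ :=
  ENNReal.ofReal (ρ ^ (1 - (D : ℤ)) * gaugeInv r₁ q₁ ρ ^ (d₁ - 1) * gaugeInv r₂ q₂ ρ ^ (d₂ - 1)) *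
    (ENNReal.ofReal (deriv q₁ (gaugeInv r₁ q₁ ρ)))⁻¹ *
    (ENNReal.ofReal (deriv q₂ (gaugeInv r₂ q₂ ρ)))⁻¹

theorem vBarDensity_comm (d₁ d₂ D : ℕ) (r₁ r₂ : ℝ≥0∞) (q₁ q₂ : ℝ → ℝ) :
    vBarDensity d₂ d₁ D r₂ r₁ q₂ q₁ = vBarDensity d₁ d₂ D r₁ r₂ q₁ q₂ := by
  ext ρ
  rw [vBarDensity, vBarDensity, mul_right_comm, mul_right_comm (ρ ^ (1 - (D : ℤ)))]

/-- The part of the energy integral where the first gauge function dominates. -/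
theorem lintegral_lintegral_le_vBarDensity {d₁ d₂ D : ℕ} [NeZero d₂] {r₁ r₂ : ℝ≥0∞}
    {q₁ q₂ : ℝ → ℝ} (h₁ : IsGauge r₁ q₁) (h₂ : IsGauge r₂ q₂) {ρ₁ ρ₂ : ℝ}
    (hρ₁ : ρ₁ ∈ gaugeDomain r₁) (hρ₂ : ρ₂ ∈ gaugeDomain r₂) (heq : q₁ ρ₁ = q₂ ρ₂)
    (hd₁ : ∀ u ∈ Ioc 0 ρ₁, DifferentiableAt ℝ q₁ u ∧ 0 < deriv q₁ u)
    (hd₂ : ∀ v ∈ Ioc 0 ρ₂, 0 < deriv q₂ v ∧ v * deriv q₂ v ≤ q₂ v) {k : ℝ → ℝ → ℝ≥0∞}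
    (hk : ∀ u ∈ Ioc 0 ρ₁, ∀ v ∈ Ioc 0 ρ₂, q₂ v ≤ q₁ u → k u v ≤
      ENNReal.ofReal (u ^ (d₁ - 1)) * ENNReal.ofReal (v ^ (d₂ - 1)) *
        (ENNReal.ofReal (q₁ u))⁻¹ ^ D)
    (hk0 : ∀ u ∈ Ioc 0 ρ₁, ∀ v ∈ Ioc 0 ρ₂, q₁ u < q₂ v → k u v = 0) :
    ∫⁻ u in Ioc 0 ρ₁, ∫⁻ v in Ioc 0 ρ₂, k u v ≤
      ∫⁻ α in Ioc 0 (q₁ ρ₁), vBarDensity d₁ d₂ D r₁ r₂ q₁ q₂ α := by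
  have hpt : ∀ u ∈ Ioc 0 ρ₁, ∫⁻ v in Ioc 0 ρ₂, k u v ≤
      ENNReal.ofReal (deriv q₁ u) * vBarDensity d₁ d₂ D r₁ r₂ q₁ q₂ (q₁ u) := by
    intro u hu
    have hu0 := hu.1
    have hum := mem_gaugeDomain_of_le hρ₁ hu0.le hu.2
    have hα := h₁.apply_pos hum hu0
    have hα' : q₁ u ≤ q₂ ρ₂ := heq ▸ h₁.mono hρ₁ hu0.le hu.2
    have hr := h₂.mem_gaugeRange hρ₂ hα.le hα'
    set α := q₁ u with hαdef
    -- For fixed $u$ the region $q_2(v)\le q_1(u)$ is $v\le H$, so the inner integral is at most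
    -- $cH$.
    set H := gaugeInv r₂ q₂ α with hH
    have hH0 : 0 < H := h₂.gaugeInv_pos hr hα
    have hHρ : H ≤ ρ₂ := h₂.gaugeInv_le hρ₂ hα.le hα'
    have hHα : q₂ H = α := IsGauge.apply_gaugeInv hr
    obtain ⟨hdu, hdu0⟩ := hd₁ u hu
    obtain ⟨hdH, hdH'⟩ := hd₂ H ⟨hH0, hHρ⟩
    rw [hHα] at hdH'
    have hu1 : gaugeInv r₁ q₁ α = u := h₁.gaugeInv_apply hum
    set c := ENNReal.ofReal (u ^ (d₁ - 1)) * ENNReal.ofReal (H ^ (d₂ - 1)) *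
      (ENNReal.ofReal α)⁻¹ ^ D with hc
    calc ∫⁻ v in Ioc 0 ρ₂, k u v ≤ ∫⁻ v in Ioc 0 ρ₂, (Iic H).indicator (fun _ => c) v := by
          refine setLIntegral_mono' measurableSet_Ioc fun v hv => ?_
          by_cases hvH : v ≤ H
          · rw [indicator_of_mem (mem_Iic.2 hvH)]
            have hv0 := hv.1
            refine (hk u hu v hv ((h₂.mono (IsGauge.gaugeInv_mem hr) hv0.le hvH).trans hHα.le)).trans ?_
            rw [hc]
            gcongr
          · rw [hk0 u hu v hv]
            · exact zero_le
            · rw [← hαdef, ← hHα]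
              exact h₂.strictMono (IsGauge.gaugeInv_mem hr) (mem_gaugeDomain_of_le hρ₂ hv.1.le hv.2)
                (not_le.1 hvH)
      _ ≤ c * ENNReal.ofReal H := by
          rw [setLIntegral_indicator measurableSet_Iic, setLIntegral_const]
          gcongr
          refine (measure_mono (t := Ioc 0 H) fun v hv => ⟨hv.2.1, hv.1⟩).trans ?_
          simp
      _ ≤ _ := by
          rw [vBarDensity, hu1, ← hH, hc, ← ENNReal.ofReal_inv_of_pos hα,
            ← ENNReal.ofReal_inv_of_pos hdu0, ← ENNReal.ofReal_inv_of_pos hdH,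
            ← ENNReal.ofReal_pow (by positivity), ← ENNReal.ofReal_mul (by positivity),
            ← ENNReal.ofReal_mul (by positivity), ← ENNReal.ofReal_mul (by positivity),
            ← ENNReal.ofReal_mul (by positivity), ← ENNReal.ofReal_mul (by positivity),
            ← ENNReal.ofReal_mul (by positivity)]
          refine ENNReal.ofReal_le_ofReal ?_
          -- Decreasing derivatives enter here: one factor $H$ is traded for $\alpha/\dot q_2(H)$,
          -- and the substitution $\alpha=q_1(u)$ then produces the integrand of $\bar v_q$.
          have hH1 : H ≤ α * (deriv q₂ H)⁻¹ := by
            rw [← div_eq_mul_inv, le_div_iff₀ hdH]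
            exact hdH'
          calc u ^ (d₁ - 1) * H ^ (d₂ - 1) * α⁻¹ ^ D * H
              ≤ u ^ (d₁ - 1) * H ^ (d₂ - 1) * α⁻¹ ^ D * (α * (deriv q₂ H)⁻¹) := by gcongr
            _ = _ := by
              rw [zpow_sub₀ hα.ne', zpow_one, zpow_natCast, inv_pow]
              field_simp
  calc ∫⁻ u in Ioc 0 ρ₁, ∫⁻ v in Ioc 0 ρ₂, k u v
      ≤ ∫⁻ u in Ioc 0 ρ₁,
          ENNReal.ofReal (deriv q₁ u) * vBarDensity d₁ d₂ D r₁ r₂ q₁ q₂ (q₁ u) :=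
        setLIntegral_mono' measurableSet_Ioc hpt
    _ = ∫⁻ α in q₁ '' Ioc 0 ρ₁, vBarDensity d₁ d₂ D r₁ r₂ q₁ q₂ α :=
        (lintegral_image_eq_lintegral_deriv_mul_of_monotoneOn measurableSet_Ioc
          (fun u hu => (hd₁ u hu).1.hasDerivAt.hasDerivWithinAt)
          (h₁.strictMono.monotoneOn.mono fun u hu =>
            mem_gaugeDomain_of_le hρ₁ hu.1.le hu.2) _).symm
    _ ≤ _ := by
        refine lintegral_mono_set ?_
        rintro _ ⟨u, hu, rfl⟩
        exact ⟨h₁.apply_pos (mem_gaugeDomain_of_le hρ₁ hu.1.le hu.2) hu.1,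
          h₁.mono hρ₁ hu.1.le hu.2⟩

/-- Split by which gauge is larger and drop the smaller one. The two halves are exchanged by
swapping indices, which preserves the density, and `q₁ ρ₁ = q₂ ρ₂` gives both the same range of
$\alpha$. -/
theorem lintegral_lintegral_add_inv_pow_lt_top {d₁ d₂ D : ℕ} [NeZero d₁] [NeZero d₂]
    {r₁ r₂ : ℝ≥0∞} {q₁ q₂ : ℝ → ℝ} (h₁ : IsGauge r₁ q₁) (h₂ : IsGauge r₂ q₂) {ρ₁ ρ₂ : ℝ}
    (hρ₁ : ρ₁ ∈ gaugeDomain r₁) (hρ₂ : ρ₂ ∈ gaugeDomain r₂) (heq : q₁ ρ₁ = q₂ ρ₂)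
    (hd₁ : ∀ u ∈ Ioc 0 ρ₁, DifferentiableAt ℝ q₁ u ∧ 0 < deriv q₁ u ∧ u * deriv q₁ u ≤ q₁ u)
    (hd₂ : ∀ v ∈ Ioc 0 ρ₂, DifferentiableAt ℝ q₂ v ∧ 0 < deriv q₂ v ∧ v * deriv q₂ v ≤ q₂ v)
    {p₁ p₂ : ℝ → ℝ} (hp₁ : Continuous p₁) (hp₂ : Continuous p₂) (hpq₁ : EqOn p₁ q₁ (Icc 0 ρ₁))
    (hpq₂ : EqOn p₂ q₂ (Icc 0 ρ₂))
    (hfin : ∫⁻ α in Ioc 0 (q₁ ρ₁), vBarDensity d₁ d₂ D r₁ r₂ q₁ q₂ α < ⊤) :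
    ∫⁻ u in Ioc 0 ρ₁, ∫⁻ v in Ioc 0 ρ₂, ENNReal.ofReal (u ^ (d₁ - 1)) *
      ENNReal.ofReal (v ^ (d₂ - 1)) * (ENNReal.ofReal (p₁ u + p₂ v))⁻¹ ^ D < ⊤ := by
  set G : ℝ × ℝ → ℝ≥0∞ := fun a => ENNReal.ofReal (a.1 ^ (d₁ - 1)) *
      ENNReal.ofReal (a.2 ^ (d₂ - 1)) * (ENNReal.ofReal (p₁ a.1 + p₂ a.2))⁻¹ ^ D with hG
  have hGm : Measurable G := by fun_prop
  set W : Set (ℝ × ℝ) := {a | p₂ a.2 ≤ p₁ a.1} with hW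
  have hWm : MeasurableSet W := measurableSet_le (by fun_prop) (by fun_prop)
  have hA := lintegral_lintegral_le_vBarDensity (d₁ := d₁) (d₂ := d₂) (D := D) h₁ h₂ hρ₁ hρ₂ heq
    (fun u hu => ⟨(hd₁ u hu).1, (hd₁ u hu).2.1⟩) (fun v hv => (hd₂ v hv).2)
    (k := fun u v => W.indicator G (u, v)) (fun u hu v hv _ => by
      refine (indicator_le_self' (fun _ _ => zero_le) _).trans ?_
      have h0 := h₂.apply_nonneg (mem_gaugeDomain_of_le hρ₂ hv.1.le hv.2)
      simp only [hG, hpq₁ ⟨hu.1.le, hu.2⟩, hpq₂ ⟨hv.1.le, hv.2⟩]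
      gcongr
      linarith) (fun u hu v hv huv => indicator_of_notMem (by
        simpa [hW, hpq₁ ⟨hu.1.le, hu.2⟩, hpq₂ ⟨hv.1.le, hv.2⟩] using huv) _)
  have hB := lintegral_lintegral_le_vBarDensity (d₁ := d₂) (d₂ := d₁) (D := D) h₂ h₁ hρ₂ hρ₁
    heq.symm (fun u hu => ⟨(hd₂ u hu).1, (hd₂ u hu).2.1⟩) (fun v hv => (hd₁ v hv).2)
    (k := fun v u => Wᶜ.indicator G (u, v)) (fun v hv u hu _ => by
      refine (indicator_le_self' (fun _ _ => zero_le) _).trans ?_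
      have h0 := h₁.apply_nonneg (mem_gaugeDomain_of_le hρ₁ hu.1.le hu.2)
      simp only [hG, hpq₁ ⟨hu.1.le, hu.2⟩, hpq₂ ⟨hv.1.le, hv.2⟩]
      rw [mul_comm (ENNReal.ofReal (u ^ (d₁ - 1)))]
      gcongr
      linarith) (fun v hv u hu huv => indicator_of_notMem (by
        simpa [hW, hpq₁ ⟨hu.1.le, hu.2⟩, hpq₂ ⟨hv.1.le, hv.2⟩] using huv.le) _)
  rw [vBarDensity_comm, ← heq] at hB
  have hm₁ : Measurable (W.indicator G) := hGm.indicator hWm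
  have hm₂ : Measurable (Wᶜ.indicator G) := hGm.indicator hWm.compl
  rw [lintegral_lintegral_swap (by exact (hm₂.comp measurable_swap).aemeasurable)] at hB
  calc ∫⁻ u in Ioc 0 ρ₁, ∫⁻ v in Ioc 0 ρ₂, G (u, v)
      = ∫⁻ u in Ioc 0 ρ₁, ((∫⁻ v in Ioc 0 ρ₂, W.indicator G (u, v)) +
          ∫⁻ v in Ioc 0 ρ₂, Wᶜ.indicator G (u, v)) := by
        refine lintegral_congr fun u => ?_
        refine Eq.trans ?_ (lintegral_add_left (hm₁.comp measurable_prodMk_left) _)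
        refine lintegral_congr fun v => ?_
        exact (congrFun (indicator_self_add_compl W G) (u, v)).symm
    _ = (∫⁻ u in Ioc 0 ρ₁, ∫⁻ v in Ioc 0 ρ₂, W.indicator G (u, v)) +
          ∫⁻ u in Ioc 0 ρ₁, ∫⁻ v in Ioc 0 ρ₂, Wᶜ.indicator G (u, v) :=
        lintegral_add_left hm₁.lintegral_prod_right' _
    _ < ⊤ := ENNReal.add_lt_top.2 ⟨hA.trans_lt hfin, hB.trans_lt hfin⟩

theorem not_isPolarOn_of_not_tendsto_gBarFun {Ω : Type*} [MeasurableSpace Ω] {P : Measure Ω}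
    [IsProbabilityMeasure P] {D : ℕ} [NeZero D] {z : EuclideanSpace ℝ (Fin D)} {d₁ d₂ : ℕ}
    [NeZero d₁] [NeZero d₂]
    {U : EuclideanSpace ℝ (Fin d₁) × EuclideanSpace ℝ (Fin d₂) → Ω → EuclideanSpace ℝ (Fin D)}
    {I : Set (EuclideanSpace ℝ (Fin d₁))} {J : Set (EuclideanSpace ℝ (Fin d₂))} {r₁ r₂ : ℝ≥0∞}
    {q₁ q₂ : ℝ → ℝ} (hU : IsGaussianField P U) (hI : IsCompact I) (hI0 : 0 < volume I)
    (hJ : IsCompact J) (hJ0 : 0 < volume J) (hq₁ : IsRegularGauge d₁ r₁ q₁)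
    (hq₂ : IsRegularGauge d₂ r₂ q₂) (hlow : LowerHypU P U I J r₁ r₂ q₁ q₂)
    (hg : ¬ Tendsto (gBarFun d₁ d₂ D r₁ r₂ q₁ q₂) (𝓝[>] 0) (𝓝 0)) :
    ¬ IsPolarOn P U (I ×ˢ J) {z} := by
  obtain ⟨hdI, hdJ, hl, ⟨δ, hδ, ha₁, ha₂⟩, hS⟩ := hlow
  have hΔ₁ := diam_pos_of_measure_pos hI.isBounded hI0
  have hΔ₂ := diam_pos_of_measure_pos hJ.isBounded hJ0
  have h₁ := hq₁.toIsGauge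
  have h₂ := hq₂.toIsGauge
  have hc : 0 < cIJ I J q₁ q₂ := lt_max_of_lt_left (h₁.apply_pos hdI hΔ₁)
  have hrange := h₁.eventually_mem_gaugeRange.and h₂.eventually_mem_gaugeRange
  obtain ⟨S, hST, hfr⟩ := exists_frequently_le
    (A := Ioc 0 (cIJ I J q₁ q₂) ∩ (gaugeRange r₁ q₁ ∩ gaugeRange r₂ q₂)) hg (by
    filter_upwards [self_mem_nhdsWithin, hrange] with τ hτ hτr
    have hτ0 : (0 : ℝ) ≤ τ := le_of_lt hτ
    have k₁ := (IsGauge.gaugeInv_mem hτr.1).1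
    have k₂ := (IsGauge.gaugeInv_mem hτr.2).1
    rw [gBarFun]
    positivity)
    ((eventually_mem_Ioc hc).and hrange) hS.2
  -- The potential is bounded at $\tau/2$ rather than $\tau$; as $\tau/2\to0$ too, this is harmless.
  have hhalf : Tendsto (fun τ : ℝ => τ / 2) (𝓝[>] 0) (𝓝 0) := by
    have := ((continuous_id (X := ℝ)).div_const 2).tendsto 0
    rw [id, zero_div] at this
    exact this.mono_left nhdsWithin_le_nhds
  have hfin : ∫⁻ α in Ioc 0 (cIJ I J q₁ q₂) ∩ (gaugeRange r₁ q₁ ∩ gaugeRange r₂ q₂),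
      vBarDensity d₁ d₂ D r₁ r₂ q₁ q₂ α < ⊤ := by
    rw [← Measure.restrict_restrict measurableSet_Ioc]
    refine (setLIntegral_Ioc_le_of_frequently hhalf (hfr.mono fun τ hτ => ?_)).trans_lt hST
    rwa [Measure.restrict_restrict measurableSet_Ioc]
  have hm : ∀ a ∈ I ×ˢ J, ∀ b ∈ I ×ˢ J, 0 ≤ q₁ (dist a.1 b.1) + q₂ (dist a.2 b.2) ∧
      q₁ (dist a.1 b.1) + q₂ (dist a.2 b.2) ≤ q₁ (Metric.diam I) + q₂ (Metric.diam J) := by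
    intro a ha b hb
    have k₁ := gauge_dist_bounds hI.isBounded h₁ hdI ha.1 hb.1
    have k₂ := gauge_dist_bounds hJ.isBounded h₂ hdJ ha.2 hb.2
    exact ⟨add_nonneg k₁.2.1 k₂.2.1, add_le_add k₁.2.2 k₂.2.2⟩
  obtain ⟨m₀, hm₀, hmain⟩ := hl.exists_not_isPolarOn hU (fun a ha b hb => (hm a ha b hb).1)
    (fun a ha b hb => (hm a ha b hb).2) z
  -- Below this minimum the derivative decreases and the gauge is defined; taking $\rho_i$ at most
  -- half of it keeps `Ioc 0 ρᵢ` in the open interval.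
  have hb₁ : 0 < min δ (Metric.diam I) := lt_min hδ hΔ₁
  have hb₂ : 0 < min δ (Metric.diam J) := lt_min hδ hΔ₂
  have hbd₁ := mem_gaugeDomain_of_le hdI hb₁.le (min_le_right _ _)
  have hbd₂ := mem_gaugeDomain_of_le hdJ hb₂.le (min_le_right _ _)
  -- The bound $\tau\le m_0/2$ accounts for the two gauges, each contributing up to $\tau$ to the
  -- metric.
  obtain ⟨τ, ⟨hτ0, hτc⟩, ⟨-, hτm⟩, ⟨hr₁, hρ₁0, hρ₁b⟩, hr₂, hρ₂0, hρ₂b⟩ :=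
    ((eventually_mem_Ioc hc).and
      ((eventually_mem_Ioc (half_pos hm₀)).and
      ((h₁.eventually_gaugeInv_le (mem_gaugeDomain_of_le hbd₁ (half_pos hb₁).le
        (half_le_self hb₁.le)) (half_pos hb₁)).and
      (h₂.eventually_gaugeInv_le (mem_gaugeDomain_of_le hbd₂ (half_pos hb₂).le
        (half_le_self hb₂.le)) (half_pos hb₂))))).exists
  set ρ₁ := gaugeInv r₁ q₁ τ with hρ₁
  set ρ₂ := gaugeInv r₂ q₂ τ with hρ₂
  have hqρ₁ : q₁ ρ₁ = τ := IsGauge.apply_gaugeInv hr₁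
  have hqρ₂ : q₂ ρ₂ = τ := IsGauge.apply_gaugeInv hr₂
  have hρd₁ : ρ₁ ∈ gaugeDomain r₁ := IsGauge.gaugeInv_mem hr₁
  have hρd₂ : ρ₂ ∈ gaugeDomain r₂ := IsGauge.gaugeInv_mem hr₂
  obtain ⟨x₁, -, hx₁⟩ := exists_measure_inter_closedBall_ne_zero hI0.ne' (half_pos hρ₁0)
  obtain ⟨x₂, -, hx₂⟩ := exists_measure_inter_closedBall_ne_zero hJ0.ne' (half_pos hρ₂0)
  set I' := I ∩ Metric.closedBall x₁ (ρ₁ / 2) with hI'def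
  set J' := J ∩ Metric.closedBall x₂ (ρ₂ / 2) with hJ'def
  have hI' : IsCompact I' := hI.inter_right Metric.isClosed_closedBall
  have hJ' : IsCompact J' := hJ.inter_right Metric.isClosed_closedBall
  have hdist₁ : ∀ x ∈ I', ∀ y ∈ I', dist x y ≤ ρ₁ :=
    fun x hx y hy => dist_le_of_mem_closedBall_half hx.2 hy.2
  have hdist₂ : ∀ x ∈ J', ∀ y ∈ J', dist x y ≤ ρ₂ :=
    fun x hx y hy => dist_le_of_mem_closedBall_half hx.2 hy.2
  obtain ⟨p₁, hp₁, hpq₁⟩ := h₁.exists_continuous_eqOn hρd₁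
  obtain ⟨p₂, hp₂, hpq₂⟩ := h₂.exists_continuous_eqOn hρd₂
  refine hmain volume (I' ×ˢ J') (hI'.prod hJ') (prod_mono inter_subset_left inter_subset_left)
    ?_ (fun a ha b hb => ?_) ?_
  · rw [Measure.volume_eq_prod, Measure.prod_prod]
    exact mul_ne_zero hx₁ hx₂
  · have k₁ := h₁.mono hρd₁ dist_nonneg (hdist₁ a.1 ha.1 b.1 hb.1)
    have k₂ := h₂.mono hρd₂ dist_nonneg (hdist₂ a.2 ha.2 b.2 hb.2)
    linarith
  have henergy := lintegral_lintegral_add_inv_pow_lt_top (d₁ := d₁) (d₂ := d₂) (D := D) h₁ h₂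
    hρd₁ hρd₂ (hqρ₁.trans hqρ₂.symm)
    (fun u hu => ⟨hq₁.diff u (mem_gaugeDomain_of_le hρd₁ hu.1.le hu.2) hu.1,
      h₁.deriv_pos_and_mul_deriv_le hq₁.diff hbd₁
        (ha₁.mono (Ioo_subset_Ioo_right (min_le_left _ _))) ⟨hu.1, by linarith [hu.2]⟩⟩)
    (fun u hu => ⟨hq₂.diff u (mem_gaugeDomain_of_le hρd₂ hu.1.le hu.2) hu.1,
      h₂.deriv_pos_and_mul_deriv_le hq₂.diff hbd₂
        (ha₂.mono (Ioo_subset_Ioo_right (min_le_left _ _))) ⟨hu.1, by linarith [hu.2]⟩⟩)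
    hp₁ hp₂ hpq₁ hpq₂ (by
      have hsub : Ioc 0 (q₁ ρ₁) ⊆
          Ioc 0 (cIJ I J q₁ q₂) ∩ (gaugeRange r₁ q₁ ∩ gaugeRange r₂ q₂) := fun α hα =>
        ⟨⟨hα.1, hα.2.trans (hqρ₁.le.trans hτc)⟩, h₁.mem_gaugeRange hρd₁ hα.1.le hα.2,
          h₂.mem_gaugeRange hρd₂ hα.1.le (hα.2.trans (hqρ₁.trans hqρ₂.symm).le)⟩
      exact (lintegral_mono_set hsub).trans_lt hfin)
  have h := setLIntegral_prod_dist_lt_top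
    (f := fun u v => (ENNReal.ofReal (p₁ u + p₂ v))⁻¹ ^ D) (by unfold Function.uncurry; fun_prop)
    hI' hJ' hdist₁ hdist₂ henergy
  refine lt_of_le_of_lt (le_of_eq ?_) h
  have hIJ : MeasurableSet (I' ×ˢ J') := hI'.measurableSet.prod hJ'.measurableSet
  refine setLIntegral_congr_fun hIJ fun a ha => setLIntegral_congr_fun hIJ fun b hb => ?_
  simp only [hpq₁ ⟨dist_nonneg, hdist₁ a.1 ha.1 b.1 hb.1⟩,
    hpq₂ ⟨dist_nonneg, hdist₂ a.2 ha.2 b.2 hb.2⟩]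

/-! ### The two equivalences -/

theorem propositions2 {Ω : Type*} [MeasurableSpace Ω] (P : Measure Ω) [IsProbabilityMeasure P]
    (D : ℕ) [NeZero D] (z : EuclideanSpace ℝ (Fin D)) :
    (∀ (d : ℕ) [NeZero d] (M : EuclideanSpace ℝ (Fin d) → Ω → EuclideanSpace ℝ (Fin D))
        (K : Set (EuclideanSpace ℝ (Fin d))) (r : ℝ≥0∞) (q : ℝ → ℝ),
        IsGaussianField P M → IsCompact K → 0 < volume K →
        UpperHypM P M K r q → LowerHypM P M K r q →
        (IsPolarOn P M K {z} ↔ Tendsto (gFun d D r q) (𝓝[>] 0) (𝓝 0))) ∧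
    (∀ (d₁ d₂ : ℕ) [NeZero d₁] [NeZero d₂]
        (U : EuclideanSpace ℝ (Fin d₁) × EuclideanSpace ℝ (Fin d₂) → Ω → EuclideanSpace ℝ (Fin D))
        (I : Set (EuclideanSpace ℝ (Fin d₁))) (J : Set (EuclideanSpace ℝ (Fin d₂)))
        (r₁ r₂ : ℝ≥0∞) (q₁ q₂ : ℝ → ℝ),
        IsGaussianField P U → IsCompact I → 0 < volume I → IsCompact J → 0 < volume J →
        UpperHypU P U I J r₁ r₂ q₁ q₂ → LowerHypU P U I J r₁ r₂ q₁ q₂ →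
        (IsPolarOn P U (I ×ˢ J) {z} ↔
          Tendsto (gBarFun d₁ d₂ D r₁ r₂ q₁ q₂) (𝓝[>] 0) (𝓝 0))) := by
  refine ⟨fun d _ M K r q hM hK hpos hup hlow => ?_,
    fun d₁ d₂ _ _ U I J r₁ r₂ q₁ q₂ hU hI hI0 hJ hJ0 hup hlow => ?_⟩
  · refine ⟨fun hpol => ?_, isPolarOn_of_tendsto_gFun hM hK hup.1 hlow.1 hlow.2.1⟩
    by_contra hg
    exact not_isPolarOn_of_not_tendsto_gFun hM hK hpos hup.1.toIsGauge hlow hg hpol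
  · refine ⟨fun hpol => ?_, isPolarOn_of_tendsto_gBarFun hU hI hJ hup.1 hup.2.1 hlow.1 hlow.2.1
      hlow.2.2.1⟩
    by_contra hg
    exact not_isPolarOn_of_not_tendsto_gBarFun hU hI hI0 hJ hJ0 hup.1 hup.2.1 hlow hg hpol
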